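/- **Setting.** Fix $K\ge 1$, factor numbers $r_1,\dots,r_K\ge 1$, and constants $\epsilon\in(0,1)$, $\omega,c_0,c_\epsilon>0$, $\bar\lambda<\infty$, $0<\alpha^{(k)}_j\le\beta^{(k)}_j$ ($j\le r_k$) with $\alpha^{(k)}_j>\beta^{(k)}_{j+1}$. For sample size $n$ and dimensions $p_1,\dots,p_K$ write $p=\prod_k p_k$, $p_{-k}=p/p_k$, and let $\mathrm{mat}_k$ be the mode-$k$ unfolding and $|\cdot|_2$ the Euclidean norm of the entries. We observe $\mathcal X_t=\mathcal F_t\times_1\Lambda_1\times_2\cdots\times_K\Lambda_K+\xi_t\in\mathbb R^{p_1\times\cdots\times p_K}$, $1\le t\le n$, where $\Lambda_k\in\mathbb R^{p_k\times r_k}$, $\mathcal F_t\in\mathbb R^{r_1\times\cdots\times r_K}$ is deterministic, $\xi_{\mathbf i,t}$ ($\mathbf i\in\prod_k[p_k]$, $t\in\mathbb Z$) are random with mean $0$, and: 1. $p_k^{-1}\Lambda_k^\top\Lambda_k=I_{r_k}$ and all entries of $\Lambda_k$ are at most $\bar\lambda$ in absolute value. 2. $n^{-1}\sum_{t\le n}\mathrm{mat}_k(\mathcal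 F_t)\mathrm{mat}_k(\mathcal F_t)^\top$ is diagonal with $j$-th diagonal entry in $[\alpha_j^{(k)},\beta_j^{(k)}]$. 3. $\|\xi_{\mathbf i,t}\|_{2+2\epsilon}\le\omega$ for all $\mathbf i,t$; $n^{-1}\sum_{t\le n}|\mathcal F_t|_2^\nu\le\omega^\nu$ for $\nu\in\{1+\epsilon,2,2+2\epsilon\}$; and $\max(\max_{t\le n}|\mathcal F_t|_2,\omega)\le M_n$, where $M_n$ may diverge. 4. One of the following two settings holds throughout, where $\alpha(\mathcal A,\mathcal B)=\sup_{A\in\mathcal A,B\in\mathcal B}|P(A\cap B)-P(A)P(B)|$ and $\Sigma(a)=n^{-1}\sum_{t,u\le n}|\mathcal F_t|_2^{1+\epsilon}|\mathcal F_u|_2^{1+\epsilon}e^{-a|t-u|}$. * *(Independence.)* The time series $\{\xi_{\mathbf i,t}\}_{t\in\mathbb Z}$ are mutually independent over $\mathbf i$; $\alpha(\sigma\{\xi_{\mathbf i,u}:u\le t\},\sigma\{\xi_{\mathbf i,v}:v\ge t+m\})\le e^{-c_0m}$ for all $\mathbf i$, $t$ and $m\ge0$; $\Sigma(\tfrac{c_0\epsilon}{1+\epsilon})\le\omega^{2+2\epsilon}c_\epsilon$;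 and $\Sigma(\tfrac{c_0}{3\log(np_{-k})})\le\omega^{2+2\epsilon}c_\epsilon\log(np_{-k})$ for all $k$. Put $\ell_k=\log(np_{-k})$. * *(Random field.)* $\alpha(\sigma\{\xi_{\mathbf i,t}:(\mathbf i,t)\in E_1\},\sigma\{\xi_{\mathbf i,t}:(\mathbf i,t)\in E_2\})\le e^{-c_0m}$ for all $m\ge0$ and all sets of sites $E_1,E_2$ such that $\max(\max_k|i_k-j_k|,|t-u|)\ge m$ for all $(\mathbf i,t)\in E_1$, $(\mathbf j,u)\in E_2$; $\Sigma(\tfrac{c_0\epsilon}{K(1+\epsilon)})\le\omega^{2+2\epsilon}c_\epsilon K$; and $\Sigma(\tfrac{c_0}{3K\log(np)})\le\omega^{2+2\epsilon}c_\epsilon K\log(np)$. Put $\ell_k=\log^K(np)$. Let $\tau^{(k)}_{n,p}=\omega(np_{-k}/\ell_k)^{1/(2+2\epsilon)}$ and $\psi^{(k)}_{n,p}=\omega^2(\ell_k/(np_{-k}))^{\epsilon/(1+\epsilon)}$. **Estimator.** For truncation levels $\tau_k>0$ (possibly all equal), let $\mathcal X_t^{\tau}$ have entries $\mathrm{sign}(X_{\mathbf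 i,t})(|X_{\mathbf i,t}|\wedge\tau)$, and let $\hat e^{(k)}_1,\hat e^{(k)}_2,\dots$ be orthonormal eigenvectors, in decreasing order of the eigenvalues, of $\hat\Gamma^{(k)}=\frac1{np_{-k}}\sum_{t\le n}\mathrm{mat}_k(\mathcal X_t^{\tau_k})\mathrm{mat}_k(\mathcal X_t^{\tau_k})^\top$. Given $1\le\bar r_k\le p_k-1$, $\rho>0$ and a (possibly random) starting value $\hat r^{(0)}$ (for instance $\hat r^{(0)}_k=\bar r_k$), define for $m\ge1$: $D^{(m)}_k$ is the Kronecker product over $k'\ne k$ (in decreasing order of $k'$) of the matrices $[\hat e^{(k')}_j,\ 1\le j\le\hat r^{(m-1)}_{k'}]$; $\check\mu^{(k),(m)}_j$ is $p_k^{-1}$ times the $j$-th largest eigenvalue of $\check\Gamma^{(k),(m)}=\frac1{np_{-k}}\sum_{t\le n}\mathrm{mat}_k(\mathcal X_t^{\tau_k})D_k^{(m)}(D_k^{(m)})^\top\mathrm{mat}_k(\mathcal X_t^{\tau_k})^\top$; and $$\hat r^{(m)}_k\in\operatorname*{arg\,max}_{1\le j\le\bar r_k}\ \frac{\check\mu^{(k),(m)}_j}{\check\mu^{(k),(m)}_{j+1}+\rho}.$$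 **Proposition.** Let $\min(n,p_1,\dots,p_K)\to\infty$ (along any sequence; $\Lambda_k,\mathcal F_t,\xi,M_n,\tau_k,\rho,\bar r_k$ may vary along it, the constants may not). Suppose that, for each $k$, $\tau_k\asymp\tau^{(k)}_{n,p}$ and $M_n(\tau^{(k)}_{n,p})^{-1}\log^{1/(2\epsilon)}(np_{-k})\to0$, and that $\rho=\rho_{n,p}\to0$ satisfies $\sum_{k'=1}^K\big(\psi^{(k')}_{n,p}\vee\frac1{p_{k'}}\big)=O(\rho_{n,p})$. If, for a given $m\ge1$, the previous iterate satisfies $r_k\le\hat r^{(m-1)}_k\le\bar r_k$ for all $k$ with probability tending to one, then $P(\hat r^{(m)}_k=r_k)\to1$ for every $k$, for every choice of the eigenvectors and every way of breaking ties in the argmax. -/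

import Mathlib

open MeasureTheory ProbabilityTheory Filter Topology Asymptotics

namespace TensorFactor

/-! ### Tensors, unfoldings and eigenvalues -/

/-- Real order-`K` tensors of dimensions `d 0 × ⋯ × d (K-1)`. -/
abbrev Tensor {K : ℕ} (d : Fin K → ℕ) : Type := (∀ k, Fin (d k)) → ℝ

/-- The index set of the columns of a mode-`k` unfolding, of cardinality `∏_{j ≠ k} d j`. -/
abbrev ColIdx {K : ℕ} (d : Fin K → ℕ) (k : Fin K) : Type := ∀ j : {j // j ≠ k}, Fin (d j)

/-- The mode-`k` unfolding: rows are indexed by the `k`-th coordinate, columns by all others. -/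
def unfold {K : ℕ} {d : Fin K → ℕ} (k : Fin K) (X : Tensor d) :
    Matrix (Fin (d k)) (ColIdx d k) ℝ :=
  Matrix.of fun i c => X ((Equiv.piSplitAt k fun j => Fin (d j)).symm (i, c))

/-- The Euclidean norm of the vector of all entries. -/
noncomputable def tnorm {K : ℕ} {d : Fin K → ℕ} (X : Tensor d) : ℝ := √(∑ i, X i ^ 2)

/-- `F ×₁ Λ₁ ×₂ ⋯ ×_K Λ_K`, written out entrywise. -/
def tucker {K : ℕ} {d e : Fin K → ℕ} (F : Tensor d)
    (L : ∀ k, Matrix (Fin (e k)) (Fin (d k)) ℝ) : Tensor e :=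
  fun i => ∑ j, F j * ∏ k, L k (i k) (j k)

/-- The Kronecker product of the matrices `E j`, `j ≠ k`, with rows and columns indexed by
tuples (so rows match the columns of a mode-`k` unfolding). For `K = 1` it is the `1 × 1`
identity. -/
def kronExcept {K : ℕ} {d s : Fin K → ℕ} (k : Fin K)
    (E : ∀ j, Matrix (Fin (d j)) (Fin (s j)) ℝ) : Matrix (ColIdx d k) (ColIdx s k) ℝ :=
  Matrix.of fun c a => ∏ j : {j // j ≠ k}, E j (c j) (a j)

/-- The `j`-th largest eigenvalue (`1 ≤ j ≤ m`, with multiplicity) of a symmetric matrix. -/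
noncomputable def eigVal {m : ℕ} (A : Matrix (Fin m) (Fin m) ℝ) (j : ℕ) : ℝ :=
  open Classical in
  if h : A.IsHermitian ∧ 1 ≤ j ∧ j ≤ m then
    h.1.eigenvalues₀ ⟨j - 1, by rw [Fintype.card_fin]; omega⟩
  else 0

/-- `e 0, e 1, …` is an orthonormal basis of eigenvectors of `A`, in decreasing order of the
eigenvalues. -/
structure IsEigenbasis {m : ℕ} (A : Matrix (Fin m) (Fin m) ℝ) (e : Fin m → Fin m → ℝ) :
    Prop where
  orthonormal : ∀ i j, e i ⬝ᵥ e j = if i = j then 1 else 0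
  eigenvector : ∀ j : Fin m, A.mulVec (e j) = eigVal A (j + 1) • e j

/-- The matrix with columns the first `s` of the vectors `e 0, e 1, …`
(zero columns are appended in the irrelevant case `m < s`). -/
def leading {m : ℕ} (e : Fin m → Fin m → ℝ) (s : ℕ) : Matrix (Fin m) (Fin s) ℝ :=
  Matrix.of fun i j => if h : (j : ℕ) < m then e ⟨j, h⟩ i else 0

/-- Truncation of a real number at level `τ`. -/
noncomputable def trunc (τ x : ℝ) : ℝ := Real.sign x * min |x| τ

/-! ### The model -/

/-- The ingredients of a Tucker factor model with sample size `n`, dimensions `p`, factor numbers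
`r`, loadings `L`, deterministic factors `F t` (`1 ≤ t ≤ n` matter) and idiosyncratic
components `ξ`. -/
structure Model (K : ℕ) (r : Fin K → ℕ) (Ω : Type*) where
  n : ℕ
  p : Fin K → ℕ
  L : ∀ k, Matrix (Fin (p k)) (Fin (r k)) ℝ
  F : ℕ → Tensor r
  ξ : (∀ k, Fin (p k)) → ℤ → Ω → ℝ

namespace Model

variable {K : ℕ} {r : Fin K → ℕ} {Ω : Type*} (S : Model K r Ω)

/-- `p = ∏ p_k`. -/
def pAll : ℕ := ∏ j, S.p j

/-- `p_{-k} = ∏_{j ≠ k} p_j`. -/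
def pExcept (k : Fin K) : ℕ := ∏ j ∈ Finset.univ.erase k, S.p j

/-- The observations `X_t = F_t ×₁ Λ₁ ⋯ ×_K Λ_K + ξ_t`. -/
def X (t : ℕ) (w : Ω) : Tensor S.p := fun i => tucker (S.F t) S.L i + S.ξ i t w

/-- The elementwise truncated observations. -/
noncomputable def Xtr (τ : ℝ) (t : ℕ) (w : Ω) : Tensor S.p := fun i => trunc τ (S.X t w i)

/-- `n⁻¹ ∑ₜ mat_k(F_t) mat_k(F_t)ᵀ`. -/
noncomputable def gammaF (k : Fin K) : Matrix (Fin (r k)) (Fin (r k)) ℝ :=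
  (S.n : ℝ)⁻¹ • ∑ t ∈ Finset.Icc 1 S.n, unfold k (S.F t) * (unfold k (S.F t)).transpose

/-- The truncated mode-`k` second moment matrix. -/
noncomputable def gammaHat (τ : ℝ) (k : Fin K) (w : Ω) : Matrix (Fin (S.p k)) (Fin (S.p k)) ℝ :=
  ((S.n : ℝ) * S.pExcept k)⁻¹ • ∑ t ∈ Finset.Icc 1 S.n,
    unfold k (S.Xtr τ t w) * (unfold k (S.Xtr τ t w)).transpose

/-- The projected truncated mode-`k` second moment matrix, where the data are projected with the
Kronecker product of the matrices of the first `s j` vectors among `e j 0, e j 1, …`, `j ≠ k`. -/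
noncomputable def gammaCheck (τ : ℝ) (e : ∀ j, Fin (S.p j) → Fin (S.p j) → ℝ) (s : Fin K → ℕ)
    (k : Fin K) (w : Ω) : Matrix (Fin (S.p k)) (Fin (S.p k)) ℝ :=
  let D := kronExcept k fun j => leading (e j) (s j)
  ((S.n : ℝ) * S.pExcept k)⁻¹ • ∑ t ∈ Finset.Icc 1 S.n,
    unfold k (S.Xtr τ t w) * D * D.transpose * (unfold k (S.Xtr τ t w)).transpose

/-- The penalised ratio `μ_j / (μ_{j+1} + ρ)` of consecutive eigenvalues of the projected second
moment matrix, where `μ_j` is the `j`-th largest eigenvalue divided by `p_k`. -/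
noncomputable def ratio (τ ρ : ℝ) (e : ∀ j, Fin (S.p j) → Fin (S.p j) → ℝ) (s : Fin K → ℕ)
    (k : Fin K) (w : Ω) (j : ℕ) : ℝ :=
  (eigVal (S.gammaCheck τ e s k w) j / S.p k) /
    (eigVal (S.gammaCheck τ e s k w) (j + 1) / S.p k + ρ)

/-- `rhat m w k` are the iterates of the eigenvalue ratio procedure: each one maximises, over
`1 ≤ j ≤ rbar k`, the ratio computed from the projections onto the leading `rhat m w` vectors of
`e w`. Ties may be broken in any way; the starting value `rhat 0` is not restricted here. -/
def IsRun (τ : Fin K → ℝ) (ρ : ℝ) (rbar : Fin K → ℕ)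
    (e : Ω → ∀ j, Fin (S.p j) → Fin (S.p j) → ℝ) (rhat : ℕ → Ω → Fin K → ℕ) : Prop :=
  ∀ m w k, rhat (m + 1) w k ∈ Finset.Icc 1 (rbar k) ∧
    ∀ j ∈ Finset.Icc 1 (rbar k),
      S.ratio (τ k) ρ (e w) (rhat m w) k w j ≤
        S.ratio (τ k) ρ (e w) (rhat m w) k w (rhat (m + 1) w k)

/-! ### Assumptions on loadings, factors and tails -/

/-- Orthogonality and boundedness of the loadings. -/
def LoadingAssumption (lbar : ℝ) : Prop :=
  ∀ k, (S.p k : ℝ)⁻¹ • ((S.L k).transpose * S.L k) = 1 ∧ ∀ i j, |S.L k i j| ≤ lbar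

/-- The second moment matrices of the factors are diagonal, with `j`-th diagonal entry in
`[α k j, β k j]`. -/
def FactorAssumption (α β : ∀ k, Fin (r k) → ℝ) : Prop :=
  ∀ k, (S.gammaF k).IsDiag ∧ ∀ j, α k j ≤ S.gammaF k j j ∧ S.gammaF k j j ≤ β k j

/-- Centred idiosyncratic components with bounded `2 + 2ε` moments, averaged moment bounds on the
factors, and the uniform bound `M`. -/
structure TailAssumption [MeasurableSpace Ω] (P : Measure Ω) (ε om M : ℝ) : Prop where
  measurable : ∀ i t, Measurable (S.ξ i t)
  centred : ∀ i t, ∫ w, S.ξ i t w ∂P = 0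
  moment : ∀ i t, eLpNorm (S.ξ i t) (ENNReal.ofReal (2 + 2 * ε)) P ≤ ENNReal.ofReal om
  factor_moment : ∀ ν ∈ ({1 + ε, 2, 2 + 2 * ε} : Set ℝ),
    (S.n : ℝ)⁻¹ * ∑ t ∈ Finset.Icc 1 S.n, tnorm (S.F t) ^ ν ≤ om ^ ν
  factor_bound : ∀ t ∈ Finset.Icc 1 S.n, tnorm (S.F t) ≤ M
  om_le : om ≤ M

/-! ### Dependence -/

/-- `n⁻¹ ∑_{t,u} |F_t|^{1+ε} |F_u|^{1+ε} exp(-a |t-u|)`. -/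
noncomputable def factorMix (ε a : ℝ) : ℝ :=
  (S.n : ℝ)⁻¹ * ∑ t ∈ Finset.Icc 1 S.n, ∑ u ∈ Finset.Icc 1 S.n,
    tnorm (S.F t) ^ (1 + ε) * tnorm (S.F u) ^ (1 + ε) * Real.exp (-(a * |(t : ℝ) - (u : ℝ)|))

end Model

/-- The strong mixing coefficient of two σ-algebras. -/
noncomputable def alphaMix {Ω : Type*} [MeasurableSpace Ω] (P : Measure Ω)
    (𝒜 ℬ : MeasurableSpace Ω) : ℝ :=
  sSup {x | ∃ A B : Set Ω, MeasurableSet[𝒜] A ∧ MeasurableSet[ℬ] B ∧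
    x = |P.real (A ∩ B) - P.real A * P.real B|}

/-- The distance of two sites `(i, t)`, `(j, u)`: the maximum of `|i_k - j_k|` and `|t - u|`. -/
def siteDist {K : ℕ} {p : Fin K → ℕ} (x y : (∀ k, Fin (p k)) × ℤ) : ℕ :=
  max (Finset.univ.sup fun k => ((x.1 k : ℤ) - (y.1 k : ℤ)).natAbs) (x.2 - y.2).natAbs

/-- The distance of two sets of sites (`⊤` if one of them is empty). -/
noncomputable def setDist {K : ℕ} {p : Fin K → ℕ} (E₁ E₂ : Set ((∀ k, Fin (p k)) × ℤ)) : ℕ∞ :=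
  ⨅ x ∈ E₁, ⨅ y ∈ E₂, (siteDist x y : ℕ∞)

/-- The two alternative dependence settings: independence across the coordinates of the tensor
with strongly mixing time series, or a strongly mixing random field. -/
inductive Regime
  | indep
  | field

namespace Model

variable {K : ℕ} {r : Fin K → ℕ} {Ω : Type*} (S : Model K r Ω)

/-- The σ-algebra generated by `ξ_{i,t}`, `(i, t) ∈ E`. -/
@[reducible] def sigma (E : Set ((∀ k, Fin (S.p k)) × ℤ)) : MeasurableSpace Ω :=
  ⨆ x ∈ E, MeasurableSpace.comap (S.ξ x.1 x.2) inferInstance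

/-- Independent time series, each exponentially strongly mixing. -/
structure IndepAssumption [MeasurableSpace Ω] (P : Measure Ω) (ε om c₀ cε : ℝ) : Prop where
  indep : iIndepFun (fun i w t => S.ξ i t w) P
  mixing : ∀ (i : ∀ k, Fin (S.p k)) (t : ℤ) (m : ℕ),
    alphaMix P (S.sigma {x | x.1 = i ∧ x.2 ≤ t}) (S.sigma {x | x.1 = i ∧ t + m ≤ x.2})
      ≤ Real.exp (-(c₀ * m))
  factor₁ : S.factorMix ε (c₀ * ε / (1 + ε)) ≤ om ^ (2 + 2 * ε) * cε
  factor₂ : ∀ k, S.factorMix ε (c₀ / (3 * Real.log (S.n * S.pExcept k)))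
    ≤ om ^ (2 + 2 * ε) * cε * Real.log (S.n * S.pExcept k)

/-- An exponentially strongly mixing random field. -/
structure FieldAssumption [MeasurableSpace Ω] (P : Measure Ω) (ε om c₀ cε : ℝ) : Prop where
  mixing : ∀ (m : ℕ) (E₁ E₂ : Set ((∀ k, Fin (S.p k)) × ℤ)), (m : ℕ∞) ≤ setDist E₁ E₂ →
    alphaMix P (S.sigma E₁) (S.sigma E₂) ≤ Real.exp (-(c₀ * m))
  factor₁ : S.factorMix ε (c₀ * ε / (K * (1 + ε))) ≤ om ^ (2 + 2 * ε) * cε * K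
  factor₂ : S.factorMix ε (c₀ / (3 * K * Real.log (S.n * S.pAll)))
    ≤ om ^ (2 + 2 * ε) * cε * K * Real.log (S.n * S.pAll)

/-- The assumption on the dependence in the given regime. -/
def DependenceAssumption [MeasurableSpace Ω] (R : Regime) (P : Measure Ω)
    (ε om c₀ cε : ℝ) : Prop :=
  match R with
  | .indep => S.IndepAssumption P ε om c₀ cε
  | .field => S.FieldAssumption P ε om c₀ cε

/-- The logarithmic factor in the rates: `log (n p_{-k})` or `log^K (n p)`. -/
noncomputable def logFactor (R : Regime) (k : Fin K) : ℝ :=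
  match R with
  | .indep => Real.log (S.n * S.pExcept k)
  | .field => Real.log (S.n * S.pAll) ^ K

/-- The order `τ^{(k)}_{n,p}` of the truncation level. -/
noncomputable def tauRate (R : Regime) (ε om : ℝ) (k : Fin K) : ℝ :=
  om * ((S.n * S.pExcept k : ℝ) / S.logFactor R k) ^ (1 / (2 + 2 * ε))

/-- The rate `ψ^{(k)}_{n,p}`. -/
noncomputable def psi (R : Regime) (ε om : ℝ) (k : Fin K) : ℝ :=
  om ^ 2 * (S.logFactor R k / (S.n * S.pExcept k : ℝ)) ^ (ε / (1 + ε))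

end Model

end TensorFactor

/-!
Decompose the truncated data into the common component and a residual. By `(x + y)² ≤ 2x² + 2y²`,
the second moment matrices of the data and of the common component dominate each other in the
Loewner order, up to a factor of two and the second moment matrix of the residuals. The mean of the
latter consists of the squared truncation bias and of covariances, which have bounded row sums by
Davydov's inequality; its fluctuation is bounded by Chebyshev's inequality in the Frobenius norm,
where mixing controls the sum of the covariances of products of truncated variables. Relative to
`p_k`, the three contributions are of order `ψ`, `1 / p_k` and `ψ`, so the operator norm of the
residual part is at most `C * ρ * p_k` with probability close to one.

On this event, as soon as at least `r_k` leading eigenvectors are kept in every mode, projecting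
onto them preserves at least half of each loading matrix. The projected second moment matrix has
`r_k` eigenvalues of order `p_k`, while the others are at most of order `ρ * p_k`. Hence the
penalised ratio is bounded for `j < r_k`, is at least of order `1 / ρ` for `j = r_k`, and is bounded
again for `j > r_k` because the penalty keeps the denominator at least `ρ`.
-/

namespace TensorFactor

open Matrix
open scoped MatrixOrder

/-! ### Eigenvalues and the Loewner order -/

section LoewnerOrder

variable {a b : Type*} [Fintype b]

theorem mul_mul_transpose_mono [Finite a] {A B : Matrix b b ℝ} (h : A ≤ B) (C : Matrix a b ℝ) :
    C * A * Cᵀ ≤ C * B * Cᵀ := by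
  rw [← sub_nonneg, ← Matrix.sub_mul, ← Matrix.mul_sub, nonneg_iff_posSemidef]
  simpa only [conjTranspose_eq_transpose_of_trivial] using
    (le_iff.mp h).mul_mul_conjTranspose_same C

theorem mul_transpose_nonneg [Finite a] (C : Matrix a b ℝ) : 0 ≤ C * Cᵀ := by
  simpa [nonneg_iff_posSemidef] using posSemidef_self_mul_conjTranspose C

variable [Fintype a]

theorem dotProduct_mulVec_mono {A B : Matrix a a ℝ} (h : A ≤ B) (v : a → ℝ) :
    v ⬝ᵥ A *ᵥ v ≤ v ⬝ᵥ B *ᵥ v := by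
  have := (le_iff.mp h).dotProduct_mulVec_nonneg v
  rwa [star_trivial, sub_mulVec, dotProduct_sub, sub_nonneg] at this

theorem le_of_dotProduct_mulVec_le {A B : Matrix a a ℝ} (hA : A.IsHermitian) (hB : B.IsHermitian)
    (h : ∀ v, v ⬝ᵥ A *ᵥ v ≤ v ⬝ᵥ B *ᵥ v) : A ≤ B := by
  refine le_iff.mpr (.of_dotProduct_mulVec_nonneg (hB.sub hA) fun v => ?_)
  rw [star_trivial, sub_mulVec, dotProduct_sub, sub_nonneg]
  exact h v

theorem mul_transpose_le_smul_one [DecidableEq a] [DecidableEq b] {B : Matrix a b ℝ} {c : ℝ}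
    (hc : 0 < c) (h : Bᵀ * B ≤ c • 1) : B * Bᵀ ≤ c • 1 := by
  have hsq : B * Bᵀ * (B * Bᵀ) ≤ c • (B * Bᵀ) := by
    simpa only [Matrix.mul_assoc, Matrix.mul_smul, Matrix.smul_mul, Matrix.mul_one] using
      mul_mul_transpose_mono h B
  have hcompl : 0 ≤ (c • 1 - B * Bᵀ) * (c • 1 - B * Bᵀ)ᵀ + (c • (B * Bᵀ) - B * Bᵀ * (B * Bᵀ)) :=
    add_nonneg (mul_transpose_nonneg _) (sub_nonneg.mpr hsq)
  have hfactor : (c • 1 - B * Bᵀ) * (c • 1 - B * Bᵀ)ᵀ + (c • (B * Bᵀ) - B * Bᵀ * (B * Bᵀ)) =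
      c • (c • 1 - B * Bᵀ) := by
    simp only [transpose_sub, transpose_smul, transpose_one, transpose_mul, transpose_transpose,
      Matrix.sub_mul, Matrix.mul_sub, Matrix.smul_mul, Matrix.mul_smul, Matrix.one_mul,
      Matrix.mul_one, smul_sub]
    abel
  rw [hfactor] at hcompl
  simpa only [inv_smul_smul₀ hc.ne', sub_nonneg] using smul_nonneg (inv_nonneg.mpr hc.le) hcompl

end LoewnerOrder

/-! ### Eigenvectors -/

theorem exists_isEigenbasis {m : ℕ} {A : Matrix (Fin m) (Fin m) ℝ} (hA : A.IsHermitian) :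
    ∃ e, IsEigenbasis A e := by
  let cast := Fin.cast (Fintype.card_fin m).symm
  let b := (isSymmetric_toEuclideanLin_iff.mpr hA).eigenvectorBasis
    (finrank_euclideanSpace (𝕜 := ℝ) (ι := Fin m))
  refine ⟨fun j => ⇑(b (cast j)), fun i j => ?_, fun j => ?_⟩
  · have h := orthonormal_iff_ite.mp b.orthonormal (cast i) (cast j)
    simp only [EuclideanSpace.inner_eq_star_dotProduct] at h
    rw [dotProduct_comm]
    simpa [cast] using h
  · have h : eigVal A (j + 1) = hA.eigenvalues₀ (cast j) := by
      unfold eigVal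
      rw [dif_pos ⟨hA, by omega, by omega⟩]
      congr
    rw [h]
    exact congr(⇑$((isSymmetric_toEuclideanLin_iff.mpr hA).apply_eigenvectorBasis
      (finrank_euclideanSpace (𝕜 := ℝ) (ι := Fin m)) (cast j)))

theorem eigVal_antitone {m : ℕ} (A : Matrix (Fin m) (Fin m) ℝ) {i j : ℕ} (hi : 1 ≤ i)
    (hij : i ≤ j) (hj : j ≤ m) : eigVal A j ≤ eigVal A i := by
  unfold eigVal
  by_cases hA : A.IsHermitian
  · rw [dif_pos ⟨hA, by omega, hj⟩, dif_pos ⟨hA, hi, by omega⟩]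
    apply hA.eigenvalues₀_antitone
    simp only [Fin.mk_le_mk]
    omega
  · rw [dif_neg (fun h => hA h.1), dif_neg (fun h => hA h.1)]

theorem leading_eq_submatrix {m s : ℕ} (e : Fin m → Fin m → ℝ) (hs : s ≤ m) :
    leading e s = (Matrix.of e)ᵀ.submatrix id (Fin.castLE hs) := by
  ext i j
  simp only [leading, of_apply, submatrix_apply, transpose_apply, id]
  rw [dif_pos (by omega)]
  rfl

theorem dotProduct_eq_zero_of_leading {m s : ℕ} {e : Fin m → Fin m → ℝ} {v : Fin m → ℝ}
    (hv : (leading e s)ᵀ *ᵥ v = 0) {j : Fin m} (hj : (j : ℕ) < s) : e j ⬝ᵥ v = 0 := by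
  simpa [mulVec, dotProduct, leading] using congrFun hv ⟨j, hj⟩

namespace IsEigenbasis

variable {m s : ℕ} {A : Matrix (Fin m) (Fin m) ℝ} {e : Fin m → Fin m → ℝ}

theorem of_mul_transpose (he : IsEigenbasis A e) : Matrix.of e * (Matrix.of e)ᵀ = 1 := by
  ext i j
  simpa [Matrix.mul_apply, dotProduct, Matrix.one_apply] using he.orthonormal i j

theorem dotProduct_eq_sum (he : IsEigenbasis A e) (v w : Fin m → ℝ) :
    v ⬝ᵥ w = ∑ j, (e j ⬝ᵥ v) * (e j ⬝ᵥ w) :=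
  calc v ⬝ᵥ w = (Matrix.of e *ᵥ v) ⬝ᵥ (Matrix.of e *ᵥ w) := by
        rw [dotProduct_mulVec, ← mulVec_transpose, mulVec_mulVec,
          mul_eq_one_comm.mp he.of_mul_transpose, one_mulVec]
    _ = ∑ j, (e j ⬝ᵥ v) * (e j ⬝ᵥ w) := rfl

theorem dotProduct_mulVec_self (he : IsEigenbasis A e) (hA : A.IsHermitian) (v : Fin m → ℝ) :
    v ⬝ᵥ A *ᵥ v = ∑ j : Fin m, eigVal A (j + 1) * (e j ⬝ᵥ v) ^ 2 := by
  have hT : Aᵀ = A := by simpa using hA.eq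
  rw [he.dotProduct_eq_sum]
  refine Finset.sum_congr rfl fun j _ => ?_
  have : e j ⬝ᵥ A *ᵥ v = eigVal A (j + 1) * (e j ⬝ᵥ v) := by
    rw [dotProduct_mulVec, ← mulVec_transpose, hT, he.eigenvector, smul_dotProduct, smul_eq_mul]
  rw [this]
  ring

theorem leading_transpose_mul_leading (he : IsEigenbasis A e) (hs : s ≤ m) :
    (leading e s)ᵀ * leading e s = 1 := by
  rw [leading_eq_submatrix e hs, transpose_submatrix, transpose_transpose,
    ← submatrix_mul _ _ _ _ _ Function.bijective_id, he.of_mul_transpose,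
    submatrix_one _ (Fin.castLE_injective hs)]

theorem mul_leading (he : IsEigenbasis A e) (hs : s ≤ m) :
    A * leading e s = leading e s * diagonal fun j : Fin s => eigVal A (j + 1) := by
  ext i j
  rw [mul_diagonal]
  simpa [leading_eq_submatrix e hs, Matrix.mul_apply, mulVec, dotProduct, mul_comm] using
    congrFun (he.eigenvector (Fin.castLE hs j)) i

theorem dotProduct_mulVec_le (he : IsEigenbasis A e) (hA : A.IsHermitian) {v : Fin m → ℝ}
    (hv : (leading e s)ᵀ *ᵥ v = 0) : v ⬝ᵥ A *ᵥ v ≤ eigVal A (s + 1) * (v ⬝ᵥ v) := by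
  rw [he.dotProduct_mulVec_self hA, he.dotProduct_eq_sum, Finset.mul_sum]
  refine Finset.sum_le_sum fun j _ => ?_
  by_cases hj : (j : ℕ) < s
  · simp [dotProduct_eq_zero_of_leading hv hj]
  · rw [← sq]
    exact mul_le_mul_of_nonneg_right (eigVal_antitone A (by omega) (by omega) (by omega))
      (sq_nonneg _)

theorem leading_mulVec_dotProduct (he : IsEigenbasis A e) (hs : s ≤ m) (x : Fin s → ℝ) :
    (leading e s *ᵥ x) ⬝ᵥ (leading e s *ᵥ x) = x ⬝ᵥ x := by
  rw [dotProduct_mulVec, ← mulVec_transpose, mulVec_mulVec,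
    he.leading_transpose_mul_leading hs, one_mulVec]

theorem le_dotProduct_mulVec (he : IsEigenbasis A e) (hs : s ≤ m) (x : Fin s → ℝ) :
    eigVal A s * ((leading e s *ᵥ x) ⬝ᵥ (leading e s *ᵥ x)) ≤
      (leading e s *ᵥ x) ⬝ᵥ A *ᵥ (leading e s *ᵥ x) := by
  have h : (leading e s *ᵥ x) ⬝ᵥ A *ᵥ (leading e s *ᵥ x) =
      ∑ j : Fin s, eigVal A (j + 1) * (x j * x j) := by
    rw [mulVec_mulVec, he.mul_leading hs, ← mulVec_mulVec, dotProduct_mulVec, ← mulVec_transpose,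
      mulVec_mulVec, he.leading_transpose_mul_leading hs, one_mulVec]
    simp only [dotProduct, mulVec_diagonal]
    exact Finset.sum_congr rfl fun j _ => mul_left_comm _ _ _
  rw [he.leading_mulVec_dotProduct hs, h, dotProduct, Finset.mul_sum]
  exact Finset.sum_le_sum fun j _ => mul_le_mul_of_nonneg_right
    (eigVal_antitone A (by omega) (by omega) hs) (mul_self_nonneg _)

theorem isStarProjection_leading (he : IsEigenbasis A e) (hs : s ≤ m) :
    IsStarProjection (leading e s * (leading e s)ᵀ) where
  isIdempotentElem := by
    rw [IsIdempotentElem, Matrix.mul_assoc, ← Matrix.mul_assoc (leading e s)ᵀ,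
      he.leading_transpose_mul_leading hs, Matrix.one_mul]
  isSelfAdjoint := by simp [IsSelfAdjoint, star_eq_conjTranspose]

end IsEigenbasis

theorem eigVal_nonneg {m : ℕ} {A : Matrix (Fin m) (Fin m) ℝ} (hA : 0 ≤ A) (j : ℕ) :
    0 ≤ eigVal A j := by
  have hpos := nonneg_iff_posSemidef.mp hA
  by_cases hj : 1 ≤ j ∧ j ≤ m
  · obtain ⟨e, he⟩ := exists_isEigenbasis hpos.isHermitian
    obtain ⟨i, rfl⟩ := Nat.exists_eq_add_of_le' hj.1
    have hquad := hpos.dotProduct_mulVec_nonneg (e ⟨i, hj.2⟩)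
    rwa [he.eigenvector, star_trivial, dotProduct_smul, he.orthonormal, if_pos rfl, smul_eq_mul,
      mul_one] at hquad
  · rw [eigVal, dif_neg fun h => hj h.2]

/-! ### Courant–Fischer bounds -/

theorem exists_mulVec_eq_zero_of_lt {s t : ℕ} (hst : s < t) (C : Matrix (Fin s) (Fin t) ℝ) :
    ∃ x ≠ 0, C *ᵥ x = 0 := by
  have h : LinearMap.ker C.mulVecLin ≠ ⊥ := LinearMap.ker_ne_bot_of_finrank_lt (by simpa)
  obtain ⟨x, hx, hx0⟩ := Submodule.exists_mem_ne_zero_of_ne_bot h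
  exact ⟨x, hx0, hx⟩

theorem eigVal_le_of_le_add {m s : ℕ} {A : Matrix (Fin m) (Fin m) ℝ}
    (B : Matrix (Fin m) (Fin s) ℝ) (M : Matrix (Fin s) (Fin s) ℝ) {c : ℝ} (hc : 0 ≤ c)
    (h : A ≤ B * M * Bᵀ + c • 1) {j : ℕ} (hj : s < j) : eigVal A j ≤ c := by
  by_cases hA : A.IsHermitian ∧ 1 ≤ j ∧ j ≤ m
  swap
  · rwa [eigVal, dif_neg hA]
  refine (eigVal_antitone A (by omega) hj hA.2.2).trans ?_
  obtain ⟨e, he⟩ := exists_isEigenbasis hA.1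
  have hsm : s + 1 ≤ m := by omega
  obtain ⟨x, hx0, hx⟩ := exists_mulVec_eq_zero_of_lt s.lt_succ_self (Bᵀ * leading e (s + 1))
  set v := leading e (s + 1) *ᵥ x with hv
  have hBv : Bᵀ *ᵥ v = 0 := by rw [hv, mulVec_mulVec, hx]
  have hv_pos : 0 < v ⬝ᵥ v := by
    rw [he.leading_mulVec_dotProduct hsm]
    simpa using dotProduct_star_self_pos_iff.mpr hx0
  refine le_of_mul_le_mul_right ((he.le_dotProduct_mulVec hsm x).trans ?_) hv_pos
  calc v ⬝ᵥ A *ᵥ v ≤ v ⬝ᵥ (B * M * Bᵀ + c • 1) *ᵥ v := dotProduct_mulVec_mono h v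
    _ = c * (v ⬝ᵥ v) := by
        rw [add_mulVec, ← mulVec_mulVec, hBv, mulVec_zero, zero_add, smul_mulVec, one_mulVec,
          dotProduct_smul, smul_eq_mul]

theorem eigVal_le_of_le_smul_one {m : ℕ} {A : Matrix (Fin m) (Fin m) ℝ} {c : ℝ} (hc : 0 ≤ c)
    (h : A ≤ c • 1) {j : ℕ} (hj : 1 ≤ j) : eigVal A j ≤ c :=
  eigVal_le_of_le_add (s := 0) 0 0 hc (by simpa using h) hj

theorem sub_le_eigVal_of_le_add {m s : ℕ} {A : Matrix (Fin m) (Fin m) ℝ} (hA : A.IsHermitian)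
    (hs : 1 ≤ s) {B : Matrix (Fin m) (Fin s) ℝ} {c d q : ℝ} (hd : 0 < d) (hB : Bᵀ * B = d • 1)
    (h : q • (B * Bᵀ) ≤ A + c • 1) : q * d - c ≤ eigVal A s := by
  obtain ⟨e, he⟩ := exists_isEigenbasis hA
  obtain ⟨t, rfl⟩ := Nat.exists_eq_add_of_le' hs
  obtain ⟨x, hx0, hx⟩ := exists_mulVec_eq_zero_of_lt t.lt_succ_self ((leading e t)ᵀ * B)
  set v := B *ᵥ x with hv
  have hBv : Bᵀ *ᵥ v = d • x := by rw [hv, mulVec_mulVec, hB, smul_mulVec, one_mulVec]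
  have hvv : v ⬝ᵥ v = d * (x ⬝ᵥ x) := by
    nth_rewrite 2 [hv]
    rw [dotProduct_mulVec, ← mulVec_transpose, hBv, smul_dotProduct, smul_eq_mul]
  have hv_pos : 0 < v ⬝ᵥ v := by
    rw [hvv]
    exact mul_pos hd (by simpa using dotProduct_star_self_pos_iff.mpr hx0)
  have hBB : v ⬝ᵥ (q • (B * Bᵀ)) *ᵥ v = q * d * (v ⬝ᵥ v) := by
    rw [smul_mulVec, dotProduct_smul, ← mulVec_mulVec, dotProduct_mulVec, ← mulVec_transpose, hBv,
      smul_dotProduct, dotProduct_smul, hvv]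
    simp only [smul_eq_mul]
    ring
  have hle := dotProduct_mulVec_mono h v
  rw [hBB, add_mulVec, smul_mulVec, one_mulVec, dotProduct_add, dotProduct_smul, smul_eq_mul] at hle
  have hAv := he.dotProduct_mulVec_le hA (s := t) (v := v) (by rw [hv, mulVec_mulVec, hx])
  refine le_of_mul_le_mul_right ?_ hv_pos
  linarith

/-! ### Kronecker products and unfoldings -/

theorem hadamard_nonneg {n : Type*} {A B : Matrix n n ℝ} (hA : 0 ≤ A) (hB : 0 ≤ B) :
    0 ≤ A ⊙ B :=
  nonneg_iff_posSemidef.mpr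
    ((nonneg_iff_posSemidef.mp hA).hadamard (nonneg_iff_posSemidef.mp hB))

theorem hadamard_mono {n : Type*} {A B C D : Matrix n n ℝ} (hA : 0 ≤ A) (hAB : A ≤ B)
    (hC : 0 ≤ C) (hCD : C ≤ D) : A ⊙ C ≤ B ⊙ D := by
  have hsplit : B ⊙ D - A ⊙ C = B ⊙ (D - C) + (B - A) ⊙ C := by
    ext
    simp only [hadamard_apply, Matrix.sub_apply, Matrix.add_apply]
    ring
  rw [← sub_nonneg, hsplit]
  exact add_nonneg (hadamard_nonneg (hA.trans hAB) (sub_nonneg.mpr hCD))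
    (hadamard_nonneg (sub_nonneg.mpr hAB) hC)

theorem of_prod_mono {ι n : Type*} [Finite n] {A B : ι → Matrix n n ℝ} (hA : ∀ j, 0 ≤ A j)
    (hAB : ∀ j, A j ≤ B j) (s : Finset ι) :
    0 ≤ Matrix.of (fun c a => ∏ j ∈ s, A j c a) ∧
      Matrix.of (fun c a => ∏ j ∈ s, A j c a) ≤ Matrix.of (fun c a => ∏ j ∈ s, B j c a) := by
  classical
  induction s using Finset.induction_on with
  | empty =>
    refine ⟨?_, le_rfl⟩
    have hones : Matrix.of (fun c a => ∏ j ∈ (∅ : Finset ι), A j c a) =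
        replicateCol Unit (fun _ : n => (1 : ℝ)) * (replicateCol Unit fun _ : n => (1 : ℝ))ᵀ := by
      ext
      simp [mul_apply]
    rw [hones]
    exact mul_transpose_nonneg _
  | insert j s hj ih =>
    have hinsert (C : ι → Matrix n n ℝ) : Matrix.of (fun c a => ∏ i ∈ insert j s, C i c a) =
        C j ⊙ Matrix.of fun c a => ∏ i ∈ s, C i c a := by
      ext
      simp [Finset.prod_insert hj]
    rw [hinsert, hinsert]
    exact ⟨hadamard_nonneg (hA j) ih.1, hadamard_mono (hA j) (hAB j) ih.1 ih.2⟩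

section Kronecker

variable {K : ℕ} (k : Fin K)

theorem kronExcept_mul {d s u : Fin K → ℕ} (A : ∀ j, Matrix (Fin (d j)) (Fin (s j)) ℝ)
    (B : ∀ j, Matrix (Fin (s j)) (Fin (u j)) ℝ) :
    kronExcept k A * kronExcept k B = kronExcept k fun j => A j * B j := by
  ext c a
  simp only [kronExcept, mul_apply, of_apply, Finset.prod_univ_sum, ← Finset.prod_mul_distrib]
  simp

theorem kronExcept_transpose {d s : Fin K → ℕ} (A : ∀ j, Matrix (Fin (d j)) (Fin (s j)) ℝ) :
    (kronExcept k A)ᵀ = kronExcept k fun j => (A j)ᵀ := rfl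

theorem kronExcept_smul_one {d : Fin K → ℕ} (c : Fin K → ℝ) :
    kronExcept k (fun j => c j • (1 : Matrix (Fin (d j)) (Fin (d j)) ℝ)) =
      (∏ j ∈ Finset.univ.erase k, c j) • (1 : Matrix (ColIdx d k) (ColIdx d k) ℝ) := by
  have hprod : ∏ j ∈ Finset.univ.erase k, c j = ∏ j : {j // j ≠ k}, c j :=
    Finset.prod_subtype _ (by simp) _
  rw [hprod]
  ext a b
  simp only [kronExcept, of_apply, Matrix.smul_apply, smul_eq_mul, Finset.prod_mul_distrib]
  congr 1
  by_cases hab : a = b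
  · subst hab
    rw [one_apply_eq]
    exact Finset.prod_eq_one fun j _ => one_apply_eq _
  · obtain ⟨j, hj⟩ := Function.ne_iff.mp hab
    rw [one_apply_ne hab]
    exact Finset.prod_eq_zero (Finset.mem_univ j) (one_apply_ne hj)

theorem kronExcept_mono {d : Fin K → ℕ} {A B : ∀ j, Matrix (Fin (d j)) (Fin (d j)) ℝ}
    (hA : ∀ j, 0 ≤ A j) (hAB : ∀ j, A j ≤ B j) : kronExcept k A ≤ kronExcept k B := by
  let lift (C : ∀ j, Matrix (Fin (d j)) (Fin (d j)) ℝ) (j : {j // j ≠ k}) :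
    Matrix (ColIdx d k) (ColIdx d k) ℝ := (C j).submatrix (fun c => c j) fun c => c j
  refine (of_prod_mono (A := lift A) (B := lift B) (fun j => ?_) (fun j => ?_) Finset.univ).2
  · exact nonneg_iff_posSemidef.mpr ((nonneg_iff_posSemidef.mp (hA j)).submatrix _)
  · exact le_iff.mpr ((le_iff.mp (hAB j)).submatrix _)

theorem unfold_tucker {d e : Fin K → ℕ} (F : Tensor d)
    (L : ∀ k, Matrix (Fin (e k)) (Fin (d k)) ℝ) :
    unfold k (tucker F L) = L k * unfold k F * (kronExcept k L)ᵀ := by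
  ext i c
  simp only [unfold, of_apply, tucker, mul_apply, transpose_apply, kronExcept, Finset.sum_mul]
  rw [← (Equiv.piSplitAt k fun j => Fin (d j)).symm.sum_comp, Fintype.sum_prod_type,
    Finset.sum_comm]
  refine Finset.sum_congr rfl fun a _ => Finset.sum_congr rfl fun b _ => ?_
  have hsplit : ∏ x, L x ((Equiv.piSplitAt k fun j => Fin (e j)).symm (i, c) x)
      ((Equiv.piSplitAt k fun j => Fin (d j)).symm (b, a) x) =
      L k i b * ∏ x : {j // j ≠ k}, L x (c x) (a x) := by
    rw [Fintype.prod_eq_mul_prod_subtype_ne _ k]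
    congr 1
    · simp [Equiv.piSplitAt]
    · exact Finset.prod_congr rfl fun x _ => by simp [Equiv.piSplitAt, x.2]
  rw [hsplit]
  ring

end Kronecker

/-! ### Empirical second moments -/

/-- The empirical second moment matrix `N⁻¹ ∑ₜ Y_t Y_tᵀ` of a matrix-valued series. The
normalisation `N` is independent of the length `n` because the second moments of an unfolded
tensor are also averaged over the columns. -/
noncomputable def secondMoment {a b : Type*} [Fintype b] (n : ℕ) (N : ℝ) (Y : ℕ → Matrix a b ℝ) :
    Matrix a a ℝ :=
  N⁻¹ • ∑ t ∈ Finset.Icc 1 n, Y t * (Y t)ᵀ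

section SecondMoment

variable {a b c d : Type*} [Fintype b] [Fintype c] [Fintype d] {n : ℕ} {N : ℝ}

theorem secondMoment_mul_left (L : Matrix a b ℝ) (Y : ℕ → Matrix b c ℝ) :
    secondMoment n N (fun t => L * Y t) = L * secondMoment n N Y * Lᵀ := by
  simp only [secondMoment, Matrix.mul_smul, Matrix.smul_mul, Matrix.mul_sum, Matrix.sum_mul,
    transpose_mul, Matrix.mul_assoc]

theorem secondMoment_add_add_secondMoment_sub (Y Z : ℕ → Matrix a b ℝ) :
    secondMoment n N (Y + Z) + secondMoment n N (Y - Z) =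
      (2 : ℝ) • (secondMoment n N Y + secondMoment n N Z) := by
  simp only [secondMoment, ← smul_add, ← Finset.sum_add_distrib]
  rw [smul_comm]
  congr 1
  rw [Finset.smul_sum]
  refine Finset.sum_congr rfl fun t _ => ?_
  simp only [Pi.add_apply, Pi.sub_apply, transpose_add, transpose_sub, Matrix.add_mul,
    Matrix.mul_add, Matrix.sub_mul, Matrix.mul_sub, two_smul]
  abel

variable [Finite a]

theorem secondMoment_nonneg (hN : 0 ≤ N) (Y : ℕ → Matrix a b ℝ) : 0 ≤ secondMoment n N Y := by
  cases nonempty_fintype a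
  have hsum : 0 ≤ ∑ t ∈ Finset.Icc 1 n, Y t * (Y t)ᵀ :=
    Finset.sum_nonneg fun t _ => mul_transpose_nonneg (Y t)
  exact smul_nonneg (inv_nonneg.mpr hN) hsum

theorem secondMoment_add_le (hN : 0 ≤ N) (Y Z : ℕ → Matrix a b ℝ) :
    secondMoment n N (Y + Z) ≤ (2 : ℝ) • (secondMoment n N Y + secondMoment n N Z) := by
  rw [← secondMoment_add_add_secondMoment_sub]
  exact le_add_of_nonneg_right (secondMoment_nonneg hN _)

theorem secondMoment_sub_le (hN : 0 ≤ N) (Y Z : ℕ → Matrix a b ℝ) :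
    secondMoment n N (Y - Z) ≤ (2 : ℝ) • (secondMoment n N Y + secondMoment n N Z) := by
  rw [← secondMoment_add_add_secondMoment_sub]
  exact le_add_of_nonneg_left (secondMoment_nonneg hN _)

theorem smul_secondMoment_mul_le (hN : 0 ≤ N) (Y : ℕ → Matrix a b ℝ) {q : ℝ} {C : Matrix b c ℝ}
    {D : Matrix b d ℝ} (h : q • (C * Cᵀ) ≤ D * Dᵀ) :
    q • secondMoment n N (fun t => Y t * C) ≤ secondMoment n N fun t => Y t * D := by
  cases nonempty_fintype a
  have hterm (t : ℕ) : q • (Y t * C * (Y t * C)ᵀ) ≤ Y t * D * (Y t * D)ᵀ := by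
    simpa only [transpose_mul, Matrix.mul_assoc, Matrix.mul_smul, Matrix.smul_mul] using
      mul_mul_transpose_mono h (Y t)
  simp only [secondMoment]
  rw [smul_comm, Finset.smul_sum]
  exact smul_le_smul_of_nonneg_left (Finset.sum_le_sum fun t _ => hterm t) (inv_nonneg.mpr hN)

end SecondMoment

/-! ### Leading eigenvectors of a perturbed low-rank matrix -/

theorem transpose_eq_of_isStarProjection {a : Type*} [Fintype a] {Q : Matrix a a ℝ}
    (hQ : IsStarProjection Q) : Qᵀ = Q := by
  simpa [IsSelfAdjoint, star_eq_conjTranspose] using hQ.isSelfAdjoint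

namespace IsEigenbasis

variable {m s : ℕ} {A : Matrix (Fin m) (Fin m) ℝ} {e : Fin m → Fin m → ℝ}

theorem one_sub_mul_mul_one_sub_le (he : IsEigenbasis A e) (hA : 0 ≤ A) (hs : s ≤ m) :
    (1 - leading e s * (leading e s)ᵀ) * A * (1 - leading e s * (leading e s)ᵀ)ᵀ ≤
      eigVal A (s + 1) • 1 := by
  set Q := 1 - leading e s * (leading e s)ᵀ with hQ
  have hproj : IsStarProjection Q := (he.isStarProjection_leading hs).one_sub
  have hQT : Qᵀ = Q := transpose_eq_of_isStarProjection hproj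
  have hherm : A.IsHermitian := (nonneg_iff_posSemidef.mp hA).isHermitian
  refine le_of_dotProduct_mulVec_le ?_ ?_ fun v => ?_
  · simpa using isHermitian_mul_mul_conjTranspose Q hherm
  · simp [IsHermitian]
  have horth : (leading e s)ᵀ *ᵥ (Q *ᵥ v) = 0 := by
    rw [mulVec_mulVec, hQ, Matrix.mul_sub, Matrix.mul_one, ← Matrix.mul_assoc,
      he.leading_transpose_mul_leading hs, Matrix.one_mul, sub_self, zero_mulVec]
  have hnorm : (Q *ᵥ v) ⬝ᵥ (Q *ᵥ v) ≤ v ⬝ᵥ v := by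
    rw [dotProduct_mulVec, ← mulVec_transpose, mulVec_mulVec, hQT, hproj.isIdempotentElem.eq,
      dotProduct_comm]
    simpa using dotProduct_mulVec_mono hproj.le_one v
  calc v ⬝ᵥ (Q * A * Qᵀ) *ᵥ v = (Q *ᵥ v) ⬝ᵥ A *ᵥ (Q *ᵥ v) := by
        rw [hQT, ← mulVec_mulVec, ← mulVec_mulVec, dotProduct_mulVec v Q, ← mulVec_transpose, hQT]
    _ ≤ eigVal A (s + 1) * ((Q *ᵥ v) ⬝ᵥ (Q *ᵥ v)) := he.dotProduct_mulVec_le hherm horth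
    _ ≤ eigVal A (s + 1) * (v ⬝ᵥ v) := mul_le_mul_of_nonneg_left hnorm (eigVal_nonneg hA _)
    _ = v ⬝ᵥ (eigVal A (s + 1) • 1) *ᵥ v := by
        rw [smul_mulVec, one_mulVec, dotProduct_smul, smul_eq_mul]

end IsEigenbasis

theorem smul_mul_mul_transpose_le_of_isStarProjection {a b : Type*} [Fintype a] [Fintype b]
    [DecidableEq a] [DecidableEq b] {Q A E : Matrix a a ℝ} {L : Matrix a b ℝ} {G : Matrix b b ℝ}
    {q c u : ℝ} (hQ : IsStarProjection Q) (hQA : Q * A * Qᵀ ≤ u • 1) (hG : q • 1 ≤ G)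
    (hc : 0 ≤ c) (hE : E ≤ c • 1) (hle : L * G * Lᵀ ≤ (2 : ℝ) • (A + E)) :
    q • (Q * L * (Q * L)ᵀ) ≤ (2 * (u + c)) • 1 := by
  have hQE : Q * E * Qᵀ ≤ c • 1 := by
    refine (mul_mul_transpose_mono hE Q).trans ?_
    simpa only [Matrix.mul_smul, Matrix.smul_mul, Matrix.mul_one,
      transpose_eq_of_isStarProjection hQ, hQ.isIdempotentElem.eq] using
      smul_le_smul_of_nonneg_left hQ.le_one hc
  calc q • (Q * L * (Q * L)ᵀ) = Q * (L * (q • 1) * Lᵀ) * Qᵀ := by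
        simp only [transpose_mul, Matrix.mul_assoc, Matrix.mul_smul, Matrix.smul_mul,
          Matrix.one_mul]
    _ ≤ Q * ((2 : ℝ) • (A + E)) * Qᵀ :=
        mul_mul_transpose_mono ((mul_mul_transpose_mono hG L).trans hle) Q
    _ = (2 : ℝ) • (Q * A * Qᵀ + Q * E * Qᵀ) := by
        simp only [Matrix.mul_smul, Matrix.smul_mul, Matrix.mul_add, Matrix.add_mul]
    _ ≤ (2 : ℝ) • (u • 1 + c • 1) :=
        smul_le_smul_of_nonneg_left (add_le_add hQA hQE) zero_le_two
    _ = (2 * (u + c)) • 1 := by rw [← add_smul, smul_smul]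

-- On the orthogonal complement of the leading eigenvectors of `A`, both `A` and `E` are small and
-- therefore so is `L`: the leading eigenvectors retain most of the columns of `L`.
theorem IsEigenbasis.smul_one_le_transpose_mul_leading {m r s : ℕ}
    {A E : Matrix (Fin m) (Fin m) ℝ} {e : Fin m → Fin m → ℝ} {L : Matrix (Fin m) (Fin r) ℝ}
    {G : Matrix (Fin r) (Fin r) ℝ} {a c d : ℝ} (he : IsEigenbasis A e) (hA : 0 ≤ A)
    (hrs : r ≤ s) (hsm : s ≤ m) (hL : Lᵀ * L = d • 1) (ha : 0 < a) (hG : a • 1 ≤ G) (hc : 0 < c)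
    (hcd : 12 * c ≤ a * d) (hE : E ≤ c • 1) (hle : A ≤ (2 : ℝ) • (L * G * Lᵀ + E))
    (hge : L * G * Lᵀ ≤ (2 : ℝ) • (A + E)) :
    (d / 2) • 1 ≤ Lᵀ * leading e s * (Lᵀ * leading e s)ᵀ := by
  set Q := 1 - leading e s * (leading e s)ᵀ with hQ
  have hproj : IsStarProjection Q := (he.isStarProjection_leading hsm).one_sub
  have hsmall : eigVal A (s + 1) ≤ 2 * c := by
    refine eigVal_le_of_le_add L ((2 : ℝ) • G) (by positivity) (hle.trans ?_) (by omega)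
    rw [smul_add, Matrix.mul_smul, Matrix.smul_mul, mul_smul]
    exact add_le_add le_rfl (smul_le_smul_of_nonneg_left hE zero_le_two)
  have hQL : a • (Q * L * (Q * L)ᵀ) ≤ (6 * c) • 1 := by
    convert smul_mul_mul_transpose_le_of_isStarProjection hproj
      ((he.one_sub_mul_mul_one_sub_le hA hsm).trans
        (smul_le_smul_of_nonneg_right hsmall zero_le_one)) hG hc.le hE hge using 2
    ring
  have hlost : (Q * L)ᵀ * (Q * L) ≤ (d / 2) • 1 := by
    have hB : Q * L * (Q * L)ᵀ ≤ (6 * c / a) • 1 := by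
      simpa only [inv_smul_smul₀ ha.ne', smul_smul, inv_mul_eq_div] using
        smul_le_smul_of_nonneg_left hQL (inv_nonneg.mpr ha.le)
    have h := mul_transpose_le_smul_one (B := (Q * L)ᵀ) (c := 6 * c / a) (by positivity)
      (by rwa [transpose_transpose])
    rw [transpose_transpose] at h
    refine h.trans (smul_le_smul_of_nonneg_right ?_ zero_le_one)
    rw [div_le_iff₀ ha]
    linarith
  have hsplit : Lᵀ * leading e s * (Lᵀ * leading e s)ᵀ = d • 1 - (Q * L)ᵀ * (Q * L) := by
    rw [transpose_mul Q, transpose_eq_of_isStarProjection hproj, Matrix.mul_assoc Lᵀ Q,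
      ← Matrix.mul_assoc Q, hproj.isIdempotentElem.eq, hQ, Matrix.sub_mul, Matrix.one_mul,
      Matrix.mul_sub, hL, sub_sub_cancel]
    simp only [transpose_mul, transpose_transpose, Matrix.mul_assoc]
  rw [hsplit, le_sub_iff_add_le', ← le_sub_iff_add_le, ← sub_smul, sub_half]
  exact hlost

/-! ### The second moment matrices of the model -/

namespace Model

variable {K : ℕ} {r : Fin K → ℕ} {Ω : Type*} (S : Model K r Ω)

/-- The residual tensor: the truncated data minus the common component. -/
noncomputable def resid (τ : ℝ) (t : ℕ) (w : Ω) : Tensor S.p :=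
  fun i => S.Xtr τ t w i - tucker (S.F t) S.L i

/-- The mode-`k` second moment matrix of the common component. -/
noncomputable def gammaSignal (k : Fin K) : Matrix (Fin (S.p k)) (Fin (S.p k)) ℝ :=
  secondMoment S.n (S.n * S.pExcept k) fun t => unfold k (tucker (S.F t) S.L)

/-- The mode-`k` second moment matrix of the residuals. -/
noncomputable def gammaResid (τ : ℝ) (k : Fin K) (w : Ω) : Matrix (Fin (S.p k)) (Fin (S.p k)) ℝ :=
  secondMoment S.n (S.n * S.pExcept k) fun t => unfold k (S.resid τ t w)

/-- The event that the residual second moment matrix has operator norm at most `z * p_k`. -/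
def SmallResid (τ z : ℝ) (k : Fin K) (w : Ω) : Prop :=
  S.gammaResid τ k w ≤ (z * S.p k) • 1

variable {S} {k : Fin K} {w : Ω} {a b z σ : ℝ}

theorem SmallResid.mono {z' : ℝ} (h : S.SmallResid σ z k w) (hz : z ≤ z') :
    S.SmallResid σ z' k w :=
  h.trans (smul_le_smul_of_nonneg_right (by gcongr) zero_le_one)

theorem unfold_Xtr (σ : ℝ) (w : Ω) (k : Fin K) : (fun t => unfold k (S.Xtr σ t w)) =
    (fun t => unfold k (tucker (S.F t) S.L)) + fun t => unfold k (S.resid σ t w) := by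
  ext t i c
  simp [unfold, resid]

theorem gammaHat_eq (σ : ℝ) (k : Fin K) (w : Ω) : S.gammaHat σ k w =
    secondMoment S.n (S.n * S.pExcept k) fun t => unfold k (S.Xtr σ t w) := rfl

theorem gammaCheck_eq (σ : ℝ) (e : ∀ j, Fin (S.p j) → Fin (S.p j) → ℝ) (s : Fin K → ℕ)
    (k : Fin K) (w : Ω) : S.gammaCheck σ e s k w =
      secondMoment S.n (S.n * S.pExcept k) fun t =>
        unfold k (S.Xtr σ t w) * kronExcept k fun j => leading (e j) (s j) := by
  simp only [gammaCheck, secondMoment, transpose_mul, Matrix.mul_assoc]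

theorem normalization_nonneg (S : Model K r Ω) (k : Fin K) : (0 : ℝ) ≤ S.n * S.pExcept k := by
  positivity

theorem gammaHat_nonneg (σ : ℝ) (k : Fin K) (w : Ω) : 0 ≤ S.gammaHat σ k w :=
  secondMoment_nonneg (S.normalization_nonneg k) _

theorem gammaCheck_nonneg (σ : ℝ) (e : ∀ j, Fin (S.p j) → Fin (S.p j) → ℝ) (s : Fin K → ℕ)
    (k : Fin K) (w : Ω) : 0 ≤ S.gammaCheck σ e s k w := by
  rw [gammaCheck_eq]
  exact secondMoment_nonneg (S.normalization_nonneg k) _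

theorem gammaHat_le (σ : ℝ) (k : Fin K) (w : Ω) :
    S.gammaHat σ k w ≤ (2 : ℝ) • (S.gammaSignal k + S.gammaResid σ k w) := by
  rw [gammaHat_eq, unfold_Xtr]
  exact secondMoment_add_le (S.normalization_nonneg k) _ _

theorem gammaSignal_le (σ : ℝ) (k : Fin K) (w : Ω) :
    S.gammaSignal k ≤ (2 : ℝ) • (S.gammaHat σ k w + S.gammaResid σ k w) := by
  have hdiff : (fun t => unfold k (tucker (S.F t) S.L)) =
      (fun t => unfold k (S.Xtr σ t w)) - fun t => unfold k (S.resid σ t w) := by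
    rw [unfold_Xtr, add_sub_cancel_right]
  rw [gammaSignal, hdiff]
  exact secondMoment_sub_le (S.normalization_nonneg k) _ _

section Loadings

variable (hL : ∀ j, (S.L j)ᵀ * S.L j = (S.p j : ℝ) • (1 : Matrix (Fin (r j)) (Fin (r j)) ℝ))
include hL

theorem kronExcept_transpose_mul_kronExcept (k : Fin K) :
    (kronExcept k S.L)ᵀ * kronExcept k S.L = (S.pExcept k : ℝ) • 1 := by
  rw [kronExcept_transpose, kronExcept_mul]
  simp only [hL]
  rw [kronExcept_smul_one k fun j => (S.p j : ℝ), pExcept, Nat.cast_prod]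

theorem gammaSignal_eq (hp : ∀ j, 0 < S.p j) (k : Fin K) :
    S.gammaSignal k = S.L k * S.gammaF k * (S.L k)ᵀ := by
  have hpk : (S.pExcept k : ℝ) ≠ 0 := by
    exact_mod_cast (Finset.prod_pos fun j _ => hp j).ne'
  have hterm (t : ℕ) : unfold k (tucker (S.F t) S.L) * (unfold k (tucker (S.F t) S.L))ᵀ =
      (S.pExcept k : ℝ) • (S.L k * unfold k (S.F t) * (S.L k * unfold k (S.F t))ᵀ) := by
    rw [unfold_tucker, transpose_mul, transpose_transpose, Matrix.mul_assoc,
      ← Matrix.mul_assoc (kronExcept k S.L)ᵀ, kronExcept_transpose_mul_kronExcept hL]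
    simp only [Matrix.smul_mul, Matrix.mul_smul, Matrix.one_mul]
  have hF : S.gammaF k = secondMoment S.n S.n fun t => unfold k (S.F t) := rfl
  rw [hF, ← secondMoment_mul_left]
  simp only [gammaSignal, secondMoment, hterm]
  rw [← Finset.smul_sum, smul_smul, mul_inv, inv_mul_cancel_right₀ hpk]

theorem transpose_mul_leading (hp : ∀ j, 0 < S.p j) {τ : Fin K → ℝ}
    {e : ∀ j, Fin (S.p j) → Fin (S.p j) → ℝ} {s : Fin K → ℕ}
    (he : ∀ j, IsEigenbasis (S.gammaHat (τ j) j w) (e j)) (hrs : ∀ j, r j ≤ s j)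
    (hsp : ∀ j, s j ≤ S.p j) (ha : 0 < a) (haF : ∀ j, a • 1 ≤ S.gammaF j) (hz : 0 < z)
    (hza : 12 * z ≤ a) (hR : ∀ j, S.SmallResid (τ j) z j w) (j : Fin K) :
    ((S.p j : ℝ) / 2) • 1 ≤
      (S.L j)ᵀ * leading (e j) (s j) * ((S.L j)ᵀ * leading (e j) (s j))ᵀ := by
  have hpj : (0 : ℝ) < S.p j := by exact_mod_cast hp j
  refine (he j).smul_one_le_transpose_mul_leading (gammaHat_nonneg _ _ _) (hrs j) (hsp j) (hL j) ha
    (haF j) (mul_pos hz hpj) (by nlinarith) (hR j) ?_ ?_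
  · rw [← gammaSignal_eq hL hp]
    exact gammaHat_le _ _ _
  · rw [← gammaSignal_eq hL hp]
    exact gammaSignal_le _ _ _

end Loadings

end Model

/-! ### Eigenvalues of the projected second moment matrix -/

theorem kronExcept_leading_mul_transpose_le_one {K : ℕ} {d s : Fin K → ℕ} (k : Fin K)
    {A : ∀ j, Matrix (Fin (d j)) (Fin (d j)) ℝ} {e : ∀ j, Fin (d j) → Fin (d j) → ℝ}
    (he : ∀ j, IsEigenbasis (A j) (e j)) (hs : ∀ j, s j ≤ d j) :
    (kronExcept k fun j => leading (e j) (s j)) * (kronExcept k fun j => leading (e j) (s j))ᵀ ≤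
      1 := by
  rw [kronExcept_transpose, kronExcept_mul]
  refine (kronExcept_mono k (fun j => mul_transpose_nonneg _)
    fun j => ((he j).isStarProjection_leading (hs j)).le_one).trans_eq ?_
  simpa using kronExcept_smul_one k fun _ : Fin K => (1 : ℝ)

namespace Model

variable {K : ℕ} {r s : Fin K → ℕ} {Ω : Type*} {S : Model K r Ω} {τ : Fin K → ℝ} {w : Ω}
  {e : ∀ j, Fin (S.p j) → Fin (S.p j) → ℝ} {a b z : ℝ}

section Projection

variable (he : ∀ j, IsEigenbasis (S.gammaHat (τ j) j w) (e j)) (hsp : ∀ j, s j ≤ S.p j)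
include he hsp

theorem secondMoment_mul_kronExcept_leading_le (k : Fin K)
    (Y : ℕ → Matrix (Fin (S.p k)) (ColIdx S.p k) ℝ) :
    secondMoment S.n (S.n * S.pExcept k)
      (fun t => Y t * kronExcept k fun j => leading (e j) (s j)) ≤
      secondMoment S.n (S.n * S.pExcept k) Y := by
  simpa using smul_secondMoment_mul_le (S.normalization_nonneg k) Y (q := 1)
    (C := kronExcept k fun j => leading (e j) (s j)) (D := (1 : Matrix _ (ColIdx S.p k) ℝ))
    (by simpa using kronExcept_leading_mul_transpose_le_one k he hsp)

theorem gammaCheck_le_gammaHat (σ : ℝ) (k : Fin K) :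
    S.gammaCheck σ e s k w ≤ S.gammaHat σ k w := by
  rw [gammaCheck_eq]
  exact secondMoment_mul_kronExcept_leading_le he hsp k _

variable (hL : ∀ j, (S.L j)ᵀ * S.L j = (S.p j : ℝ) • (1 : Matrix (Fin (r j)) (Fin (r j)) ℝ))
  (hp : ∀ j, 0 < S.p j) {k : Fin K}
include hL hp

theorem gammaCheck_le (hR : S.SmallResid (τ k) z k w) : S.gammaCheck (τ k) e s k w ≤
    S.L k * ((2 : ℝ) • S.gammaF k) * (S.L k)ᵀ + (2 * z * S.p k) • 1 := by
  refine (gammaCheck_le_gammaHat he hsp _ k).trans ((gammaHat_le _ _ _).trans ?_)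
  rw [gammaSignal_eq hL hp, smul_add, Matrix.mul_smul, Matrix.smul_mul, mul_assoc, mul_smul]
  exact add_le_add le_rfl (smul_le_smul_of_nonneg_left hR zero_le_two)

theorem eigVal_gammaCheck_le_of_lt (hz : 0 ≤ z) (hR : S.SmallResid (τ k) z k w) {j : ℕ}
    (hj : r k < j) : eigVal (S.gammaCheck (τ k) e s k w) j ≤ 2 * z * S.p k :=
  eigVal_le_of_le_add _ _ (by positivity) (gammaCheck_le he hsp hL hp hR) hj

theorem eigVal_gammaCheck_le (hb : 0 ≤ b) (hbF : S.gammaF k ≤ b • 1) (hz : 0 ≤ z)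
    (hR : S.SmallResid (τ k) z k w) {j : ℕ} (hj : 1 ≤ j) :
    eigVal (S.gammaCheck (τ k) e s k w) j ≤ 2 * (b + z) * S.p k := by
  have hpk : (0 : ℝ) < S.p k := by exact_mod_cast hp k
  have hF : S.L k * ((2 : ℝ) • S.gammaF k) * (S.L k)ᵀ ≤ (2 * b * S.p k) • 1 :=
    calc S.L k * ((2 : ℝ) • S.gammaF k) * (S.L k)ᵀ ≤ S.L k * ((2 : ℝ) • b • 1) * (S.L k)ᵀ :=
          mul_mul_transpose_mono (smul_le_smul_of_nonneg_left hbF zero_le_two) _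
      _ = (2 * b) • (S.L k * (S.L k)ᵀ) := by
          simp only [Matrix.mul_smul, Matrix.smul_mul, Matrix.mul_one, smul_smul]
      _ ≤ (2 * b) • ((S.p k : ℝ) • 1) :=
          smul_le_smul_of_nonneg_left (mul_transpose_le_smul_one hpk (hL k).le) (by positivity)
      _ = (2 * b * S.p k) • 1 := smul_smul _ _ _
  refine eigVal_le_of_le_smul_one (by positivity) ?_ hj
  refine (gammaCheck_le he hsp hL hp hR).trans ((add_le_add hF le_rfl).trans_eq ?_)
  rw [← add_smul]
  ring_nf

section LowerBound

variable (hrs : ∀ j, r j ≤ s j) (ha : 0 < a) (haF : ∀ j, a • 1 ≤ S.gammaF j) (hz : 0 < z)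
  (hza : 12 * z ≤ a) (hR : ∀ j, S.SmallResid (τ j) z j w)
include hrs ha haF hz hza hR

theorem smul_le_kronExcept_leading (k : Fin K) :
    (1 / 2 : ℝ) ^ (K - 1) • ((kronExcept k S.L)ᵀ * kronExcept k S.L) ≤
      (kronExcept k S.L)ᵀ * (kronExcept k fun j => leading (e j) (s j)) *
        ((kronExcept k S.L)ᵀ * kronExcept k fun j => leading (e j) (s j))ᵀ := by
  have hretained := transpose_mul_leading hL hp he hrs hsp ha haF hz hza hR
  have hhalf (j : Fin K) : (0 : Matrix (Fin (r j)) (Fin (r j)) ℝ) ≤ ((S.p j : ℝ) / 2) • 1 :=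
    smul_nonneg (by positivity) zero_le_one
  have hcard : (1 / 2 : ℝ) ^ (K - 1) * S.pExcept k =
      ∏ j ∈ Finset.univ.erase k, (S.p j : ℝ) / 2 := by
    simp [div_eq_mul_inv, Finset.prod_mul_distrib, pExcept, mul_comm]
  rw [kronExcept_transpose_mul_kronExcept hL, smul_smul, hcard, ← kronExcept_smul_one,
    kronExcept_transpose, kronExcept_mul, kronExcept_transpose, kronExcept_mul]
  exact kronExcept_mono k hhalf hretained

theorem smul_mul_transpose_le_gammaCheck (k : Fin K) :
    (a * (1 / 2) ^ K) • (S.L k * (S.L k)ᵀ) ≤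
      S.gammaCheck (τ k) e s k w + (z * S.p k) • 1 := by
  set D := kronExcept k fun j => leading (e j) (s j)
  set projSignal := secondMoment S.n (S.n * S.pExcept k) fun t =>
    unfold k (tucker (S.F t) S.L) * D
  have hsignal : (1 / 2 : ℝ) ^ (K - 1) • S.gammaSignal k ≤ projSignal := by
    simp only [projSignal, gammaSignal, unfold_tucker, Matrix.mul_assoc _ (kronExcept k S.L)ᵀ]
    exact smul_secondMoment_mul_le (S.normalization_nonneg k) _ (by
      simpa using smul_le_kronExcept_leading he hsp hL hp hrs ha haF hz hza hR k)
  have hproj : projSignal ≤ (2 : ℝ) • (S.gammaCheck (τ k) e s k w + (z * S.p k) • 1) := by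
    have hdiff : (fun t => unfold k (tucker (S.F t) S.L) * D) =
        (fun t => unfold k (S.Xtr (τ k) t w) * D) - fun t => unfold k (S.resid (τ k) t w) * D := by
      ext1 t
      rw [Pi.sub_apply, ← Matrix.sub_mul, congrFun (unfold_Xtr (τ k) w k) t, Pi.add_apply,
        add_sub_cancel_right]
    simp only [projSignal, hdiff, gammaCheck_eq]
    exact (secondMoment_sub_le (S.normalization_nonneg k) _ _).trans
      (smul_le_smul_of_nonneg_left (add_le_add le_rfl
        ((secondMoment_mul_kronExcept_leading_le he hsp k _).trans (hR k))) zero_le_two)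
  have hfactor : a • (S.L k * (S.L k)ᵀ) ≤ S.gammaSignal k := by
    rw [gammaSignal_eq hL hp]
    simpa using mul_mul_transpose_mono (haF k) (S.L k)
  have hK : a * (1 / 2) ^ K = 2⁻¹ * ((1 / 2) ^ (K - 1) * a) := by
    rw [← Nat.sub_add_cancel k.pos, pow_succ, Nat.add_sub_cancel]
    ring
  rw [hK, mul_smul, mul_smul, inv_smul_le_iff_of_pos two_pos]
  exact (smul_le_smul_of_nonneg_left hfactor (by positivity)).trans (hsignal.trans hproj)

theorem le_eigVal_gammaCheck (hr : 1 ≤ r k) :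
    (a * (1 / 2) ^ K - z) * S.p k ≤ eigVal (S.gammaCheck (τ k) e s k w) (r k) := by
  rw [sub_mul]
  exact sub_le_eigVal_of_le_add (nonneg_iff_posSemidef.mp (gammaCheck_nonneg _ _ _ _ _)).isHermitian
    hr (by exact_mod_cast hp k) (hL k)
    (smul_mul_transpose_le_gammaCheck he hsp hL hp hrs ha haF hz hza hR k)

end LowerBound

end Projection

end Model

/-! ### The eigenvalue ratio criterion -/

theorem eq_of_ratio_le_ratio {μ : ℕ → ℝ} {r j : ℕ} {ρ B c u : ℝ} (hμ : ∀ i, 0 ≤ μ i)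
    (hB : ∀ i, 1 ≤ i → μ i ≤ B) (hlow : ∀ i, 1 ≤ i → i ≤ r → c ≤ μ i)
    (hhigh : ∀ i, r < i → μ i ≤ u) (hr : 1 ≤ r) (hc : 0 < c) (hρ : 0 < ρ)
    (hBu : B * (u + ρ) < c * c) (huρ : u * (u + ρ) < c * ρ) (hj : 1 ≤ j)
    (hmax : μ r / (μ (r + 1) + ρ) ≤ μ j / (μ (j + 1) + ρ)) : j = r := by
  have hu : 0 ≤ u := (hμ (r + 1)).trans (hhigh _ (Nat.lt_succ_self r))
  have hgap : c / (u + ρ) ≤ μ r / (μ (r + 1) + ρ) :=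
    div_le_div₀ (hμ r) (hlow r hr le_rfl) (add_pos_of_nonneg_of_pos (hμ _) hρ)
      (by gcongr; exact hhigh _ (Nat.lt_succ_self r))
  rcases lt_trichotomy j r with hjr | hjr | hjr
  · have hbefore : μ j / (μ (j + 1) + ρ) ≤ B / c :=
      div_le_div₀ ((hμ j).trans (hB j hj)) (hB j hj) hc
        ((hlow (j + 1) (by omega) hjr).trans (le_add_of_nonneg_right hρ.le))
    have hlt : B / c < c / (u + ρ) := (div_lt_div_iff₀ hc (by positivity)).mpr hBu
    linarith
  · exact hjr
  · have hafter : μ j / (μ (j + 1) + ρ) ≤ u / ρ :=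
      div_le_div₀ hu (hhigh j hjr) hρ (le_add_of_nonneg_left (hμ _))
    have hlt : u / ρ < c / (u + ρ) := (div_lt_div_iff₀ hρ (by positivity)).mpr huρ
    linarith

namespace Model

variable {K : ℕ} {r : Fin K → ℕ} {Ω : Type*} {S : Model K r Ω}

theorem IsRun.eq_of_smallResid {τ : Fin K → ℝ} {ρ : ℝ} {rbar : Fin K → ℕ}
    {e : Ω → ∀ j, Fin (S.p j) → Fin (S.p j) → ℝ} {rhat : ℕ → Ω → Fin K → ℕ}
    (hrun : S.IsRun τ ρ rbar e rhat) {w : Ω}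
    (he : ∀ j, IsEigenbasis (S.gammaHat (τ j) j w) (e w j))
    (hL : ∀ j, (S.L j)ᵀ * S.L j = (S.p j : ℝ) • (1 : Matrix (Fin (r j)) (Fin (r j)) ℝ))
    (hr : ∀ j, 1 ≤ r j) (hrbar : ∀ j, rbar j ≤ S.p j) {m : ℕ}
    (hprev : ∀ j, r j ≤ rhat m w j ∧ rhat m w j ≤ rbar j) {a b z c : ℝ} (ha : 0 < a) (hb : 0 ≤ b)
    (haF : ∀ j, a • 1 ≤ S.gammaF j) (hbF : ∀ j, S.gammaF j ≤ b • 1) (hz : 0 < z)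
    (hR : ∀ j, S.SmallResid (τ j) z j w) (hρ : 0 < ρ) (hza : 12 * z ≤ a) (hc : 0 < c)
    (hca : c ≤ a * (1 / 2) ^ K - z) (hbz : 2 * (b + z) * (2 * z + ρ) < c * c)
    (hzρ : 2 * z * (2 * z + ρ) < c * ρ) (k : Fin K) : rhat (m + 1) w k = r k := by
  have hsp (j : Fin K) : rhat m w j ≤ S.p j := (hprev j).2.trans (hrbar j)
  have hp (j : Fin K) : 0 < S.p j := (hr j).trans ((hprev j).1.trans (hsp j))
  have hpk : (0 : ℝ) < S.p k := by exact_mod_cast hp k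
  obtain ⟨hmem, hmax⟩ := hrun m w k
  refine eq_of_ratio_le_ratio (μ := fun i => eigVal (S.gammaCheck (τ k) _ _ k w) i / S.p k)
    (fun i => div_nonneg (eigVal_nonneg (gammaCheck_nonneg _ _ _ _ _) i) hpk.le)
    (fun i hi => (div_le_iff₀ hpk).mpr ?_) (fun i hi hir => (le_div_iff₀ hpk).mpr ?_)
    (fun i hi => (div_le_iff₀ hpk).mpr ?_) (hr k) hc hρ hbz hzρ (Finset.mem_Icc.mp hmem).1
    (hmax (r k) (Finset.mem_Icc.mpr ⟨hr k, (hprev k).1.trans (hprev k).2⟩))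
  · exact eigVal_gammaCheck_le he hsp hL hp hb (hbF k) hz.le (hR k) hi
  · calc c * S.p k ≤ (a * (1 / 2) ^ K - z) * S.p k := by gcongr
      _ ≤ eigVal _ (r k) := le_eigVal_gammaCheck he hsp hL hp (fun j => (hprev j).1) ha haF hz hza
          hR (hr k)
      _ ≤ eigVal _ i := eigVal_antitone _ hi hir ((hprev k).1.trans (hsp k))
  · exact eigVal_gammaCheck_le_of_lt he hsp hL hp hz.le (hR k) hi

end Model

end TensorFactor

namespace TensorFactor

/-! ### Truncation -/

theorem trunc_eq_max_min {τ : ℝ} (hτ : 0 ≤ τ) (x : ℝ) : trunc τ x = max (-τ) (min x τ) := by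
  rcases lt_trichotomy x 0 with hx | rfl | hx
  · rw [trunc, Real.sign_of_neg hx, abs_of_neg hx, neg_one_mul, min_eq_left (hx.le.trans hτ),
      ← max_neg_neg, neg_neg, max_comm]
  · simp [trunc, hτ]
  · rw [trunc, Real.sign_of_pos hx, abs_of_pos hx, one_mul,
      max_eq_right ((neg_nonpos.mpr hτ).trans (le_min hx.le hτ))]

theorem measurable_trunc {τ : ℝ} (hτ : 0 ≤ τ) : Measurable (trunc τ) := by
  rw [funext (trunc_eq_max_min hτ)]
  fun_prop

theorem abs_trunc_le {τ : ℝ} (hτ : 0 ≤ τ) (x : ℝ) : |trunc τ x| ≤ τ := by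
  rw [trunc_eq_max_min hτ, abs_le]
  exact ⟨le_max_left _ _, max_le (by linarith) (min_le_right _ _)⟩

theorem trunc_of_abs_le {τ x : ℝ} (hx : |x| ≤ τ) : trunc τ x = x := by
  obtain ⟨hneg, hpos⟩ := abs_le.mp hx
  rw [trunc_eq_max_min ((abs_nonneg x).trans hx), min_eq_left hpos, max_eq_right hneg]

theorem abs_trunc_add_sub_le {τ c : ℝ} (hc : |c| ≤ τ) (y : ℝ) : |trunc τ (c + y) - c| ≤ |y| := by
  have hτ : 0 ≤ τ := (abs_nonneg c).trans hc
  rw [trunc_eq_max_min hτ]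
  grind

theorem abs_trunc_add_sub_sub_le {τ c : ℝ} (hc : |c| ≤ τ) (y : ℝ) :
    |trunc τ (c + y) - c - y| ≤ |y| := by
  have hτ : 0 ≤ τ := (abs_nonneg c).trans hc
  rw [trunc_eq_max_min hτ]
  grind

theorem abs_trunc_add_sub_le_two_mul {τ c : ℝ} (hc : |c| ≤ τ) (y : ℝ) :
    |trunc τ (c + y) - c| ≤ 2 * τ :=
  calc |trunc τ (c + y) - c| ≤ |trunc τ (c + y)| + |c| := abs_sub _ _
    _ ≤ τ + τ := add_le_add (abs_trunc_le ((abs_nonneg c).trans hc) _) hc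
    _ = 2 * τ := (two_mul τ).symm

theorem rpow_le_rpow_neg_mul_rpow {a x s q : ℝ} (ha : 0 < a) (hx : a ≤ x) (hsq : s ≤ q) :
    x ^ s ≤ a ^ (-(q - s)) * x ^ q := by
  have hx0 : 0 < x := ha.trans_le hx
  calc x ^ s = x ^ (-(q - s)) * x ^ q := by rw [← Real.rpow_add hx0]; ring_nf
    _ ≤ a ^ (-(q - s)) * x ^ q := mul_le_mul_of_nonneg_right
        (Real.rpow_le_rpow_of_nonpos ha hx (by linarith)) (by positivity)

/-! ### Covariance inequalities under strong mixing -/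

section covariance

variable {Ω : Type*} {𝒜 ℬ : MeasurableSpace Ω} [m0 : MeasurableSpace Ω] {P : Measure Ω}
  [IsProbabilityMeasure P]

theorem abs_measureReal_inter_sub_le {δ : ℝ} (h : alphaMix P 𝒜 ℬ ≤ δ) {A B : Set Ω}
    (hA : MeasurableSet[𝒜] A) (hB : MeasurableSet[ℬ] B) :
    |P.real (A ∩ B) - P.real A * P.real B| ≤ δ := by
  refine le_trans (le_csSup ⟨1, ?_⟩ (by exact ⟨A, B, hA, hB, rfl⟩)) h
  rintro _ ⟨A, B, -, -, rfl⟩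
  refine abs_sub_le_of_nonneg_of_le measureReal_nonneg measureReal_le_one (by positivity) ?_
  exact mul_le_one₀ measureReal_le_one measureReal_nonneg measureReal_le_one

theorem memLp_of_abs_le {X : Ω → ℝ} (hX : Measurable X) {a : ℝ} (ha : ∀ w, |X w| ≤ a)
    (q : ENNReal) : MemLp X q P :=
  MemLp.of_bound hX.aestronglyMeasurable a (ae_of_all _ ha)

theorem memLp_indicator_one {A : Set Ω} (hA : MeasurableSet A) :
    MemLp (A.indicator (1 : Ω → ℝ)) 2 P :=
  (memLp_const (1 : ℝ)).indicator hA

theorem integral_abs_condExp_le (hm : 𝒜 ≤ m0) {W : Ω → ℝ} (hW : Integrable W P) {δ : ℝ}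
    (hδ : ∀ A, MeasurableSet[𝒜] A → |∫ w in A, W w ∂P| ≤ δ) :
    ∫ w, |(P[W|𝒜]) w| ∂P ≤ 2 * δ := by
  have hA : MeasurableSet[𝒜] {w | 0 ≤ (P[W|𝒜]) w} :=
    (stronglyMeasurable_condExp (m := 𝒜)).measurable measurableSet_Ici
  have hpos : ∫ w in {w | 0 ≤ (P[W|𝒜]) w}, |(P[W|𝒜]) w| ∂P =
      ∫ w in {w | 0 ≤ (P[W|𝒜]) w}, W w ∂P := by
    rw [← setIntegral_condExp hm hW hA]
    exact setIntegral_congr_fun (hm _ hA) fun w hw => abs_of_nonneg hw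
  have hneg : ∫ w in {w | 0 ≤ (P[W|𝒜]) w}ᶜ, |(P[W|𝒜]) w| ∂P =
      -∫ w in {w | 0 ≤ (P[W|𝒜]) w}ᶜ, W w ∂P := by
    rw [← setIntegral_condExp hm hW hA.compl, ← integral_neg]
    exact setIntegral_congr_fun (hm _ hA.compl) fun w hw => abs_of_neg (not_le.mp hw)
  rw [← integral_add_compl (hm _ hA) integrable_condExp.abs, hpos, hneg]
  linarith [le_of_abs_le (hδ _ hA), neg_le_of_abs_le (hδ _ hA.compl)]

theorem abs_integral_mul_le_of_setIntegral (hm : 𝒜 ≤ m0) {X W : Ω → ℝ} (hX : Measurable[𝒜] X)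
    {a δ : ℝ} (ha : ∀ w, |X w| ≤ a) (hW : Integrable W P)
    (hδ : ∀ A, MeasurableSet[𝒜] A → |∫ w in A, W w ∂P| ≤ δ) :
    |∫ w, X w * W w ∂P| ≤ 2 * a * δ := by
  have ha0 : 0 ≤ a := P.nonempty_of_neZero.elim fun w => (abs_nonneg _).trans (ha w)
  have hXW : Integrable (X * W) P :=
    hW.bdd_mul (hX.mono hm le_rfl).aestronglyMeasurable (ae_of_all _ ha)
  have hcond : ∫ w, X w * W w ∂P = ∫ w, X w * (P[W|𝒜]) w ∂P :=
    (integral_condExp hm (f := X * W)).symm.trans (integral_congr_ae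
      (condExp_mul_of_stronglyMeasurable_left hX.stronglyMeasurable hXW hW))
  calc |∫ w, X w * W w ∂P| ≤ ∫ w, |X w * (P[W|𝒜]) w| ∂P := by
        rw [hcond]; exact abs_integral_le_integral_abs
    _ ≤ ∫ w, a * |(P[W|𝒜]) w| ∂P := by
        refine integral_mono_of_nonneg (ae_of_all _ fun _ => abs_nonneg _)
          (integrable_condExp.abs.const_mul a) (ae_of_all _ fun w => ?_)
        dsimp only
        rw [abs_mul]
        gcongr
        exact ha w
    _ ≤ a * (2 * δ) := by
        rw [integral_const_mul]; gcongr; exact integral_abs_condExp_le hm hW hδ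
    _ = 2 * a * δ := by ring

theorem covariance_indicator_one_left {Y : Ω → ℝ} (hY : MemLp Y 2 P) {A : Set Ω}
    (hA : MeasurableSet A) :
    cov[A.indicator 1, Y; P] = ∫ w in A, (Y w - ∫ v, Y v ∂P) ∂P := by
  have hYi : Integrable Y P := hY.integrable one_le_two
  rw [covariance_eq_sub (memLp_indicator_one hA) hY,
    integral_sub hYi.integrableOn (integrable_const _), setIntegral_const,
    integral_indicator_one hA, smul_eq_mul]
  congr 1
  rw [← integral_indicator hA]
  refine integral_congr_ae (ae_of_all _ fun w => ?_)
  by_cases hw : w ∈ A <;> simp [hw]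

theorem abs_covariance_le_of_indicator (hm : 𝒜 ≤ m0) {X Y : Ω → ℝ} (hX : Measurable[𝒜] X)
    {a δ : ℝ} (ha : ∀ w, |X w| ≤ a) (hY : MemLp Y 2 P)
    (hδ : ∀ A, MeasurableSet[𝒜] A → |cov[A.indicator 1, Y; P]| ≤ δ) :
    |cov[X, Y; P]| ≤ 2 * a * δ := by
  have hX2 : MemLp X 2 P := memLp_of_abs_le (hX.mono hm le_rfl) ha 2
  have hYi : Integrable Y P := hY.integrable one_le_two
  have hcov : cov[X, Y; P] = ∫ w, X w * (Y w - ∫ v, Y v ∂P) ∂P := by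
    have hsub := integral_sub (hX2.integrable_mul hY)
      ((hX2.integrable one_le_two).mul_const (∫ v, Y v ∂P))
    rw [covariance_eq_sub hX2 hY, ← integral_mul_const, ← hsub]
    simp only [Pi.mul_apply, mul_sub]
  rw [hcov]
  refine abs_integral_mul_le_of_setIntegral hm hX ha (hYi.sub (integrable_const _)) fun A hA => ?_
  rw [← covariance_indicator_one_left hY (hm _ hA)]
  exact hδ A hA

theorem abs_covariance_le_of_alphaMix (h𝒜 : 𝒜 ≤ m0) (hℬ : ℬ ≤ m0) {δ : ℝ}
    (h : alphaMix P 𝒜 ℬ ≤ δ) {X Y : Ω → ℝ} (hX : Measurable[𝒜] X) (hY : Measurable[ℬ] Y)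
    {a b : ℝ} (ha : ∀ w, |X w| ≤ a) (hb : ∀ w, |Y w| ≤ b) :
    |cov[X, Y; P]| ≤ 4 * a * b * δ := by
  have hY2 : MemLp Y 2 P := memLp_of_abs_le (hY.mono hℬ le_rfl) hb 2
  have hXind (A : Set Ω) (hA : MeasurableSet[𝒜] A) :
      |cov[A.indicator 1, Y; P]| ≤ 2 * b * δ := by
    rw [covariance_comm]
    refine abs_covariance_le_of_indicator hℬ hY hb (memLp_indicator_one (h𝒜 _ hA)) fun B hB => ?_
    rw [covariance_comm, covariance_eq_sub (memLp_indicator_one (h𝒜 _ hA))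
      (memLp_indicator_one (hℬ _ hB)), ← Set.inter_indicator_one, integral_indicator_one (h𝒜 _ hA),
      integral_indicator_one (hℬ _ hB), integral_indicator_one ((h𝒜 _ hA).inter (hℬ _ hB))]
    exact abs_measureReal_inter_sub_le h hA hB
  linarith [abs_covariance_le_of_indicator h𝒜 hX ha hY2 hXind]

theorem abs_covariance_le_of_integral_sq_le {U V : Ω → ℝ} (hU : MemLp U 2 P) (hV : MemLp V 2 P)
    {t A B : ℝ} (ht : 0 < t) (hA : ∫ w, U w ^ 2 ∂P ≤ A) (hB : ∫ w, V w ^ 2 ∂P ≤ t ^ 2 * B) :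
    |cov[U, V; P]| ≤ (A + B) / 2 * t := by
  have hadd := variance_nonneg (t • U + V) P
  have hsub := variance_nonneg (t • U - V) P
  rw [variance_add (hU.const_smul t) hV, variance_smul, covariance_smul_left] at hadd
  rw [variance_sub (hU.const_smul t) hV, variance_smul, covariance_smul_left] at hsub
  have hvarU : t ^ 2 * Var[U; P] ≤ t ^ 2 * A := by
    gcongr; exact (variance_le_expectation_sq hU.aestronglyMeasurable).trans hA
  have hvarV : Var[V; P] ≤ t ^ 2 * B :=
    (variance_le_expectation_sq hV.aestronglyMeasurable).trans hB
  have hcov : t * |cov[U, V; P]| ≤ t * ((A + B) / 2 * t) := by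
    rw [← abs_of_pos ht, ← abs_mul, abs_of_pos ht, abs_le]
    constructor <;> linarith
  exact le_of_mul_le_mul_left hcov ht

end covariance

section moments

variable {Ω : Type*} {𝒜 ℬ : MeasurableSpace Ω} [m0 : MeasurableSpace Ω] {P : Measure Ω}

/-- A random variable bounded by `b` whose absolute moment of order `2 + 2ε` is at most `Q`. The
bound `b` grows with the truncation level, `Q` does not. -/
structure MomentBound (P : Measure Ω) (ε Q b : ℝ) (X : Ω → ℝ) : Prop where
  measurable : Measurable X
  abs_le : ∀ w, |X w| ≤ b
  moment : ∫ w, |X w| ^ (2 + 2 * ε) ∂P ≤ Q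

namespace MomentBound

variable {ε Q b : ℝ} {X Y : Ω → ℝ}

theorem moment_nonneg (h : MomentBound P ε Q b X) : 0 ≤ Q :=
  (integral_nonneg fun _ => by positivity).trans h.moment

theorem abs_mul_le (hX : MomentBound P ε Q b X) (hY : MomentBound P ε Q b Y) (w : Ω) :
    |X w * Y w| ≤ b ^ 2 := by
  rw [abs_mul, sq]
  exact mul_le_mul (hX.abs_le w) (hY.abs_le w) (abs_nonneg _) ((abs_nonneg _).trans (hX.abs_le w))

variable [IsProbabilityMeasure P]

theorem bound_nonneg (h : MomentBound P ε Q b X) : 0 ≤ b :=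
  P.nonempty_of_neZero.elim fun w => (abs_nonneg _).trans (h.abs_le w)

theorem memLp (h : MomentBound P ε Q b X) (q : ENNReal) : MemLp X q P :=
  memLp_of_abs_le h.measurable h.abs_le q

theorem integrable_pow_four (h : MomentBound P ε Q b X) : Integrable (fun w => X w ^ 4) P := by
  simpa only [Even.pow_abs (show Even 4 by decide), Real.norm_eq_abs]
    using (h.memLp (4 : ℕ)).integrable_norm_pow four_ne_zero

variable (hε : 0 < ε)
include hε

theorem integrable_rpow (h : MomentBound P ε Q b X) :
    Integrable (fun w => |X w| ^ (2 + 2 * ε)) P := by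
  have hint := (h.memLp (ENNReal.ofReal (2 + 2 * ε))).integrable_norm_rpow'
  rwa [ENNReal.toReal_ofReal (by linarith)] at hint

theorem mono (h : MomentBound P ε Q b X) (hY : Measurable Y) (hYX : ∀ w, |Y w| ≤ |X w|) :
    MomentBound P ε Q b Y where
  measurable := hY
  abs_le w := (hYX w).trans (h.abs_le w)
  moment := (integral_mono_of_nonneg (ae_of_all _ fun _ => by positivity) (h.integrable_rpow hε)
    (ae_of_all _ fun w => Real.rpow_le_rpow (abs_nonneg _) (hYX w) (by linarith))).trans h.moment

theorem integral_sq_le (h : MomentBound P ε Q b X) : ∫ w, X w ^ 2 ∂P ≤ 1 + Q := by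
  have hpoint (w : Ω) : X w ^ 2 ≤ 1 + |X w| ^ (2 + 2 * ε) := by
    have hnonneg : 0 ≤ |X w| ^ (2 + 2 * ε) := by positivity
    rw [← sq_abs]
    rcases le_total |X w| 1 with hX | hX
    · exact (pow_le_one₀ (abs_nonneg _) hX).trans (le_add_of_nonneg_right hnonneg)
    · have hpow : |X w| ^ (2 : ℝ) ≤ |X w| ^ (2 + 2 * ε) :=
        Real.rpow_le_rpow_of_exponent_le hX (by linarith)
      rw [Real.rpow_two] at hpow
      linarith
  calc ∫ w, X w ^ 2 ∂P ≤ ∫ w, (1 + |X w| ^ (2 + 2 * ε)) ∂P :=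
        integral_mono (h.memLp 2).integrable_sq
          ((integrable_const _).add (h.integrable_rpow hε)) hpoint
    _ = 1 + ∫ w, |X w| ^ (2 + 2 * ε) ∂P := by
        rw [integral_add (integrable_const _) (h.integrable_rpow hε)]
        simp
    _ ≤ 1 + Q := add_le_add le_rfl h.moment

theorem integral_sub_trunc_sq_le (h : MomentBound P ε Q b X) {a : ℝ} (ha : 0 < a) :
    ∫ w, (X w - trunc a (X w)) ^ 2 ∂P ≤ a ^ (-(2 * ε)) * Q := by
  have hpoint (w : Ω) :
      (X w - trunc a (X w)) ^ 2 ≤ a ^ (-(2 * ε)) * |X w| ^ (2 + 2 * ε) := by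
    rcases le_or_gt |X w| a with hX | hX
    · rw [trunc_of_abs_le hX, sub_self, zero_pow two_ne_zero]
      positivity
    · have hsub := abs_trunc_add_sub_sub_le (τ := a) (c := 0) (by simpa using ha.le) (X w)
      rw [zero_add, sub_zero, abs_sub_comm] at hsub
      calc (X w - trunc a (X w)) ^ 2 ≤ |X w| ^ (2 : ℝ) := by
            rw [Real.rpow_two]; exact sq_le_sq.mpr (hsub.trans (le_abs_self _))
        _ ≤ a ^ (-(2 + 2 * ε - 2)) * |X w| ^ (2 + 2 * ε) :=
            rpow_le_rpow_neg_mul_rpow ha hX.le (by linarith)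
        _ = a ^ (-(2 * ε)) * |X w| ^ (2 + 2 * ε) := by rw [add_sub_cancel_left]
  refine (integral_mono_of_nonneg (ae_of_all _ fun _ => sq_nonneg _)
    ((h.integrable_rpow hε).const_mul _) (ae_of_all _ hpoint)).trans ?_
  rw [integral_const_mul]
  gcongr
  exact h.moment

theorem integral_pow_four_le (h : MomentBound P ε Q b X) (hε1 : ε < 1) :
    ∫ w, X w ^ 4 ∂P ≤ b ^ (2 - 2 * ε) * Q := by
  have hpoint (w : Ω) : X w ^ 4 ≤ b ^ (2 - 2 * ε) * |X w| ^ (2 + 2 * ε) :=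
    calc X w ^ 4 = |X w| ^ ((4 : ℕ) : ℝ) := by rw [Real.rpow_natCast, Even.pow_abs (by decide)]
      _ = |X w| ^ (2 - 2 * ε) * |X w| ^ (2 + 2 * ε) := by
          rw [← Real.rpow_add_of_nonneg (abs_nonneg _) (by linarith) (by linarith)]
          congr 1
          push_cast
          ring
      _ ≤ b ^ (2 - 2 * ε) * |X w| ^ (2 + 2 * ε) := by
          gcongr
          · linarith
          · exact h.abs_le w
  refine (integral_mono_of_nonneg (ae_of_all _ fun _ => by positivity)
    ((h.integrable_rpow hε).const_mul _) (ae_of_all _ hpoint)).trans ?_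
  rw [integral_const_mul]
  exact mul_le_mul_of_nonneg_left h.moment (Real.rpow_nonneg h.bound_nonneg _)

theorem integral_mul_sq_le (hX : MomentBound P ε Q b X) (hY : MomentBound P ε Q b Y)
    (hε1 : ε < 1) : ∫ w, (X w * Y w) ^ 2 ∂P ≤ b ^ (2 - 2 * ε) * Q := by
  have hmono : ∫ w, (X w * Y w) ^ 2 ∂P ≤ ∫ w, (X w ^ 4 + Y w ^ 4) / 2 ∂P :=
    integral_mono_of_nonneg (ae_of_all _ fun _ => sq_nonneg _)
      ((hX.integrable_pow_four.add hY.integrable_pow_four).div_const 2)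
      (ae_of_all _ fun w => by dsimp only; nlinarith [sq_nonneg (X w ^ 2 - Y w ^ 2)])
  rw [integral_div, integral_add hX.integrable_pow_four hY.integrable_pow_four] at hmono
  linarith [hX.integral_pow_four_le hε hε1, hY.integral_pow_four_le hε hε1]

theorem abs_covariance_mul_le {X' Y' : Ω → ℝ} (hX : MomentBound P ε Q b X)
    (hY : MomentBound P ε Q b Y) (hX' : MomentBound P ε Q b X') (hY' : MomentBound P ε Q b Y')
    (hε1 : ε < 1) :
    |cov[fun w => X w * Y w, fun w => X' w * Y' w; P]| ≤ b ^ (2 - 2 * ε) * Q := by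
  refine (abs_covariance_le_of_integral_sq_le
    (memLp_of_abs_le (hX.measurable.mul hY.measurable) (hX.abs_mul_le hY) 2)
    (memLp_of_abs_le (hX'.measurable.mul hY'.measurable) (hX'.abs_mul_le hY') 2) one_pos
    (hX.integral_mul_sq_le hε hY hε1) (B := b ^ (2 - 2 * ε) * Q) ?_).trans_eq (by ring)
  rw [one_pow, one_mul]
  exact hX'.integral_mul_sq_le hε hY' hε1

theorem abs_covariance_le (hX : MomentBound P ε Q b X) (hY : MomentBound P ε Q b Y) :
    |cov[X, Y; P]| ≤ 1 + Q :=
  (abs_covariance_le_of_integral_sq_le (hX.memLp 2) (hY.memLp 2) one_pos (hX.integral_sq_le hε)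
    (by simpa only [one_pow, one_mul] using hY.integral_sq_le hε)).trans_eq (by ring)

theorem trunc_comp (h : MomentBound P ε Q b X) {a : ℝ} (ha : 0 ≤ a) :
    MomentBound P ε Q b fun w => trunc a (X w) :=
  h.mono hε ((measurable_trunc ha).comp h.measurable) fun w => by
    simpa using abs_trunc_add_sub_le (τ := a) (c := 0) (by simpa using ha) (X w)

theorem memLp_sub_trunc (h : MomentBound P ε Q b X) {a : ℝ} (ha : 0 ≤ a) (q : ENNReal) :
    MemLp (fun w => X w - trunc a (X w)) q P :=
  (h.memLp q).sub ((h.trunc_comp hε ha).memLp q)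

theorem covariance_eq_add_trunc (hX : MomentBound P ε Q b X) (hY : MomentBound P ε Q b Y) {a : ℝ}
    (ha : 0 ≤ a) :
    cov[X, Y; P] = cov[fun w => trunc a (X w), fun w => trunc a (Y w); P] +
      cov[fun w => trunc a (X w), fun w => Y w - trunc a (Y w); P] +
      cov[Y, fun w => X w - trunc a (X w); P] := by
  have htrunc : MemLp (fun w => trunc a (X w)) 2 P := (hX.trunc_comp hε ha).memLp 2
  have hsum (Z : Ω → ℝ) : (fun w => trunc a (Z w)) + (fun w => Z w - trunc a (Z w)) = Z := by
    ext w; simp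
  rw [covariance_comm Y, ← covariance_add_right htrunc ((hY.trunc_comp hε ha).memLp 2)
    (hY.memLp_sub_trunc hε ha 2), hsum Y, ← covariance_add_left htrunc
    (hX.memLp_sub_trunc hε ha 2) (hY.memLp 2), hsum X]

/-- Davydov's inequality up to the constants: truncating both variables at `exp (c * m / 4)` costs
only half of the mixing rate in the covariance of the bounded parts. -/
theorem abs_covariance_le_exp (h𝒜 : 𝒜 ≤ m0) (hℬ : ℬ ≤ m0) {c m : ℝ} (hcm : 0 ≤ c * m)
    (hε1 : ε < 1) (h : alphaMix P 𝒜 ℬ ≤ Real.exp (-(c * m))) (hX𝒜 : Measurable[𝒜] X)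
    (hYℬ : Measurable[ℬ] Y) (hX : MomentBound P ε Q b X) (hY : MomentBound P ε Q b Y) :
    |cov[X, Y; P]| ≤ (5 + 2 * Q) * Real.exp (-(ε * c / 4 * m)) := by
  set a := Real.exp (c * m / 4) with ha
  set t := Real.exp (-(ε * c / 4 * m)) with ht
  have ha0 : 0 < a := Real.exp_pos _
  have hat : a ^ (-(2 * ε)) = t ^ 2 := by
    rw [ha, ht, ← Real.exp_mul, ← Real.exp_nat_mul]
    congr 1
    push_cast
    ring
  have hmeas : Measurable (trunc a) := measurable_trunc ha0.le
  have hbounded : |cov[fun w => trunc a (X w), fun w => trunc a (Y w); P]| ≤ 4 * t :=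
    calc _ ≤ 4 * a * a * Real.exp (-(c * m)) :=
          abs_covariance_le_of_alphaMix h𝒜 hℬ h (hmeas.comp hX𝒜) (hmeas.comp hYℬ)
            (fun _ => abs_trunc_le ha0.le _) (fun _ => abs_trunc_le ha0.le _)
      _ = 4 * Real.exp (-(c * m / 2)) := by
          rw [ha, mul_assoc 4, ← Real.exp_add, mul_assoc, ← Real.exp_add]
          congr 2
          ring
      _ ≤ 4 * t := by
          refine mul_le_mul_of_nonneg_left (Real.exp_le_exp.mpr ?_) (by norm_num)
          nlinarith
  have htail_right := abs_covariance_le_of_integral_sq_le ((hX.trunc_comp hε ha0.le).memLp 2)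
    (hY.memLp_sub_trunc hε ha0.le 2) (Real.exp_pos _) ((hX.trunc_comp hε ha0.le).integral_sq_le hε)
    (hat ▸ hY.integral_sub_trunc_sq_le hε ha0)
  have htail_left := abs_covariance_le_of_integral_sq_le (hY.memLp 2)
    (hX.memLp_sub_trunc hε ha0.le 2) (Real.exp_pos _) (hY.integral_sq_le hε)
    (hat ▸ hX.integral_sub_trunc_sq_le hε ha0)
  rw [hX.covariance_eq_add_trunc hε hY ha0.le]
  refine (abs_add_three _ _ _).trans ?_
  linarith

end MomentBound

end moments

section IndependentPairs

variable {Ω : Type*} [MeasurableSpace Ω] {P : Measure Ω} [IsProbabilityMeasure P]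
  {X Y X' Y' : Ω → ℝ}

theorem covariance_mul_eq_of_indepFun (hX : MemLp X 2 P) (hY : MemLp Y 2 P) (hX' : MemLp X' 2 P)
    (hY' : MemLp Y' 2 P) (hXY : MemLp (X * Y) 2 P) (hXY' : MemLp (X' * Y') 2 P)
    (hind : IndepFun (fun w => (X w, X' w)) (fun w => (Y w, Y' w)) P) :
    cov[X * Y, X' * Y'; P] = cov[X, X'; P] * P[Y * Y'] + P[X] * P[X'] * cov[Y, Y'; P] := by
  have hfst : P[X * Y] = P[X] * P[Y] :=
    (hind.comp measurable_fst measurable_fst).integral_mul_eq_mul_integral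
      hX.aestronglyMeasurable hY.aestronglyMeasurable
  have hsnd : P[X' * Y'] = P[X'] * P[Y'] :=
    (hind.comp measurable_snd measurable_snd).integral_mul_eq_mul_integral
      hX'.aestronglyMeasurable hY'.aestronglyMeasurable
  have hprod : P[(X * X') * (Y * Y')] = P[X * X'] * P[Y * Y'] :=
    (hind.comp (measurable_fst.mul measurable_snd)
      (measurable_fst.mul measurable_snd)).integral_mul_eq_mul_integral
        (hX.aestronglyMeasurable.mul hX'.aestronglyMeasurable)
        (hY.aestronglyMeasurable.mul hY'.aestronglyMeasurable)
  rw [covariance_eq_sub hXY hXY', covariance_eq_sub hX hX', covariance_eq_sub hY hY',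
    mul_mul_mul_comm X, hprod, hfst, hsnd]
  ring

theorem abs_covariance_mul_le_of_indepFun {b δ : ℝ} (hX : Measurable X) (hY : Measurable Y)
    (hX' : Measurable X') (hY' : Measurable Y') (hXb : ∀ w, |X w| ≤ b) (hYb : ∀ w, |Y w| ≤ b)
    (hXb' : ∀ w, |X' w| ≤ b) (hYb' : ∀ w, |Y' w| ≤ b)
    (hind : IndepFun (fun w => (X w, X' w)) (fun w => (Y w, Y' w)) P)
    (hXδ : |cov[X, X'; P]| ≤ δ) (hYδ : |cov[Y, Y'; P]| ≤ δ) :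
    |cov[X * Y, X' * Y'; P]| ≤ 2 * b ^ 2 * δ := by
  have hmul {U V : Ω → ℝ} (hU : ∀ w, |U w| ≤ b) (hV : ∀ w, |V w| ≤ b) (w : Ω) :
      |(U * V) w| ≤ b * b := by
    rw [Pi.mul_apply, abs_mul]
    exact mul_le_mul (hU w) (hV w) (abs_nonneg _) ((abs_nonneg _).trans (hU w))
  have hmean {U : Ω → ℝ} {B : ℝ} (hU : ∀ w, |U w| ≤ B) : |P[U]| ≤ B := by
    simpa using norm_integral_le_of_norm_le_const (μ := P) (f := U) (ae_of_all _ hU)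
  have hδ : 0 ≤ δ := (abs_nonneg _).trans hXδ
  have hb : 0 ≤ b := (abs_nonneg _).trans (hmean hXb)
  rw [covariance_mul_eq_of_indepFun (memLp_of_abs_le hX hXb 2) (memLp_of_abs_le hY hYb 2)
    (memLp_of_abs_le hX' hXb' 2) (memLp_of_abs_le hY' hYb' 2)
    (memLp_of_abs_le (hX.mul hY) (hmul hXb hYb) 2)
    (memLp_of_abs_le (hX'.mul hY') (hmul hXb' hYb') 2) hind]
  calc _ ≤ |cov[X, X'; P]| * |P[Y * Y']| + |P[X]| * |P[X']| * |cov[Y, Y'; P]| := by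
        simp only [← abs_mul]
        exact abs_add_le _ _
    _ ≤ δ * (b * b) + b * b * δ := by
        gcongr
        exacts [hmean (hmul hYb hYb'), hmean hXb, hmean hXb']
    _ = 2 * b ^ 2 * δ := by ring

end IndependentPairs

end TensorFactor

namespace TensorFactor

open Matrix
open scoped MatrixOrder

/-! ### Random Gram matrices -/

section LoewnerBounds

variable {m : Type*} [Fintype m]

theorem dotProduct_mulVec_eq_sum_sum (A : Matrix m m ℝ) (v : m → ℝ) :
    v ⬝ᵥ A *ᵥ v = ∑ i, ∑ j, v i * v j * A i j := by
  simp only [dotProduct, mulVec, Finset.mul_sum]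
  exact Finset.sum_congr rfl fun i _ => Finset.sum_congr rfl fun j _ => by ring

variable [DecidableEq m] {A : Matrix m m ℝ}

theorem le_smul_one_of_dotProduct_mulVec_le (hA : A.IsHermitian) {R : ℝ}
    (h : ∀ v, v ⬝ᵥ A *ᵥ v ≤ R * (v ⬝ᵥ v)) : A ≤ R • 1 :=
  le_of_dotProduct_mulVec_le hA (isHermitian_one.smul (IsSelfAdjoint.all R)) fun v => by
    simpa [smul_mulVec] using h v

theorem le_smul_one_of_sum_abs_row_le (hA : A.IsHermitian) {R : ℝ}
    (hR : ∀ i, ∑ j, |A i j| ≤ R) : A ≤ R • 1 := by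
  refine le_smul_one_of_dotProduct_mulVec_le hA fun v => ?_
  have hterm (i j : m) : v i * v j * A i j ≤ (|A i j| * v i ^ 2 + |A j i| * v j ^ 2) / 2 := by
    have hsymm : A j i = A i j := hA.apply i j
    have habs : v i * v j * A i j ≤ |v i| * |v j| * |A i j| := by
      simpa only [abs_mul] using le_abs_self (v i * v j * A i j)
    rw [hsymm, ← sq_abs (v i), ← sq_abs (v j)]
    nlinarith [mul_nonneg (abs_nonneg (A i j)) (sq_nonneg (|v i| - |v j|))]
  have hrows : ∑ i, ∑ j, |A i j| * v i ^ 2 ≤ R * (v ⬝ᵥ v) := by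
    rw [dotProduct, Finset.mul_sum]
    refine Finset.sum_le_sum fun i _ => ?_
    rw [← Finset.sum_mul, ← sq]
    gcongr
    exact hR i
  have hcols : ∑ i, ∑ j, |A j i| * v j ^ 2 = ∑ i, ∑ j, |A i j| * v i ^ 2 := Finset.sum_comm
  calc v ⬝ᵥ A *ᵥ v = ∑ i, ∑ j, v i * v j * A i j := dotProduct_mulVec_eq_sum_sum A v
    _ ≤ ∑ i, ∑ j, (|A i j| * v i ^ 2 + |A j i| * v j ^ 2) / 2 := by gcongr; exact hterm _ _
    _ = (∑ i, ∑ j, |A i j| * v i ^ 2 + ∑ i, ∑ j, |A j i| * v j ^ 2) / 2 := by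
        simp_rw [← Finset.sum_div, Finset.sum_add_distrib]
    _ ≤ R * (v ⬝ᵥ v) := by rw [hcols]; linarith

theorem le_smul_one_of_sum_sq_le (hA : A.IsHermitian) {θ : ℝ} (hθ : 0 ≤ θ)
    (h : ∑ i, ∑ j, A i j ^ 2 ≤ θ ^ 2) : A ≤ θ • 1 := by
  refine le_smul_one_of_dotProduct_mulVec_le hA fun v => ?_
  have hcauchy := Finset.sum_mul_sq_le_sq_mul_sq (Finset.univ : Finset (m × m))
    (fun x => v x.1 * v x.2) (fun x => A x.1 x.2)
  simp only [Fintype.sum_prod_type] at hcauchy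
  have hnorm : ∑ i, ∑ j, (v i * v j) ^ 2 = (v ⬝ᵥ v) ^ 2 := by
    rw [sq (v ⬝ᵥ v), dotProduct, Finset.sum_mul_sum]
    exact Finset.sum_congr rfl fun i _ => Finset.sum_congr rfl fun j _ => by ring
  rw [hnorm, ← dotProduct_mulVec_eq_sum_sum] at hcauchy
  have hv : 0 ≤ v ⬝ᵥ v := Finset.sum_nonneg fun i _ => mul_self_nonneg (v i)
  refine (abs_le_of_sq_le_sq' (hcauchy.trans ?_) (mul_nonneg hθ hv)).2
  rw [mul_pow, mul_comm]
  gcongr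

end LoewnerBounds

/-- The Gram matrix `∑_x Z_{·,x} Z_{·,x}ᵀ` of a finite family of random vectors. -/
def randomGram {Ω ι m : Type*} (s : Finset ι) (Z : m → ι → Ω → ℝ) (w : Ω) : Matrix m m ℝ :=
  Matrix.of fun i j => ∑ x ∈ s, Z i x w * Z j x w

section RandomGram

variable {Ω ι m : Type*} [MeasurableSpace Ω] {P : Measure Ω}
  {s : Finset ι} {Z : m → ι → Ω → ℝ} {β R V σ : ℝ}

theorem memLp_randomGram (hZZ : ∀ i j, ∀ x ∈ s, MemLp (fun w => Z i x w * Z j x w) 2 P) (i j : m) :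
    MemLp (fun w => randomGram s Z w i j) 2 P :=
  memLp_finsetSum s fun x hx => hZZ i j x hx

theorem randomGram_le_of_sum_sq_sub_le [Fintype m] [DecidableEq m] {θ : ℝ}
    (hR : ∀ i, ∑ j, |∫ w, randomGram s Z w i j ∂P| ≤ R) (hθ : 0 ≤ θ) {w : Ω}
    (hw : ∑ i, ∑ j, (randomGram s Z w i j - ∫ v, randomGram s Z v i j ∂P) ^ 2 ≤ θ ^ 2) :
    randomGram s Z w ≤ (R + θ) • 1 := by
  have hsymm (v : Ω) (i j : m) : randomGram s Z v j i = randomGram s Z v i j :=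
    Finset.sum_congr rfl fun x _ => mul_comm _ _
  set G : Matrix m m ℝ := Matrix.of fun i j => ∫ v, randomGram s Z v i j ∂P with hG
  have hGH : G.IsHermitian := IsHermitian.ext fun i j => by simp [hG, hsymm _ i j]
  have hwH : (randomGram s Z w).IsHermitian := IsHermitian.ext fun i j => by simp [hsymm w i j]
  calc randomGram s Z w = G + (randomGram s Z w - G) := by abel
    _ ≤ R • 1 + θ • 1 := add_le_add (le_smul_one_of_sum_abs_row_le hGH hR)
        (le_smul_one_of_sum_sq_le (hwH.sub hGH) hθ hw)
    _ = (R + θ) • 1 := (add_smul _ _ _).symm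

variable [IsProbabilityMeasure P]

theorem integral_randomGram_sub_sq_le
    (hZZ : ∀ i j, ∀ x ∈ s, MemLp (fun w => Z i x w * Z j x w) 2 P)
    (hV : ∀ i j, ∀ x ∈ s,
      ∑ y ∈ s, |cov[fun w => Z i x w * Z j x w, fun w => Z i y w * Z j y w; P]| ≤ V) (i j : m) :
    ∫ w, (randomGram s Z w i j - ∫ v, randomGram s Z v i j ∂P) ^ 2 ∂P ≤ s.card * V := by
  have hmeas := (memLp_randomGram hZZ i j).aemeasurable
  calc _ = cov[fun w => randomGram s Z w i j, fun w => randomGram s Z w i j; P] := by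
        rw [covariance_self hmeas, variance_eq_integral hmeas]
    _ = ∑ x ∈ s, ∑ y ∈ s, cov[fun w => Z i x w * Z j x w, fun w => Z i y w * Z j y w; P] :=
        covariance_fun_sum_fun_sum' (hZZ i j) (hZZ i j)
    _ ≤ ∑ _x ∈ s, V := by
        have hrow (x) (hx : x ∈ s) := (Finset.sum_le_sum fun y _ =>
          le_abs_self (cov[fun w => Z i x w * Z j x w, fun w => Z i y w * Z j y w; P])).trans
            (hV i j x hx)
        exact Finset.sum_le_sum hrow
    _ = s.card * V := by simp

theorem abs_integral_mul_le_covariance_add_sq {X Y : Ω → ℝ} (hX : MemLp X 2 P) (hY : MemLp Y 2 P)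
    (hXβ : |∫ w, X w ∂P| ≤ β) (hYβ : |∫ w, Y w ∂P| ≤ β) :
    |∫ w, X w * Y w ∂P| ≤ |cov[X, Y; P]| + β ^ 2 := by
  have hcov : ∫ w, X w * Y w ∂P = cov[X, Y; P] + (∫ w, X w ∂P) * ∫ w, Y w ∂P := by
    simp [covariance_eq_sub hX hY]
  rw [hcov, sq]
  refine (abs_add_le _ _).trans (add_le_add le_rfl ?_)
  rw [abs_mul]
  exact mul_le_mul hXβ hYβ (abs_nonneg _) ((abs_nonneg _).trans hXβ)

theorem sum_abs_integral_randomGram_le [Fintype m] (hZ : ∀ i, ∀ x ∈ s, MemLp (Z i x) 2 P)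
    (hβ : ∀ i, ∀ x ∈ s, |∫ w, Z i x w ∂P| ≤ β)
    (hR : ∀ i, ∀ x ∈ s, ∑ j, |cov[Z i x, Z j x; P]| ≤ R) (i : m) :
    ∑ j, |∫ w, randomGram s Z w i j ∂P| ≤ (R + Fintype.card m * β ^ 2) * s.card := by
  have hentry (j : m) :
      |∫ w, randomGram s Z w i j ∂P| ≤ ∑ x ∈ s, (|cov[Z i x, Z j x; P]| + β ^ 2) :=
    calc |∫ w, randomGram s Z w i j ∂P| = |∑ x ∈ s, ∫ w, Z i x w * Z j x w ∂P| :=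
          congrArg abs (integral_finsetSum s fun x hx => (hZ i x hx).integrable_mul (hZ j x hx))
      _ ≤ ∑ x ∈ s, |∫ w, Z i x w * Z j x w ∂P| := Finset.abs_sum_le_sum_abs _ _
      _ ≤ _ := Finset.sum_le_sum fun x hx => abs_integral_mul_le_covariance_add_sq (hZ i x hx)
          (hZ j x hx) (hβ i x hx) (hβ j x hx)
  calc ∑ j, |∫ w, randomGram s Z w i j ∂P|
      ≤ ∑ j, ∑ x ∈ s, (|cov[Z i x, Z j x; P]| + β ^ 2) := Finset.sum_le_sum fun j _ => hentry j
    _ = ∑ x ∈ s, (∑ j, |cov[Z i x, Z j x; P]| + Fintype.card m * β ^ 2) := by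
        rw [Finset.sum_comm]
        simp [Finset.sum_add_distrib]
    _ ≤ ∑ x ∈ s, (R + Fintype.card m * β ^ 2) := by gcongr with x hx; exact hR i x hx
    _ = (R + Fintype.card m * β ^ 2) * s.card := by
        rw [Finset.sum_const, nsmul_eq_mul, mul_comm]

/-- The mean of the Gram matrix is controlled by row sums, its fluctuation by Chebyshev's inequality
in the Frobenius norm. -/
theorem measureReal_not_randomGram_le [Fintype m] [DecidableEq m] [Nonempty m]
    (hs : s.Nonempty) (hZ : ∀ i, ∀ x ∈ s, MemLp (Z i x) 2 P)
    (hZZ : ∀ i j, ∀ x ∈ s, MemLp (fun w => Z i x w * Z j x w) 2 P)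
    (hβ : ∀ i, ∀ x ∈ s, |∫ w, Z i x w ∂P| ≤ β)
    (hR : ∀ i, ∀ x ∈ s, ∑ j, |cov[Z i x, Z j x; P]| ≤ R)
    (hV : ∀ i j, ∀ x ∈ s,
      ∑ y ∈ s, |cov[fun w => Z i x w * Z j x w, fun w => Z i y w * Z j y w; P]| ≤ V)
    (hσ : 0 < σ) :
    P.real {w | ¬ randomGram s Z w ≤
      ((R + Fintype.card m * β ^ 2 + Fintype.card m * σ) * s.card) • 1} ≤ V / (s.card * σ ^ 2) := by
  set W : Ω → ℝ := fun w =>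
    ∑ i, ∑ j, (randomGram s Z w i j - ∫ v, randomGram s Z v i j ∂P) ^ 2
  set θ : ℝ := Fintype.card m * σ * s.card with hθ
  have hθ0 : 0 < θ := by positivity
  have hint (i j : m) : Integrable
      (fun w => (randomGram s Z w i j - ∫ v, randomGram s Z v i j ∂P) ^ 2) P :=
    ((memLp_randomGram hZZ i j).sub (memLp_const _)).integrable_sq
  have hWint : Integrable W P :=
    integrable_finsetSum _ fun i _ => integrable_finsetSum _ fun j _ => hint i j
  have hW0 (w : Ω) : 0 ≤ W w :=
    Finset.sum_nonneg fun i _ => Finset.sum_nonneg fun j _ => sq_nonneg _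
  have hW : ∫ w, W w ∂P ≤ (Fintype.card m : ℝ) ^ 2 * (s.card * V) :=
    calc ∫ w, W w ∂P = ∑ i, ∑ j,
          ∫ w, (randomGram s Z w i j - ∫ v, randomGram s Z v i j ∂P) ^ 2 ∂P := by
          rw [integral_finsetSum _ fun i _ => integrable_finsetSum _ fun j _ => hint i j]
          exact Finset.sum_congr rfl fun i _ => integral_finsetSum _ fun j _ => hint i j
      _ ≤ ∑ _i : m, ∑ _j : m, s.card * V := Finset.sum_le_sum fun i _ =>
          Finset.sum_le_sum fun j _ => integral_randomGram_sub_sq_le hZZ hV i j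
      _ = (Fintype.card m : ℝ) ^ 2 * (s.card * V) := by simp; ring
  calc P.real _ ≤ P.real {w | θ ^ 2 ≤ W w} := by
        refine measureReal_mono fun w hw => ?_
        by_contra hlt
        refine hw ((randomGram_le_of_sum_sq_sub_le (sum_abs_integral_randomGram_le hZ hβ hR) hθ0.le
          (not_le.mp hlt).le).trans_eq ?_)
        rw [hθ]
        ring_nf
    _ ≤ (Fintype.card m : ℝ) ^ 2 * (s.card * V) / θ ^ 2 := by
        rw [le_div_iff₀ (by positivity), mul_comm]
        exact (mul_meas_ge_le_integral_of_nonneg (ae_of_all P hW0) hWint _).trans hW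
    _ = V / (s.card * σ ^ 2) := by rw [hθ]; field_simp

end RandomGram

end TensorFactor

namespace TensorFactor

/-! ### Sums of exponentials -/

section ExponentialSums

variable {a : ℝ}

theorem sum_exp_neg_nat_le (ha : 0 < a) (s : Finset ℕ) :
    ∑ x ∈ s, Real.exp (-(a * x)) ≤ 1 + 1 / a := by
  have hgeom (x : ℕ) : Real.exp (-(a * x)) = Real.exp (-a) ^ x := by
    rw [← Real.exp_nat_mul]
    ring_nf
  have hlt : Real.exp (-a) < 1 := by simpa using ha
  have hinv : Real.exp (-a) ≤ (a + 1)⁻¹ := by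
    rw [Real.exp_neg]
    exact inv_anti₀ (by linarith) (Real.add_one_le_exp a)
  simp_rw [hgeom]
  calc ∑ x ∈ s, Real.exp (-a) ^ x ≤ ∑' x, Real.exp (-a) ^ x :=
        (summable_geometric_of_lt_one (Real.exp_pos _).le hlt).sum_le_tsum s
          fun _ _ => by positivity
    _ = (1 - Real.exp (-a))⁻¹ := tsum_geometric_of_lt_one (Real.exp_pos _).le hlt
    _ ≤ (1 - (a + 1)⁻¹)⁻¹ := by
        refine inv_anti₀ ?_ (by linarith)
        exact sub_pos.mpr (inv_lt_one_of_one_lt₀ (by linarith))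
    _ = 1 + 1 / a := by
        have hsub : 1 - (a + 1)⁻¹ = a / (a + 1) := by field_simp; ring
        rw [hsub]
        field_simp

theorem sum_exp_neg_int_le (ha : 0 < a) (c : ℤ) (s : Finset ℤ) :
    ∑ x ∈ s, Real.exp (-(a * (c - x).natAbs)) ≤ 2 * (1 + 1 / a) := by
  have hside {u : Finset ℤ} (hu : Set.InjOn (fun x => (c - x).natAbs) u) :
      ∑ x ∈ u, Real.exp (-(a * (c - x).natAbs)) ≤ 1 + 1 / a := by
    rw [← Finset.sum_image (f := fun x : ℕ => Real.exp (-(a * x))) hu]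
    exact sum_exp_neg_nat_le ha _
  rw [← Finset.sum_filter_add_sum_filter_not s fun x => c ≤ x, two_mul]
  refine add_le_add (hside fun x hx y hy hxy => ?_) (hside fun x hx y hy hxy => ?_) <;>
  · simp only [Finset.coe_filter, Set.mem_ofPred_eq] at hx hy hxy
    omega

theorem sum_exp_neg_fin_le (ha : 0 < a) {p : ℕ} (c : Fin p) :
    ∑ x : Fin p, Real.exp (-(a * ((c : ℤ) - (x : ℤ)).natAbs)) ≤ 2 * (1 + 1 / a) := by
  have hsum := sum_exp_neg_int_le ha (c : ℤ)
    (Finset.univ.image fun x : Fin p => ((x : ℕ) : ℤ))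
  rwa [Finset.sum_image fun x _ y _ hxy => Fin.ext (by exact_mod_cast hxy)] at hsum

theorem sum_exp_neg_Icc_le (ha : 0 < a) (t n : ℕ) :
    ∑ u ∈ Finset.Icc 1 n, Real.exp (-(a * ((t : ℤ) - (u : ℤ)).natAbs)) ≤ 2 * (1 + 1 / a) := by
  have hsum := sum_exp_neg_int_le ha (t : ℤ) ((Finset.Icc 1 n).image fun x : ℕ => (x : ℤ))
  rwa [Finset.sum_image fun x _ y _ hxy => by exact_mod_cast hxy] at hsum

/-- Trading decay for a large prefactor: when `x ≤ A` as well, a prefactor of size `A * exp L` only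
divides the rate of decay by `L`. -/
theorem le_mul_exp_neg_div_of_le {x A B C L c d : ℝ} (hA : 0 ≤ A) (hC : 1 ≤ C) (hL : 1 ≤ L)
    (hB : B ≤ A * C * Real.exp L) (hx : x ≤ A) (hxd : x ≤ B * Real.exp (-(c * d))) :
    x ≤ A * C * Real.exp 1 * Real.exp (-(c / L * d)) := by
  have hL0 : 0 < L := zero_lt_one.trans_le hL
  rw [mul_assoc, ← Real.exp_add]
  have hexp : 1 + -(c / L * d) = 1 - c * d / L := by ring
  rw [hexp]
  rcases le_total (c * d) L with hle | hge
  · have hone : 1 ≤ Real.exp (1 - c * d / L) :=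
      Real.one_le_exp (sub_nonneg.mpr ((div_le_one hL0).mpr hle))
    rw [mul_assoc]
    exact hx.trans (le_mul_of_one_le_right hA (one_le_mul_of_one_le_of_one_le hC hone))
  · have hneg : 1 - c * d / L ≤ 0 := sub_nonpos.mpr ((one_le_div hL0).mpr hge)
    calc x ≤ A * C * Real.exp L * Real.exp (-(c * d)) := hxd.trans (by gcongr)
      _ = A * C * Real.exp (L * (1 - c * d / L)) := by
          rw [mul_assoc, ← Real.exp_add]
          congr 2
          field_simp
          ring
      _ ≤ A * C * Real.exp (1 * (1 - c * d / L)) := by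
          gcongr A * C * Real.exp ?_
          exact mul_le_mul_of_nonpos_right hL hneg
      _ = A * C * Real.exp (1 - c * d / L) := by rw [one_mul]

end ExponentialSums

/-! ### The truncated residuals -/

theorem abs_tucker_le {K : ℕ} {d e : Fin K → ℕ} (F : Tensor d)
    (L : ∀ k, Matrix (Fin (e k)) (Fin (d k)) ℝ) {l : ℝ} (hL : ∀ k i j, |L k i j| ≤ l)
    (i : ∀ k, Fin (e k)) : |tucker F L i| ≤ (∏ k, d k : ℕ) * |l| ^ K * tnorm F := by
  have hterm (j : ∀ k, Fin (d k)) : |F j * ∏ k, L k (i k) (j k)| ≤ tnorm F * |l| ^ K := by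
    rw [abs_mul, Finset.abs_prod]
    have hF : |F j| ≤ tnorm F := Real.abs_le_sqrt (Finset.single_le_sum (f := fun j => F j ^ 2)
      (fun _ _ => sq_nonneg _) (Finset.mem_univ j))
    have hprod : ∏ k, |L k (i k) (j k)| ≤ ∏ _k : Fin K, |l| :=
      Finset.prod_le_prod (fun _ _ => abs_nonneg _) fun k _ =>
        (hL k (i k) (j k)).trans (le_abs_self l)
    rw [Finset.prod_const, Finset.card_univ, Fintype.card_fin] at hprod
    exact mul_le_mul hF hprod (by positivity) ((abs_nonneg _).trans hF)
  calc |tucker F L i| ≤ ∑ j, |F j * ∏ k, L k (i k) (j k)| := Finset.abs_sum_le_sum_abs _ _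
    _ ≤ ∑ _j : ∀ k, Fin (d k), tnorm F * |l| ^ K := Finset.sum_le_sum fun j _ => hterm j
    _ = _ := by simp; ring

namespace Model

variable {K : ℕ} {r : Fin K → ℕ} {Ω : Type*} (S : Model K r Ω)

/-- The common component is at most half of the truncation level. -/
structure SmallSignal (τ : ℝ) : Prop where
  pos : 0 < τ
  abs_tucker_le : ∀ t ∈ Finset.Icc 1 S.n, ∀ i, |tucker (S.F t) S.L i| ≤ τ / 2

/-- Centred idiosyncratic components with absolute moments of order `2 + 2ε` bounded by `Q`: the
part of `TailAssumption` that does not concern the factors. -/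
structure NoiseAssumption [MeasurableSpace Ω] (P : Measure Ω) (ε Q : ℝ) : Prop where
  measurable : ∀ i t, Measurable (S.ξ i t)
  centred : ∀ i t, ∫ w, S.ξ i t w ∂P = 0
  memLp : ∀ i t, MemLp (S.ξ i t) (ENNReal.ofReal (2 + 2 * ε)) P
  moment : ∀ i t, ∫ w, |S.ξ i t w| ^ (2 + 2 * ε) ∂P ≤ Q

/-- The truncated residual in entry `i` at time `t` as a function of the idiosyncratic
component. -/
noncomputable def residFun (τ : ℝ) (t : ℕ) (i : ∀ k, Fin (S.p k)) (x : ℝ) : ℝ :=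
  trunc τ (tucker (S.F t) S.L i + x) - tucker (S.F t) S.L i

variable {S} {τ : ℝ} {t : ℕ}

theorem SmallSignal.abs_tucker_le_self (hτ : S.SmallSignal τ) (ht : t ∈ Finset.Icc 1 S.n)
    (i : ∀ k, Fin (S.p k)) : |tucker (S.F t) S.L i| ≤ τ :=
  (hτ.abs_tucker_le t ht i).trans (half_le_self hτ.pos.le)

theorem measurable_residFun (hτ : S.SmallSignal τ) (t : ℕ) (i : ∀ k, Fin (S.p k)) :
    Measurable (S.residFun τ t i) :=
  ((measurable_trunc hτ.pos.le).comp (measurable_const_add _)).sub_const _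

theorem abs_residFun_le (hτ : S.SmallSignal τ) (ht : t ∈ Finset.Icc 1 S.n)
    (i : ∀ k, Fin (S.p k)) (x : ℝ) : |S.residFun τ t i x| ≤ 2 * τ :=
  abs_trunc_add_sub_le_two_mul (hτ.abs_tucker_le_self ht i) x

theorem abs_resid_sub_le {ε : ℝ} (hε : 0 < ε) (hτ : S.SmallSignal τ) (ht : t ∈ Finset.Icc 1 S.n)
    (i : ∀ k, Fin (S.p k)) (w : Ω) : |S.resid τ t w i - S.ξ i t w| ≤
      (τ / 2) ^ (-(1 + 2 * ε)) * |S.ξ i t w| ^ (2 + 2 * ε) := by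
  have hτ2 : 0 < τ / 2 := half_pos hτ.pos
  have hc := hτ.abs_tucker_le t ht i
  rcases le_total |S.ξ i t w| (τ / 2) with hle | hlt
  · have hzero : S.resid τ t w i = S.ξ i t w := by
      have htrunc := trunc_of_abs_le ((abs_add_le (tucker (S.F t) S.L i) (S.ξ i t w)).trans
        ((add_le_add hc hle).trans_eq (add_halves τ)))
      simp [resid, Xtr, X, htrunc]
    rw [hzero, sub_self, abs_zero]
    positivity
  · refine (abs_trunc_add_sub_sub_le (hτ.abs_tucker_le_self ht i) (S.ξ i t w)).trans ?_
    have hpow := rpow_le_rpow_neg_mul_rpow hτ2 hlt (s := 1) (q := 2 + 2 * ε) (by linarith)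
    rwa [Real.rpow_one, show 2 + 2 * ε - 1 = 1 + 2 * ε by ring] at hpow

variable [MeasurableSpace Ω] {P : Measure Ω} {ε Q : ℝ}

theorem NoiseAssumption.integrable_rpow (hε : 0 < ε) (hN : S.NoiseAssumption P ε Q)
    (i : ∀ k, Fin (S.p k)) (t : ℤ) : Integrable (fun w => |S.ξ i t w| ^ (2 + 2 * ε)) P := by
  have hint := (hN.memLp i t).integrable_norm_rpow (by simp; linarith) ENNReal.ofReal_ne_top
  rwa [ENNReal.toReal_ofReal (by linarith)] at hint

theorem momentBound_resid (hε : 0 < ε) (hN : S.NoiseAssumption P ε Q) (hτ : S.SmallSignal τ)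
    (ht : t ∈ Finset.Icc 1 S.n) (i : ∀ k, Fin (S.p k)) :
    MomentBound P ε Q (2 * τ) fun w => S.resid τ t w i where
  measurable := (measurable_residFun hτ t i).comp (hN.measurable i t)
  abs_le w := abs_residFun_le hτ ht i _
  moment := (integral_mono_of_nonneg (ae_of_all _ fun _ => by positivity)
    (hN.integrable_rpow hε i t) (ae_of_all _ fun w => Real.rpow_le_rpow (abs_nonneg _)
      (abs_trunc_add_sub_le (hτ.abs_tucker_le_self ht i) _) (by linarith))).trans (hN.moment i t)

variable [IsProbabilityMeasure P]

theorem abs_integral_resid_le (hε : 0 < ε) (hN : S.NoiseAssumption P ε Q) (hτ : S.SmallSignal τ)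
    (ht : t ∈ Finset.Icc 1 S.n) (i : ∀ k, Fin (S.p k)) :
    |∫ w, S.resid τ t w i ∂P| ≤ (τ / 2) ^ (-(1 + 2 * ε)) * Q := by
  have hτ2 : 0 < τ / 2 := half_pos hτ.pos
  have hξ : Integrable (S.ξ i t) P :=
    (hN.memLp i t).integrable (by rw [ENNReal.one_le_ofReal]; linarith)
  have hresid : Integrable (fun w => S.resid τ t w i) P :=
    ((momentBound_resid hε hN hτ ht i).memLp 1).integrable le_rfl
  calc |∫ w, S.resid τ t w i ∂P| = |∫ w, (S.resid τ t w i - S.ξ i t w) ∂P| := by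
        rw [integral_sub hresid hξ, hN.centred i t, sub_zero]
    _ ≤ ∫ w, |S.resid τ t w i - S.ξ i t w| ∂P := abs_integral_le_integral_abs
    _ ≤ ∫ w, (τ / 2) ^ (-(1 + 2 * ε)) * |S.ξ i t w| ^ (2 + 2 * ε) ∂P :=
        integral_mono_of_nonneg (ae_of_all _ fun _ => abs_nonneg _)
          ((hN.integrable_rpow hε i t).const_mul _) (ae_of_all _ (abs_resid_sub_le hε hτ ht i))
    _ ≤ (τ / 2) ^ (-(1 + 2 * ε)) * Q := by
        rw [integral_const_mul]
        gcongr
        exact hN.moment i t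

end Model

/-! ### Distances of sites -/

section Sites

variable {K : ℕ} {p : Fin K → ℕ} {k : Fin K}

theorem le_setDist {E₁ E₂ : Set ((∀ k, Fin (p k)) × ℤ)} {m : ℕ}
    (h : ∀ x ∈ E₁, ∀ y ∈ E₂, m ≤ siteDist x y) : (m : ℕ∞) ≤ setDist E₁ E₂ :=
  le_iInf₂ fun x hx => le_iInf₂ fun y hy => by exact_mod_cast h x hx y hy

/-- The index of the entry in row `i` and column `c` of the mode-`k` unfolding. -/
def rowCol (k : Fin K) (i : Fin (p k)) (c : ColIdx p k) : ∀ k, Fin (p k) :=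
  (Equiv.piSplitAt k fun j => Fin (p j)).symm (i, c)

theorem rowCol_self (i : Fin (p k)) (c : ColIdx p k) : rowCol k i c k = i := by
  simp [rowCol, Equiv.piSplitAt]

theorem rowCol_of_ne (i : Fin (p k)) (c : ColIdx p k) (j : {j // j ≠ k}) :
    rowCol k i c j = c j := by
  simp [rowCol, Equiv.piSplitAt, j.2]

theorem rowCol_inj {i i' : Fin (p k)} {c c' : ColIdx p k} :
    rowCol k i c = rowCol k i' c' ↔ i = i' ∧ c = c' := by
  rw [rowCol, rowCol, Equiv.apply_eq_iff_eq, Prod.mk.injEq]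

theorem natAbs_le_siteDist (x y : (∀ k, Fin (p k)) × ℤ) (k : Fin K) :
    ((x.1 k : ℤ) - (y.1 k : ℤ)).natAbs ≤ siteDist x y :=
  le_max_of_le_left
    (Finset.le_sup (f := fun k => ((x.1 k : ℤ) - (y.1 k : ℤ)).natAbs) (Finset.mem_univ k))

/-- The distance of the column `c` at time `t` from the column `d` at time `u`, which bounds from
below the distance of any two sites in these columns. -/
def colDist (c d : ColIdx p k) (t u : ℕ) : ℕ :=
  max (Finset.univ.sup fun j => ((c j : ℤ) - (d j : ℤ)).natAbs) ((t : ℤ) - (u : ℤ)).natAbs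

theorem colDist_le_siteDist (i i' : Fin (p k)) (c d : ColIdx p k) (t u : ℕ) :
    colDist c d t u ≤ siteDist (rowCol k i c, (t : ℤ)) (rowCol k i' d, (u : ℤ)) := by
  refine max_le (Finset.sup_le fun j _ => ?_) (le_max_right _ _)
  simpa only [rowCol_of_ne] using
    natAbs_le_siteDist (rowCol k i c, (t : ℤ)) (rowCol k i' d, (u : ℤ)) j

theorem card_ne (k : Fin K) : Fintype.card {j // j ≠ k} = K - 1 := by
  rw [Fintype.card_subtype_compl]
  simp

theorem add_sum_natAbs_le_mul_colDist (c d : ColIdx p k) (t u : ℕ) :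
    ((t : ℤ) - (u : ℤ)).natAbs + ∑ j, ((c j : ℤ) - (d j : ℤ)).natAbs ≤ K * colDist c d t u := by
  have hcols : ∑ j, ((c j : ℤ) - (d j : ℤ)).natAbs ≤ (K - 1) * colDist c d t u := by
    rw [← smul_eq_mul, ← card_ne k, ← Finset.card_univ]
    exact Finset.sum_le_card_nsmul _ _ _ fun j _ => le_max_of_le_left
      (Finset.le_sup (f := fun j => ((c j : ℤ) - (d j : ℤ)).natAbs) (Finset.mem_univ j))
  calc _ ≤ 1 * colDist c d t u + (K - 1) * colDist c d t u :=
        add_le_add ((le_max_right _ _).trans_eq (one_mul _).symm) hcols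
    _ = K * colDist c d t u := by rw [← add_mul, Nat.add_sub_cancel' (Fin.pos k)]

theorem sum_exp_neg_colDist_le {a : ℝ} (ha : 0 < a) (c : ColIdx p k) (t n : ℕ) :
    ∑ y ∈ Finset.Icc 1 n ×ˢ (Finset.univ : Finset (ColIdx p k)),
      Real.exp (-(a * colDist c y.2 t y.1)) ≤ (2 * (1 + K / a)) ^ K := by
  have hK : 0 < K := Fin.pos k
  have haK : 0 < a / K := by positivity
  have hterm (y : ℕ × ColIdx p k) : Real.exp (-(a * colDist c y.2 t y.1)) ≤
      Real.exp (-(a / K * ((t : ℤ) - (y.1 : ℤ)).natAbs)) *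
        ∏ j, Real.exp (-(a / K * ((c j : ℤ) - (y.2 j : ℤ)).natAbs)) := by
    have hdist : a / K * (((t : ℤ) - (y.1 : ℤ)).natAbs +
        ∑ j, (((c j : ℤ) - (y.2 j : ℤ)).natAbs : ℝ)) ≤ a / K * (K * colDist c y.2 t y.1) := by
      gcongr
      exact_mod_cast add_sum_natAbs_le_mul_colDist c y.2 t y.1
    rw [← mul_assoc, div_mul_cancel₀ a (by positivity), mul_add, Finset.mul_sum] at hdist
    rw [← Real.exp_sum, ← Real.exp_add, Finset.sum_neg_distrib, ← neg_add]
    exact Real.exp_le_exp.mpr (neg_le_neg hdist)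
  calc _ ≤ ∑ y ∈ Finset.Icc 1 n ×ˢ (Finset.univ : Finset (ColIdx p k)),
        Real.exp (-(a / K * ((t : ℤ) - (y.1 : ℤ)).natAbs)) *
        ∏ j, Real.exp (-(a / K * ((c j : ℤ) - (y.2 j : ℤ)).natAbs)) :=
        Finset.sum_le_sum fun y _ => hterm y
    _ = (∑ u ∈ Finset.Icc 1 n, Real.exp (-(a / K * ((t : ℤ) - (u : ℤ)).natAbs))) *
        ∏ j : {j // j ≠ k}, ∑ x : Fin (p j),
          Real.exp (-(a / K * ((c j : ℤ) - (x : ℤ)).natAbs)) := by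
        rw [Finset.sum_product, Finset.prod_univ_sum, Fintype.piFinset_univ, Finset.sum_mul_sum]
    _ ≤ (2 * (1 + 1 / (a / K))) * ∏ _j : {j // j ≠ k}, (2 * (1 + 1 / (a / K))) := by
        gcongr
        exacts [sum_exp_neg_Icc_le haK t n, sum_exp_neg_fin_le haK _]
    _ = (2 * (1 + K / a)) ^ K := by
        rw [Finset.prod_const, Finset.card_univ, card_ne, ← pow_succ', Nat.sub_add_cancel hK,
          one_div_div]

end Sites

/-! ### Mixing of the residuals -/

namespace Model

variable {K : ℕ} {r : Fin K → ℕ} {Ω : Type*} (S : Model K r Ω)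

/-- The entries of the unfolded truncated residuals, where the columns of all times are put next to
each other. -/
noncomputable def residEntry (τ : ℝ) (k : Fin K) (i : Fin (S.p k)) (x : ℕ × ColIdx S.p k) (w : Ω) :
    ℝ := unfold k (S.resid τ x.1 w) i x.2

/-- Independent time series, each exponentially strongly mixing: the part of `IndepAssumption`
that does not concern the factors. -/
structure IndepMixing [MeasurableSpace Ω] (P : Measure Ω) (c₀ : ℝ) : Prop where
  indep : iIndepFun (fun i w t => S.ξ i t w) P
  mixing : ∀ (i : ∀ k, Fin (S.p k)) (t : ℤ) (m : ℕ),
    alphaMix P (S.sigma {x | x.1 = i ∧ x.2 ≤ t}) (S.sigma {x | x.1 = i ∧ t + m ≤ x.2})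
      ≤ Real.exp (-(c₀ * m))

/-- An exponentially strongly mixing random field: the part of `FieldAssumption` that does not
concern the factors. -/
def FieldMixing [MeasurableSpace Ω] (P : Measure Ω) (c₀ : ℝ) : Prop :=
  ∀ (m : ℕ) (E₁ E₂ : Set ((∀ k, Fin (S.p k)) × ℤ)), (m : ℕ∞) ≤ setDist E₁ E₂ →
    alphaMix P (S.sigma E₁) (S.sigma E₂) ≤ Real.exp (-(c₀ * m))

/-- The mixing assumption on the idiosyncratic components in the given regime: the part of
`DependenceAssumption` that does not concern the factors. -/
def MixingAssumption [MeasurableSpace Ω] (R : Regime) (P : Measure Ω) (c₀ : ℝ) : Prop :=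
  match R with
  | .indep => S.IndepMixing P c₀
  | .field => S.FieldMixing P c₀

variable {S} {τ : ℝ} {k : Fin K}

theorem measurable_sigma {E : Set ((∀ k, Fin (S.p k)) × ℤ)} {i : ∀ k, Fin (S.p k)} {t : ℤ}
    (h : (i, t) ∈ E) {f : ℝ → ℝ} (hf : Measurable f) : Measurable[S.sigma E] (f ∘ S.ξ i t) :=
  hf.comp (Measurable.mono (comap_measurable (S.ξ i t))
    (le_iSup₂ (f := fun (x : (∀ k, Fin (S.p k)) × ℤ) (_ : x ∈ E) =>
      MeasurableSpace.comap (S.ξ x.1 x.2) inferInstance) (i, t) h) le_rfl)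

theorem measurable_sigma_residEntry (hτ : S.SmallSignal τ) {E : Set ((∀ k, Fin (S.p k)) × ℤ)}
    {i : Fin (S.p k)} {x : ℕ × ColIdx S.p k} (h : (rowCol k i x.2, (x.1 : ℤ)) ∈ E) :
    Measurable[S.sigma E] (S.residEntry τ k i x) :=
  measurable_sigma h (measurable_residFun hτ x.1 (rowCol k i x.2))

variable [m0 : MeasurableSpace Ω] {P : Measure Ω} {ε Q c₀ : ℝ}

theorem sigma_le (hξ : ∀ i t, Measurable (S.ξ i t)) (E : Set ((∀ k, Fin (S.p k)) × ℤ)) :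
    S.sigma E ≤ m0 :=
  iSup₂_le fun x _ => (hξ x.1 x.2).comap_le

theorem IndepMixing.indepFun_comp (hS : S.IndepMixing P c₀) {i j : ∀ k, Fin (S.p k)} (hij : i ≠ j)
    {β γ : Type*} [MeasurableSpace β] [MeasurableSpace γ] {f : (ℤ → ℝ) → β} {g : (ℤ → ℝ) → γ}
    (hf : Measurable f) (hg : Measurable g) :
    IndepFun (fun w => f fun t => S.ξ i t w) (fun w => g fun t => S.ξ j t w) P :=
  (hS.indep.indepFun hij).comp hf hg

variable [IsProbabilityMeasure P]

theorem IndepMixing.abs_covariance_comp_le (hS : S.IndepMixing P c₀)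
    (hξ : ∀ i t, Measurable (S.ξ i t)) (i : ∀ k, Fin (S.p k)) {f g : ℝ → ℝ} (hf : Measurable f)
    (hg : Measurable g) {a b : ℝ} (ha : ∀ x, |f x| ≤ a) (hb : ∀ x, |g x| ≤ b) (t u : ℤ) :
    |cov[f ∘ S.ξ i t, g ∘ S.ξ i u; P]| ≤ 4 * a * b * Real.exp (-(c₀ * (t - u).natAbs)) := by
  wlog htu : t ≤ u generalizing f g a b t u
  · rw [covariance_comm, mul_right_comm 4 a b, ← Int.natAbs_neg, neg_sub]
    exact this hg hf hb ha u t (le_of_not_ge htu)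
  exact abs_covariance_le_of_alphaMix (sigma_le hξ _) (sigma_le hξ _)
    (hS.mixing i t (t - u).natAbs)
    (measurable_sigma (E := {x | x.1 = i ∧ x.2 ≤ t}) ⟨rfl, le_rfl⟩ hf)
    (measurable_sigma (E := {x | x.1 = i ∧ t + (t - u).natAbs ≤ x.2})
      ⟨rfl, by dsimp only; omega⟩ hg)
    (fun _ => ha _) fun _ => hb _

variable (hε : 0 < ε) (hN : S.NoiseAssumption P ε Q) (hτ : S.SmallSignal τ)
include hε hN hτ

omit [IsProbabilityMeasure P] in
theorem momentBound_residEntry (i : Fin (S.p k)) {x : ℕ × ColIdx S.p k}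
    (hx : x.1 ∈ Finset.Icc 1 S.n) : MomentBound P ε Q (2 * τ) (S.residEntry τ k i x) :=
  momentBound_resid hε hN hτ hx _

theorem IndepMixing.abs_covariance_residEntry_le (hS : S.IndepMixing P c₀) (i j : Fin (S.p k))
    {x : ℕ × ColIdx S.p k} (hx : x.1 ∈ Finset.Icc 1 S.n) :
    |cov[S.residEntry τ k i x, S.residEntry τ k j x; P]| ≤
      (5 + 2 * Q) * Real.exp (-(ε * c₀ / 4 * ((i : ℤ) - (j : ℤ)).natAbs)) := by
  have hi := momentBound_residEntry hε hN hτ i hx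
  have hj := momentBound_residEntry hε hN hτ j hx
  have hQ := hi.moment_nonneg
  rcases eq_or_ne i j with rfl | hij
  · simp only [sub_self, Int.natAbs_zero, Nat.cast_zero, mul_zero, neg_zero, Real.exp_zero,
      mul_one]
    linarith [hi.abs_covariance_le hε hi]
  · have hmeas (i : Fin (S.p k)) :
        Measurable fun y : ℤ → ℝ => S.residFun τ x.1 (rowCol k i x.2) (y x.1) :=
      (measurable_residFun hτ _ _).comp (measurable_pi_apply _)
    have hind : IndepFun (S.residEntry τ k i x) (S.residEntry τ k j x) P :=
      hS.indepFun_comp (fun h => hij (rowCol_inj.mp h).1) (hmeas i) (hmeas j)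
    rw [hind.covariance_eq_zero (hi.memLp 2) (hj.memLp 2), abs_zero]
    positivity

theorem FieldMixing.abs_covariance_residEntry_le (hε1 : ε < 1) (hc₀ : 0 < c₀)
    (hS : S.FieldMixing P c₀) (i j : Fin (S.p k)) {x : ℕ × ColIdx S.p k}
    (hx : x.1 ∈ Finset.Icc 1 S.n) :
    |cov[S.residEntry τ k i x, S.residEntry τ k j x; P]| ≤
      (5 + 2 * Q) * Real.exp (-(ε * c₀ / 4 * ((i : ℤ) - (j : ℤ)).natAbs)) := by
  have hmix := hS ((i : ℤ) - (j : ℤ)).natAbs {(rowCol k i x.2, (x.1 : ℤ))}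
    {(rowCol k j x.2, (x.1 : ℤ))} <| le_setDist <| by
      rintro _ rfl _ rfl
      simpa only [rowCol_self] using
        natAbs_le_siteDist (rowCol k i x.2, (x.1 : ℤ)) (rowCol k j x.2, (x.1 : ℤ)) k
  exact MomentBound.abs_covariance_le_exp hε (sigma_le hN.measurable _) (sigma_le hN.measurable _)
    (by positivity) hε1 hmix (measurable_sigma_residEntry hτ (Set.mem_singleton _))
    (measurable_sigma_residEntry hτ (Set.mem_singleton _)) (momentBound_residEntry hε hN hτ i hx)
    (momentBound_residEntry hε hN hτ j hx)

theorem sum_abs_covariance_residEntry_le {R : Regime} (hε1 : ε < 1) (hc₀ : 0 < c₀)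
    (hS : S.MixingAssumption R P c₀) (i : Fin (S.p k)) {x : ℕ × ColIdx S.p k}
    (hx : x.1 ∈ Finset.Icc 1 S.n) :
    ∑ j, |cov[S.residEntry τ k i x, S.residEntry τ k j x; P]| ≤
      (5 + 2 * Q) * (2 * (1 + 1 / (ε * c₀ / 4))) := by
  have hQ := (momentBound_residEntry hε hN hτ i hx).moment_nonneg
  have hcov (j : Fin (S.p k)) : |cov[S.residEntry τ k i x, S.residEntry τ k j x; P]| ≤
      (5 + 2 * Q) * Real.exp (-(ε * c₀ / 4 * ((i : ℤ) - (j : ℤ)).natAbs)) :=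
    match R with
    | .indep => IndepMixing.abs_covariance_residEntry_le hε hN hτ hS i j hx
    | .field => FieldMixing.abs_covariance_residEntry_le hε hN hτ hε1 hc₀ hS i j hx
  calc _ ≤ ∑ j : Fin (S.p k),
        (5 + 2 * Q) * Real.exp (-(ε * c₀ / 4 * ((i : ℤ) - (j : ℤ)).natAbs)) :=
        Finset.sum_le_sum fun j _ => hcov j
    _ ≤ (5 + 2 * Q) * (2 * (1 + 1 / (ε * c₀ / 4))) := by
        rw [← Finset.mul_sum]
        gcongr
        exact sum_exp_neg_fin_le (by positivity) i

variable (i j : Fin (S.p k)) {x y : ℕ × ColIdx S.p k} (hx : x.1 ∈ Finset.Icc 1 S.n)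
  (hy : y.1 ∈ Finset.Icc 1 S.n)
include hx hy

theorem FieldMixing.abs_covariance_residEntry_mul_le (hS : S.FieldMixing P c₀) :
    |cov[S.residEntry τ k i x * S.residEntry τ k j x,
      S.residEntry τ k i y * S.residEntry τ k j y; P]| ≤
      8 * (2 * τ) ^ 4 * Real.exp (-(c₀ * colDist x.2 y.2 x.1 y.1)) := by
  have hmix := hS (colDist x.2 y.2 x.1 y.1)
    {(rowCol k i x.2, (x.1 : ℤ)), (rowCol k j x.2, (x.1 : ℤ))}
    {(rowCol k i y.2, (y.1 : ℤ)), (rowCol k j y.2, (y.1 : ℤ))} <| le_setDist <| by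
      rintro _ (rfl | rfl) _ (rfl | rfl) <;> exact colDist_le_siteDist _ _ _ _ _ _
  have hcov := abs_covariance_le_of_alphaMix (sigma_le hN.measurable _)
    (sigma_le hN.measurable _) hmix
    ((measurable_sigma_residEntry (i := i) hτ (by simp)).mul
      (measurable_sigma_residEntry (i := j) hτ (by simp)))
    ((measurable_sigma_residEntry (i := i) hτ (by simp)).mul
      (measurable_sigma_residEntry (i := j) hτ (by simp)))
    ((momentBound_residEntry hε hN hτ i hx).abs_mul_le (momentBound_residEntry hε hN hτ j hx))
    ((momentBound_residEntry hε hN hτ i hy).abs_mul_le (momentBound_residEntry hε hN hτ j hy))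
  calc _ ≤ 4 * (2 * τ) ^ 2 * (2 * τ) ^ 2 * Real.exp (-(c₀ * colDist x.2 y.2 x.1 y.1)) := hcov
    _ = 4 * (2 * τ) ^ 4 * Real.exp (-(c₀ * colDist x.2 y.2 x.1 y.1)) := by ring
    _ ≤ 8 * (2 * τ) ^ 4 * Real.exp (-(c₀ * colDist x.2 y.2 x.1 y.1)) := by gcongr; norm_num

omit hε in
theorem IndepMixing.abs_covariance_residEntry_sq_le (hS : S.IndepMixing P c₀)
    (hxy : x.2 = y.2) :
    |cov[S.residEntry τ k i x ^ 2, S.residEntry τ k i y ^ 2; P]| ≤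
      4 * (2 * τ) ^ 4 * Real.exp (-(c₀ * ((x.1 : ℤ) - (y.1 : ℤ)).natAbs)) := by
  obtain ⟨t, c⟩ := x
  obtain ⟨u, d⟩ := y
  obtain rfl : c = d := hxy
  have hmeas (t : ℕ) := (measurable_residFun hτ t (rowCol k i c)).pow_const 2
  have hsq {t : ℕ} (ht : t ∈ Finset.Icc 1 S.n) (x : ℝ) :
      |S.residFun τ t (rowCol k i c) x ^ 2| ≤ (2 * τ) ^ 2 := by
    rw [abs_pow]
    exact pow_le_pow_left₀ (abs_nonneg _) (abs_residFun_le hτ ht _ x) 2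
  exact (hS.abs_covariance_comp_le hN.measurable (rowCol k i c) (hmeas t) (hmeas u) (hsq hx)
    (hsq hy) t u).trans_eq (by ring)

theorem IndepMixing.abs_covariance_residEntry_mul_le_of_ne (hS : S.IndepMixing P c₀)
    (hij : i ≠ j) (hxy : x.2 = y.2) :
    |cov[S.residEntry τ k i x * S.residEntry τ k j x,
      S.residEntry τ k i y * S.residEntry τ k j y; P]| ≤
      8 * (2 * τ) ^ 4 * Real.exp (-(c₀ * ((x.1 : ℤ) - (y.1 : ℤ)).natAbs)) := by
  obtain ⟨t, c⟩ := x
  obtain ⟨u, d⟩ := y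
  obtain rfl : c = d := hxy
  have hmeas (i : Fin (S.p k)) (t : ℕ) := measurable_residFun hτ t (rowCol k i c)
  have hpair (i : Fin (S.p k)) : Measurable fun y : ℤ → ℝ =>
      (S.residFun τ t (rowCol k i c) (y t), S.residFun τ u (rowCol k i c) (y u)) :=
    ((hmeas i t).comp (measurable_pi_apply _)).prodMk ((hmeas i u).comp (measurable_pi_apply _))
  have hcov (i : Fin (S.p k)) := hS.abs_covariance_comp_le hN.measurable (rowCol k i c)
    (hmeas i t) (hmeas i u) (abs_residFun_le hτ hx _) (abs_residFun_le hτ hy _) t u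
  have hbx (i : Fin (S.p k)) := momentBound_residEntry (x := (t, c)) hε hN hτ i hx
  have hby (i : Fin (S.p k)) := momentBound_residEntry (x := (u, c)) hε hN hτ i hy
  exact (abs_covariance_mul_le_of_indepFun (hbx i).measurable (hbx j).measurable
    (hby i).measurable (hby j).measurable (hbx i).abs_le (hbx j).abs_le (hby i).abs_le
    (hby j).abs_le (hS.indepFun_comp (fun h => hij (rowCol_inj.mp h).1) (hpair i) (hpair j))
    (hcov i) (hcov j)).trans_eq (by ring)

theorem IndepMixing.abs_covariance_residEntry_mul_le (hS : S.IndepMixing P c₀)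
    (hxy : x.2 = y.2) :
    |cov[S.residEntry τ k i x * S.residEntry τ k j x,
      S.residEntry τ k i y * S.residEntry τ k j y; P]| ≤
      8 * (2 * τ) ^ 4 * Real.exp (-(c₀ * ((x.1 : ℤ) - (y.1 : ℤ)).natAbs)) := by
  rcases eq_or_ne i j with rfl | hij
  · rw [← pow_two, ← pow_two]
    refine (IndepMixing.abs_covariance_residEntry_sq_le hN hτ i hx hy hS hxy).trans ?_
    gcongr
    norm_num
  · exact IndepMixing.abs_covariance_residEntry_mul_le_of_ne hε hN hτ i j hx hy hS hij hxy

theorem IndepMixing.covariance_residEntry_mul_of_ne (hS : S.IndepMixing P c₀) (hxy : x.2 ≠ y.2) :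
    cov[S.residEntry τ k i x * S.residEntry τ k j x,
      S.residEntry τ k i y * S.residEntry τ k j y; P] = 0 := by
  classical
  have hdisj : Disjoint ({rowCol k i x.2, rowCol k j x.2} : Finset (∀ k, Fin (S.p k)))
      {rowCol k i y.2, rowCol k j y.2} := by
    simp [Finset.disjoint_left, rowCol_inj, hxy]
  have hind := hS.indep.indepFun_finset _ _ hdisj fun i =>
    measurable_pi_lambda _ fun t => hN.measurable i t
  have hmeas (x : ℕ × ColIdx S.p k) : Measurable
      fun z : (({rowCol k i x.2, rowCol k j x.2} : Finset (∀ k, Fin (S.p k))) → ℤ → ℝ) =>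
        S.residFun τ x.1 (rowCol k i x.2) (z ⟨rowCol k i x.2, by simp⟩ x.1) *
          S.residFun τ x.1 (rowCol k j x.2) (z ⟨rowCol k j x.2, by simp⟩ x.1) :=
    ((measurable_residFun hτ _ _).comp ((measurable_pi_apply _).comp (measurable_pi_apply _))).mul
      ((measurable_residFun hτ _ _).comp ((measurable_pi_apply _).comp (measurable_pi_apply _)))
  have hmemLp {x : ℕ × ColIdx S.p k} (hx : x.1 ∈ Finset.Icc 1 S.n) :
      MemLp (S.residEntry τ k i x * S.residEntry τ k j x) 2 P := by
    have hi := momentBound_residEntry hε hN hτ i hx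
    have hj := momentBound_residEntry hε hN hτ j hx
    exact memLp_of_abs_le (hi.measurable.mul hj.measurable) (hi.abs_mul_le hj) 2
  exact (hind.comp (hmeas x) (hmeas y)).covariance_eq_zero (hmemLp hx) (hmemLp hy)

end Model

end TensorFactor

namespace TensorFactor

open scoped MatrixOrder

/-! ### Concentration of the residual second moment matrices -/

namespace Model

variable {K : ℕ} {r : Fin K → ℕ} {Ω : Type*} (S : Model K r Ω)

/-- The logarithm whose power (of exponent `1` or `K`) is `logFactor`. -/
noncomputable def logSize (R : Regime) (k : Fin K) : ℝ :=
  match R with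
  | .indep => Real.log (S.n * S.pExcept k)
  | .field => Real.log (S.n * S.pAll)

variable {S} {τ : ℝ} {k : Fin K}

theorem card_Icc_prod_univ (k : Fin K) :
    ((Finset.Icc 1 S.n ×ˢ (Finset.univ : Finset (ColIdx S.p k))).card : ℝ) =
      S.n * S.pExcept k := by
  have hprod : S.pExcept k = ∏ j : {j // j ≠ k}, S.p j :=
    Finset.prod_subtype _ (by simp) _
  simp [Finset.card_product, hprod]

theorem mul_pExcept_pos (hn : 0 < S.n) (hp : ∀ k, 0 < S.p k) (k : Fin K) :
    (0 : ℝ) < S.n * S.pExcept k := by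
  rw [pExcept]
  exact_mod_cast Nat.mul_pos hn (Finset.prod_pos fun j _ => hp j)

theorem gammaResid_eq_smul_randomGram (w : Ω) : S.gammaResid τ k w =
    ((S.n : ℝ) * S.pExcept k)⁻¹ • randomGram
      (Finset.Icc 1 S.n ×ˢ (Finset.univ : Finset (ColIdx S.p k))) (S.residEntry τ k) w := by
  ext i j
  rw [gammaResid, secondMoment, Matrix.smul_apply, Matrix.smul_apply, Matrix.sum_apply,
    randomGram, Matrix.of_apply, Finset.sum_product]
  rfl

variable [MeasurableSpace Ω] {P : Measure Ω} [IsProbabilityMeasure P] {ε Q c₀ : ℝ}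
  (hε : 0 < ε) (hN : S.NoiseAssumption P ε Q) (hτ : S.SmallSignal τ)
include hε hN hτ

section CovarianceSums

variable (hε1 : ε < 1) (hc₀ : 0 < c₀) {C L : ℝ} (hC : 1 ≤ C) (hL : 1 ≤ L)
  (hτC : 8 * (2 * τ) ^ 4 ≤ (2 * τ) ^ (2 - 2 * ε) * Q * C * Real.exp L)
  (i j : Fin (S.p k)) {x : ℕ × ColIdx S.p k} (hx : x.1 ∈ Finset.Icc 1 S.n)
include hε1 hc₀ hC hL hτC hx

theorem IndepMixing.sum_abs_covariance_residEntry_mul_le (hS : S.IndepMixing P c₀) :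
    ∑ y ∈ Finset.Icc 1 S.n ×ˢ (Finset.univ : Finset (ColIdx S.p k)),
      |cov[S.residEntry τ k i x * S.residEntry τ k j x,
        S.residEntry τ k i y * S.residEntry τ k j y; P]| ≤
      (2 * τ) ^ (2 - 2 * ε) * Q * C * Real.exp 1 * (2 * (1 + L / c₀)) := by
  set A := (2 * τ) ^ (2 - 2 * ε) * Q
  have hQ := (momentBound_residEntry hε hN hτ i hx).moment_nonneg
  have hτ0 := hτ.pos
  have hA0 : 0 ≤ A := by positivity
  have hterm {u : ℕ} (hu : u ∈ Finset.Icc 1 S.n) :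
      ∑ d : ColIdx S.p k, |cov[S.residEntry τ k i x * S.residEntry τ k j x,
        S.residEntry τ k i (u, d) * S.residEntry τ k j (u, d); P]| ≤
      A * C * Real.exp 1 * Real.exp (-(c₀ / L * ((x.1 : ℤ) - (u : ℤ)).natAbs)) := by
    rw [Finset.sum_eq_single x.2]
    · have hb (i : Fin (S.p k)) := momentBound_residEntry (x := (u, x.2)) hε hN hτ i hu
      exact le_mul_exp_neg_div_of_le hA0 hC hL hτC
        ((momentBound_residEntry hε hN hτ i hx).abs_covariance_mul_le hε
          (momentBound_residEntry hε hN hτ j hx) (hb i) (hb j) hε1)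
        (IndepMixing.abs_covariance_residEntry_mul_le hε hN hτ i j hx (y := (u, x.2)) hu hS rfl)
    · intro d _ hd
      rw [IndepMixing.covariance_residEntry_mul_of_ne hε hN hτ i j hx (y := (u, d)) hu hS hd.symm,
        abs_zero]
    · simp
  rw [Finset.sum_product]
  calc _ ≤ ∑ u ∈ Finset.Icc 1 S.n,
        A * C * Real.exp 1 * Real.exp (-(c₀ / L * ((x.1 : ℤ) - (u : ℤ)).natAbs)) :=
        Finset.sum_le_sum fun u hu => hterm hu
    _ ≤ A * C * Real.exp 1 * (2 * (1 + 1 / (c₀ / L))) := by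
        rw [← Finset.mul_sum]
        gcongr
        exact sum_exp_neg_Icc_le (by positivity) _ _
    _ = _ := by rw [one_div_div]

theorem FieldMixing.sum_abs_covariance_residEntry_mul_le (hS : S.FieldMixing P c₀) :
    ∑ y ∈ Finset.Icc 1 S.n ×ˢ (Finset.univ : Finset (ColIdx S.p k)),
      |cov[S.residEntry τ k i x * S.residEntry τ k j x,
        S.residEntry τ k i y * S.residEntry τ k j y; P]| ≤
      (2 * τ) ^ (2 - 2 * ε) * Q * C * Real.exp 1 * (2 * (1 + K * L / c₀)) ^ K := by
  set A := (2 * τ) ^ (2 - 2 * ε) * Q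
  have hb (i : Fin (S.p k)) {x : ℕ × ColIdx S.p k} (hx : x.1 ∈ Finset.Icc 1 S.n) :=
    momentBound_residEntry hε hN hτ i hx
  have hQ := (hb i hx).moment_nonneg
  have hτ0 := hτ.pos
  have hA0 : 0 ≤ A := by positivity
  have hterm {y : ℕ × ColIdx S.p k} (hy : y.1 ∈ Finset.Icc 1 S.n) :
      |cov[S.residEntry τ k i x * S.residEntry τ k j x,
        S.residEntry τ k i y * S.residEntry τ k j y; P]| ≤
      A * C * Real.exp 1 * Real.exp (-(c₀ / L * colDist x.2 y.2 x.1 y.1)) :=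
    le_mul_exp_neg_div_of_le hA0 hC hL hτC
      ((hb i hx).abs_covariance_mul_le hε (hb j hx) (hb i hy) (hb j hy) hε1)
      (FieldMixing.abs_covariance_residEntry_mul_le hε hN hτ i j hx hy hS)
  calc _ ≤ ∑ y ∈ Finset.Icc 1 S.n ×ˢ (Finset.univ : Finset (ColIdx S.p k)),
        A * C * Real.exp 1 * Real.exp (-(c₀ / L * colDist x.2 y.2 x.1 y.1)) :=
        Finset.sum_le_sum fun y hy => hterm (Finset.mem_product.mp hy).1
    _ ≤ A * C * Real.exp 1 * (2 * (1 + K / (c₀ / L))) ^ K := by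
        rw [← Finset.mul_sum]
        gcongr
        exact sum_exp_neg_colDist_le (by positivity) _ _ _
    _ = _ := by rw [div_div_eq_mul_div]

end CovarianceSums

theorem sum_abs_covariance_residEntry_mul_le {R : Regime} (hε1 : ε < 1) (hc₀ : 0 < c₀)
    (hS : S.MixingAssumption R P c₀) {C : ℝ} (hC : 1 ≤ C) (hL : 1 ≤ S.logSize R k)
    (hτC : 8 * (2 * τ) ^ 4 ≤ (2 * τ) ^ (2 - 2 * ε) * Q * C * Real.exp (S.logSize R k))
    (i j : Fin (S.p k)) {x : ℕ × ColIdx S.p k} (hx : x.1 ∈ Finset.Icc 1 S.n) :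
    ∑ y ∈ Finset.Icc 1 S.n ×ˢ (Finset.univ : Finset (ColIdx S.p k)),
      |cov[S.residEntry τ k i x * S.residEntry τ k j x,
        S.residEntry τ k i y * S.residEntry τ k j y; P]| ≤
      (2 * τ) ^ (2 - 2 * ε) * Q * C * Real.exp 1 *
        ((2 * (1 + K / c₀)) ^ K * S.logFactor R k) := by
  have hQ := (momentBound_residEntry hε hN hτ i hx).moment_nonneg
  have hτ0 := hτ.pos
  have hK : (1 : ℝ) ≤ K := by exact_mod_cast Fin.pos k
  have hlin {q : ℝ} : 2 * (1 + q * S.logSize R k / c₀) ≤ 2 * (1 + q / c₀) * S.logSize R k := by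
    linarith [show q * S.logSize R k / c₀ = q / c₀ * S.logSize R k by ring]
  cases R with
  | indep =>
    refine (IndepMixing.sum_abs_covariance_residEntry_mul_le hε hN hτ hε1 hc₀ hC hL hτC i j hx
      hS).trans (mul_le_mul_of_nonneg_left ?_ (by positivity))
    have hbase : 2 * (1 + 1 / c₀) ≤ (2 * (1 + K / c₀)) ^ K := by
      refine le_trans (by gcongr) (le_self_pow₀ ?_ (Fin.pos k).ne')
      linarith [show 0 ≤ K / c₀ by positivity]
    calc 2 * (1 + S.logSize .indep k / c₀) ≤ 2 * (1 + 1 / c₀) * S.logSize .indep k := by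
          simpa only [one_mul] using hlin (q := 1)
      _ ≤ (2 * (1 + K / c₀)) ^ K * S.logSize .indep k := by gcongr
  | field =>
    refine (FieldMixing.sum_abs_covariance_residEntry_mul_le hε hN hτ hε1 hc₀ hC hL hτC i j hx
      hS).trans (mul_le_mul_of_nonneg_left ?_ (by positivity))
    calc (2 * (1 + K * S.logSize .field k / c₀)) ^ K
        ≤ (2 * (1 + K / c₀) * S.logSize .field k) ^ K := pow_le_pow_left₀ (by positivity) hlin K
      _ = (2 * (1 + K / c₀)) ^ K * S.logFactor .field k := mul_pow _ _ _

theorem measureReal_not_smallResid_le {R : Regime} (hε1 : ε < 1) (hc₀ : 0 < c₀)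
    (hS : S.MixingAssumption R P c₀) {C σ : ℝ} (hC : 1 ≤ C) (hL : 1 ≤ S.logSize R k)
    (hτC : 8 * (2 * τ) ^ 4 ≤ (2 * τ) ^ (2 - 2 * ε) * Q * C * Real.exp (S.logSize R k))
    (hσ : 0 < σ) (hn : 0 < S.n) (hp : ∀ k, 0 < S.p k) :
    P.real {w | ¬ S.SmallResid τ ((5 + 2 * Q) * (2 * (1 + 1 / (ε * c₀ / 4))) / S.p k +
        ((τ / 2) ^ (-(1 + 2 * ε)) * Q) ^ 2 + σ) k w} ≤
      (2 * τ) ^ (2 - 2 * ε) * Q * C * Real.exp 1 *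
        ((2 * (1 + K / c₀)) ^ K * S.logFactor R k) / (S.n * S.pExcept k * σ ^ 2) := by
  set s := Finset.Icc 1 S.n ×ˢ (Finset.univ : Finset (ColIdx S.p k))
  have : Nonempty (Fin (S.p k)) := ⟨⟨0, hp k⟩⟩
  have hpk : (0 : ℝ) < S.p k := by exact_mod_cast hp k
  have hcard : (s.card : ℝ) = S.n * S.pExcept k := card_Icc_prod_univ k
  have hcard0 : (0 : ℝ) < S.n * S.pExcept k := mul_pExcept_pos hn hp k
  have hpE : (S.pExcept k : ℝ) ≠ 0 := right_ne_zero_of_mul hcard0.ne'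
  have hsne : s.Nonempty := Finset.card_pos.mp (by exact_mod_cast hcard ▸ hcard0)
  have hmem {x} (hx : x ∈ s) : x.1 ∈ Finset.Icc 1 S.n := (Finset.mem_product.mp hx).1
  have hb (i : Fin (S.p k)) {x : ℕ × ColIdx S.p k} (hx : x ∈ s) :=
    momentBound_residEntry hε hN hτ i (hmem hx)
  have hGram := measureReal_not_randomGram_le (P := P) (Z := S.residEntry τ k) hsne
    (fun i x hx => (hb i hx).memLp 2)
    (fun i j x hx => memLp_of_abs_le ((hb i hx).measurable.mul (hb j hx).measurable)
      ((hb i hx).abs_mul_le (hb j hx)) 2)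
    (fun i x hx => abs_integral_resid_le hε hN hτ (hmem hx) _)
    (fun i x hx => sum_abs_covariance_residEntry_le hε hN hτ hε1 hc₀ hS i (hmem hx))
    (fun i j x hx =>
      sum_abs_covariance_residEntry_mul_le hε hN hτ hε1 hc₀ hS hC hL hτC i j (hmem hx)) hσ
  rw [hcard] at hGram
  refine le_trans (measureReal_mono ?_) hGram
  intro w hw hsmall
  refine hw ?_
  rw [SmallResid, gammaResid_eq_smul_randomGram]
  refine (smul_le_smul_of_nonneg_left hsmall (inv_nonneg.mpr hcard0.le)).trans_eq ?_
  rw [smul_smul, Fintype.card_fin]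
  congr 1
  field_simp

end Model

end TensorFactor

namespace TensorFactor

/-! ### Rates -/

section TruncationLevel

variable {ε c T τ Q : ℝ}

theorem rpow_bias_le (hε : 0 < ε) (hc : 0 < c) (hT : 1 ≤ T) (hTτ : T ≤ c * τ) (hQ : 0 ≤ Q) :
    ((τ / 2) ^ (-(1 + 2 * ε)) * Q) ^ 2 ≤
      ((2 * c) ^ (1 + 2 * ε)) ^ 2 * Q * (Q * T ^ (-(2 * ε))) := by
  have hT0 : 0 < T := by linarith
  have hlevel : T / (2 * c) ≤ τ / 2 := by
    rw [div_le_iff₀ (by positivity)]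
    linarith
  have hτ : 0 ≤ (τ / 2) ^ (-(1 + 2 * ε)) :=
    Real.rpow_nonneg ((by positivity : 0 ≤ T / (2 * c)).trans hlevel) _
  have hτT : (τ / 2) ^ (-(1 + 2 * ε)) ≤ (2 * c) ^ (1 + 2 * ε) * T ^ (-(1 + 2 * ε)) := by
    refine (Real.rpow_le_rpow_of_nonpos (by positivity) hlevel (by linarith)).trans_eq ?_
    rw [Real.div_rpow hT0.le (by positivity), Real.rpow_neg (by positivity : 0 ≤ 2 * c),
      div_inv_eq_mul, mul_comm]
  have hsq : (T ^ (-(1 + 2 * ε))) ^ 2 ≤ T ^ (-(2 * ε)) := by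
    rw [← Real.rpow_mul_natCast hT0.le]
    refine Real.rpow_le_rpow_of_exponent_le hT ?_
    push_cast
    linarith
  calc ((τ / 2) ^ (-(1 + 2 * ε)) * Q) ^ 2
      ≤ ((2 * c) ^ (1 + 2 * ε) * T ^ (-(1 + 2 * ε)) * Q) ^ 2 := by gcongr
    _ = ((2 * c) ^ (1 + 2 * ε)) ^ 2 * Q * (Q * (T ^ (-(1 + 2 * ε))) ^ 2) := by ring
    _ ≤ _ := by gcongr

variable (hT : 0 < T) (hτ : 0 < τ) (hτT : τ ≤ c * T)
include hT hτ hτT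

theorem rpow_variance_le (hε1 : ε < 1) (hQ : 0 ≤ Q) :
    (2 * τ) ^ (2 - 2 * ε) * Q * (Q * T ^ (-(2 + 2 * ε))) ≤
      (2 * c) ^ (2 - 2 * ε) * (Q * T ^ (-(2 * ε))) ^ 2 := by
  have hc : 0 < c := pos_of_mul_pos_left (hτ.trans_le hτT) hT.le
  have hpow : (2 * τ) ^ (2 - 2 * ε) ≤ (2 * c) ^ (2 - 2 * ε) * T ^ (2 - 2 * ε) := by
    rw [← Real.mul_rpow (by positivity) hT.le]
    exact Real.rpow_le_rpow (by positivity) (by linarith) (by linarith)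
  have hexp : T ^ (2 - 2 * ε) * T ^ (-(2 + 2 * ε)) = (T ^ (-(2 * ε))) ^ 2 := by
    rw [← Real.rpow_add hT, ← Real.rpow_mul_natCast hT.le]
    congr 1
    push_cast
    ring
  calc _ ≤ (2 * c) ^ (2 - 2 * ε) * T ^ (2 - 2 * ε) * Q * (Q * T ^ (-(2 + 2 * ε))) := by gcongr
    _ = (2 * c) ^ (2 - 2 * ε) * (Q ^ 2 * (T ^ (2 - 2 * ε) * T ^ (-(2 + 2 * ε)))) := by ring
    _ = _ := by rw [hexp]; ring

theorem two_mul_pow_four_le (hε : 0 < ε) :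
    (2 * τ) ^ 4 ≤ (2 * τ) ^ (2 - 2 * ε) * ((2 * c) ^ (2 + 2 * ε) * T ^ (2 + 2 * ε)) := by
  have hc : 0 < c := pos_of_mul_pos_left (hτ.trans_le hτT) hT.le
  calc (2 * τ) ^ 4 = (2 * τ) ^ (2 - 2 * ε) * (2 * τ) ^ (2 + 2 * ε) := by
        rw [← Real.rpow_add (by positivity), ← Real.rpow_natCast]
        congr 1
        push_cast
        ring
    _ ≤ _ := by
        rw [← Real.mul_rpow (by positivity) hT.le]
        exact mul_le_mul_of_nonneg_left
          (Real.rpow_le_rpow (by positivity) (by linarith) (by positivity)) (by positivity)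

end TruncationLevel

namespace Model

variable {K : ℕ} {r : Fin K → ℕ} {Ω : Type*} {S : Model K r Ω} {R : Regime} {k : Fin K}
  (hn : 3 ≤ S.n) (hp : ∀ k, 0 < S.p k)
include hn hp

theorem one_le_log_mul_pExcept : 1 ≤ Real.log (S.n * S.pExcept k) := by
  have hn3 : (3 : ℝ) ≤ S.n := by exact_mod_cast hn
  have hpE : (1 : ℝ) ≤ S.pExcept k := by exact_mod_cast Finset.prod_pos fun j _ => hp j
  rw [Real.le_log_iff_exp_le (by positivity)]
  nlinarith [Real.exp_one_lt_d9]

omit hn in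
theorem mul_pExcept_le_mul_pAll : (S.n * S.pExcept k : ℝ) ≤ S.n * S.pAll := by
  gcongr
  exact Finset.prod_le_prod_of_subset_of_one_le' (Finset.erase_subset k _) fun j _ _ => hp j

theorem log_mul_pExcept_le_logSize : Real.log (S.n * S.pExcept k) ≤ S.logSize R k := by
  cases R with
  | indep => exact le_rfl
  | field =>
    exact Real.log_le_log (mul_pExcept_pos (by omega) hp k) (mul_pExcept_le_mul_pAll hp)

theorem one_le_logFactor : 1 ≤ S.logFactor R k := by
  cases R with
  | indep => exact one_le_log_mul_pExcept hn hp
  | field =>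
    exact one_le_pow₀ ((one_le_log_mul_pExcept hn hp).trans
      (log_mul_pExcept_le_logSize hn hp (R := .field) (k := k)))

variable {ε om : ℝ} (hom : 0 < om)
include hom

theorem tauRate_pos : 0 < S.tauRate R ε om k :=
  mul_pos hom (Real.rpow_pos_of_pos (div_pos (mul_pExcept_pos (by omega) hp k)
    (one_pos.trans_le (one_le_logFactor hn hp))) _)

variable (hε : 0 < ε)
include hε

theorem tauRate_rpow : S.tauRate R ε om k ^ (2 + 2 * ε) =
    om ^ (2 + 2 * ε) * ((S.n * S.pExcept k : ℝ) / S.logFactor R k) := by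
  have hx := div_pos (mul_pExcept_pos (by omega) hp k)
    (one_pos.trans_le (one_le_logFactor hn hp (R := R) (k := k)))
  rw [tauRate, Real.mul_rpow hom.le (Real.rpow_nonneg hx.le _), ← Real.rpow_mul hx.le,
    one_div_mul_cancel (by linarith), Real.rpow_one]

theorem tauRate_rpow_le : S.tauRate R ε om k ^ (2 + 2 * ε) ≤
    om ^ (2 + 2 * ε) * Real.exp (S.logSize R k) := by
  have hN := mul_pExcept_pos (by omega) hp k
  rw [tauRate_rpow hn hp hom hε]
  gcongr
  calc (S.n * S.pExcept k : ℝ) / S.logFactor R k ≤ S.n * S.pExcept k :=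
        div_le_self hN.le (one_le_logFactor hn hp)
    _ ≤ Real.exp (S.logSize R k) := by
        rw [← Real.log_le_iff_le_exp hN]
        exact log_mul_pExcept_le_logSize hn hp

theorem two_mul_pow_four_le_mul_exp_logSize {c τ : ℝ} (hτ : 0 < τ)
    (hτc : τ ≤ c * S.tauRate R ε om k) :
    8 * (2 * τ) ^ 4 ≤ (2 * τ) ^ (2 - 2 * ε) * om ^ (2 + 2 * ε) *
      max 1 (8 * (2 * c) ^ (2 + 2 * ε)) * Real.exp (S.logSize R k) := by
  have hT := tauRate_pos hn hp hom (R := R) (ε := ε) (k := k)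
  calc 8 * (2 * τ) ^ 4 ≤ 8 * ((2 * τ) ^ (2 - 2 * ε) *
        ((2 * c) ^ (2 + 2 * ε) * S.tauRate R ε om k ^ (2 + 2 * ε))) := by
        gcongr
        exact two_mul_pow_four_le hT hτ hτc hε
    _ = (2 * τ) ^ (2 - 2 * ε) *
        ((8 * (2 * c) ^ (2 + 2 * ε)) * S.tauRate R ε om k ^ (2 + 2 * ε)) := by ring
    _ ≤ (2 * τ) ^ (2 - 2 * ε) * (max 1 (8 * (2 * c) ^ (2 + 2 * ε)) *
        (om ^ (2 + 2 * ε) * Real.exp (S.logSize R k))) := by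
        gcongr
        exacts [le_max_right _ _, tauRate_rpow_le hn hp hom hε]
    _ = _ := by ring

theorem logFactor_div_eq : S.logFactor R k / (S.n * S.pExcept k : ℝ) =
    om ^ (2 + 2 * ε) * S.tauRate R ε om k ^ (-(2 + 2 * ε)) := by
  have hQ := (Real.rpow_pos_of_pos hom (2 + 2 * ε)).ne'
  rw [Real.rpow_neg (tauRate_pos hn hp hom).le, tauRate_rpow hn hp hom hε, mul_inv, inv_div,
    mul_inv_cancel_left₀ hQ]

theorem psi_eq : S.psi R ε om k =
    om ^ (2 + 2 * ε) * S.tauRate R ε om k ^ (-(2 * ε)) := by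
  have hx := div_pos (mul_pExcept_pos (by omega) hp k)
    (one_pos.trans_le (one_le_logFactor hn hp (R := R) (k := k)))
  rw [psi, tauRate, Real.mul_rpow hom.le (Real.rpow_nonneg hx.le _), ← Real.rpow_mul hx.le,
    ← mul_assoc, ← Real.rpow_add hom, ← inv_div, Real.inv_rpow hx.le, ← Real.rpow_neg hx.le,
    add_neg_cancel_right, Real.rpow_two]
  congr 2
  field_simp

theorem one_le_tauRate_of_psi_le (hψ : S.psi R ε om k ≤ om ^ (2 + 2 * ε)) :
    1 ≤ S.tauRate R ε om k := by
  have hQ := Real.rpow_pos_of_pos hom (2 + 2 * ε)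
  rw [psi_eq hn hp hom hε, mul_le_iff_le_one_right hQ] at hψ
  by_contra! hT
  exact hψ.not_gt (Real.one_lt_rpow_of_pos_of_lt_one_of_neg (tauRate_pos hn hp hom) hT
    (by linarith))

end Model

/-! ### Tightness of the residual second moment matrices relative to the penalty -/

namespace Model

variable {K : ℕ} {r : Fin K → ℕ}

theorem measureReal_not_smallResid_le_of_psi_le {Ω : Type*} {S : Model K r Ω}
    [MeasurableSpace Ω] {P : Measure Ω} [IsProbabilityMeasure P] {R : Regime} {k : Fin K}
    {ε om c₀ c₁ c₂ B C ρ τ : ℝ} (hn : 3 ≤ S.n) (hp : ∀ k, 0 < S.p k) (hε : 0 < ε) (hε1 : ε < 1)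
    (hom : 0 < om) (hc₀ : 0 < c₀) (hN : S.NoiseAssumption P ε (om ^ (2 + 2 * ε)))
    (hS : S.MixingAssumption R P c₀) (hτ : S.SmallSignal τ) (hT1 : 1 ≤ S.tauRate R ε om k)
    (hc₁ : 0 < c₁) (h₁ : S.tauRate R ε om k ≤ c₁ * τ) (h₂ : τ ≤ c₂ * S.tauRate R ε om k)
    (hB : 0 < B) (hρ : 0 < ρ) (hψ : S.psi R ε om k ≤ C * ρ) (hpρ : 1 / (S.p k : ℝ) ≤ C * ρ) :
    P.real {w | ¬ S.SmallResid τ (((5 + 2 * om ^ (2 + 2 * ε)) * (2 * (1 + 1 / (ε * c₀ / 4))) * C +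
      ((2 * c₁) ^ (1 + 2 * ε)) ^ 2 * om ^ (2 + 2 * ε) * C + B) * ρ) k w} ≤
      (2 * c₂) ^ (2 - 2 * ε) * (max 1 (8 * (2 * c₂) ^ (2 + 2 * ε)) * Real.exp 1 *
        (2 * (1 + K / c₀)) ^ K) * C ^ 2 / B ^ 2 := by
  set T := S.tauRate R ε om k
  set Q := om ^ (2 + 2 * ε)
  have hτ0 := hτ.pos
  have hT0 : 0 < T := by linarith
  have hQ0 : 0 < Q := Real.rpow_pos_of_pos hom _
  have hc₂ : 0 < c₂ := pos_of_mul_pos_left (hτ0.trans_le h₂) hT0.le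
  set C₂ := max 1 (8 * (2 * c₂) ^ (2 + 2 * ε))
  have hτC := two_mul_pow_four_le_mul_exp_logSize hn hp hom hε hτ0 h₂
  have hbias := rpow_bias_le hε hc₁ hT1 h₁ hQ0.le
  have hvariance := rpow_variance_le hT0 hτ0 h₂ hε1 hQ0.le
  rw [← psi_eq hn hp hom hε] at hbias hvariance
  rw [← logFactor_div_eq hn hp hom hε] at hvariance
  have hψ0 : 0 ≤ S.psi R ε om k := psi_eq hn hp hom hε ▸ by positivity
  have hL : 1 ≤ S.logSize R k :=
    (one_le_log_mul_pExcept hn hp).trans (log_mul_pExcept_le_logSize hn hp)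
  calc _ ≤ P.real {w | ¬ S.SmallResid τ ((5 + 2 * Q) * (2 * (1 + 1 / (ε * c₀ / 4))) / S.p k +
        ((τ / 2) ^ (-(1 + 2 * ε)) * Q) ^ 2 + B * ρ) k w} := by
        refine measureReal_mono fun w hw hsmall => hw (hsmall.mono ?_)
        have hbias' := mul_le_mul_of_nonneg_left hψ
          (by positivity : 0 ≤ ((2 * c₁) ^ (1 + 2 * ε)) ^ 2 * Q)
        have hdim := mul_le_mul_of_nonneg_left hpρ
          (by positivity : 0 ≤ (5 + 2 * Q) * (2 * (1 + 1 / (ε * c₀ / 4))))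
        rw [mul_one_div] at hdim
        linarith
    _ ≤ (2 * τ) ^ (2 - 2 * ε) * Q * C₂ * Real.exp 1 *
        ((2 * (1 + K / c₀)) ^ K * S.logFactor R k) / (S.n * S.pExcept k * (B * ρ) ^ 2) :=
        measureReal_not_smallResid_le hε hN hτ hε1 hc₀ hS (le_max_left 1 _) hL hτC
          (by positivity) (by omega) hp
    _ = (2 * τ) ^ (2 - 2 * ε) * Q * (S.logFactor R k / (S.n * S.pExcept k)) *
        (C₂ * Real.exp 1 * (2 * (1 + K / c₀)) ^ K) / (B * ρ) ^ 2 := by ring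
    _ ≤ (2 * c₂) ^ (2 - 2 * ε) * (C * ρ) ^ 2 *
        (C₂ * Real.exp 1 * (2 * (1 + K / c₀)) ^ K) / (B * ρ) ^ 2 := by
        gcongr ?_ * _ / _
        exact hvariance.trans (by gcongr)
    _ = _ := by field_simp

end Model

section Sequences

variable {K : ℕ} {r : Fin K → ℕ} {Ω : ℕ → Type*} [∀ ν, MeasurableSpace (Ω ν)]
  {P : ∀ ν, Measure (Ω ν)} {S : ∀ ν, Model K r (Ω ν)}
  {R : Regime} {ε om c₀ : ℝ} {τ : ℕ → Fin K → ℝ} {ρ : ℕ → ℝ}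

omit [∀ ν, MeasurableSpace (Ω ν)] in
theorem Model.eventually_smallSignal {lbar : ℝ} {M : ℕ → ℝ} {τ : ℕ → ℝ}
    (hL : ∀ ν k i j, |(S ν).L k i j| ≤ lbar)
    (hF : ∀ ν, ∀ t ∈ Finset.Icc 1 (S ν).n, tnorm ((S ν).F t) ≤ M ν) (hτ0 : ∀ ν, 0 < τ ν)
    (hM : M =o[atTop] τ) : ∀ᶠ ν in atTop, (S ν).SmallSignal (τ ν) := by
  set D := ((∏ k, r k : ℕ) : ℝ) * |lbar| ^ K
  filter_upwards [(hM.const_mul_left D).bound (half_pos one_pos)] with ν hν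
  refine ⟨hτ0 ν, fun t ht i => ?_⟩
  calc _ ≤ D * tnorm ((S ν).F t) := abs_tucker_le _ _ (hL ν) i
    _ ≤ D * M ν := by
        gcongr
        exact hF ν t ht
    _ ≤ ‖D * M ν‖ := Real.le_norm_self _
    _ ≤ 1 / 2 * ‖τ ν‖ := hν
    _ = τ ν / 2 := by rw [Real.norm_of_nonneg (hτ0 ν).le]; ring

variable [∀ ν, IsProbabilityMeasure (P ν)]
  (hn : Tendsto (fun ν => (S ν).n) atTop atTop)
  (hp : ∀ k, Tendsto (fun ν => (S ν).p k) atTop atTop)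
  (hε : 0 < ε) (hε1 : ε < 1) (hom : 0 < om) (hc₀ : 0 < c₀)
  (hN : ∀ ν, (S ν).NoiseAssumption (P ν) ε (om ^ (2 + 2 * ε)))
  (hS : ∀ ν, (S ν).MixingAssumption R (P ν) c₀)
  (hτ0 : ∀ k, ∀ᶠ ν in atTop, (S ν).SmallSignal (τ ν k))
  (hτ : ∀ k, (fun ν => τ ν k) =Θ[atTop] fun ν => (S ν).tauRate R ε om k)
  (hρ0 : ∀ ν, 0 < ρ ν) (hρ : Tendsto ρ atTop (𝓝 0))
  (hψρ : (fun ν => ∑ k, max ((S ν).psi R ε om k) (1 / ((S ν).p k : ℝ))) =O[atTop] ρ)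
include hn hp hε hε1 hom hc₀ hN hS hτ0 hτ hρ0 hρ hψρ

theorem Model.exists_eventually_measureReal_not_smallResid_le (k : Fin K) {η : ℝ} (hη : 0 < η) :
    ∃ C, 0 < C ∧ ∀ᶠ ν in atTop,
      (P ν).real {w | ¬ (S ν).SmallResid (τ ν k) (C * ρ ν) k w} ≤ η := by
  obtain ⟨c₂, h₂⟩ := (hτ k).1.isBigOWith
  obtain ⟨c₁, hc₁, h₁⟩ := (hτ k).2.exists_pos
  obtain ⟨C, hC, hCρ⟩ := hψρ.exists_pos
  set E := (2 * c₂) ^ (2 - 2 * ε) * (max 1 (8 * (2 * c₂) ^ (2 + 2 * ε)) * Real.exp 1 *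
        (2 * (1 + K / c₀)) ^ K) * C ^ 2
  obtain ⟨B, hEB, hB⟩ : ∃ B : ℝ, E / B ^ 2 ≤ η ∧ 0 < B :=
    ((tendsto_const_nhds.div_atTop (tendsto_pow_atTop two_ne_zero)).eventually_le_const hη
      |>.and (eventually_gt_atTop 0)).exists
  refine ⟨(5 + 2 * om ^ (2 + 2 * ε)) * (2 * (1 + 1 / (ε * c₀ / 4))) * C +
    ((2 * c₁) ^ (1 + 2 * ε)) ^ 2 * om ^ (2 + 2 * ε) * C + B, by positivity, ?_⟩
  have hCρ0 : Tendsto (fun ν => C * ρ ν) atTop (𝓝 0) := by simpa using hρ.const_mul C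
  filter_upwards [h₁.bound, h₂.bound, hCρ.bound, hn.eventually_ge_atTop 3,
    eventually_all.mpr fun j => (hp j).eventually_gt_atTop 0, hτ0 k,
    hCρ0.eventually_le_const (Real.rpow_pos_of_pos hom (2 + 2 * ε))]
    with ν h₁ h₂ hCρ hn hp hτ hCρ0
  have hterm (j : Fin K) : 0 ≤ max ((S ν).psi R ε om j) (1 / ((S ν).p j : ℝ)) :=
    le_max_of_le_right (by positivity)
  have hmax : max ((S ν).psi R ε om k) (1 / ((S ν).p k : ℝ)) ≤ C * ρ ν :=
    calc _ ≤ ∑ j, max ((S ν).psi R ε om j) (1 / ((S ν).p j : ℝ)) :=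
          Finset.single_le_sum (fun j _ => hterm j) (Finset.mem_univ k)
      _ ≤ C * ρ ν := by
          rwa [Real.norm_of_nonneg (Finset.sum_nonneg fun j _ => hterm j),
            Real.norm_of_nonneg (hρ0 ν).le] at hCρ
  have hψ := (le_max_left _ _).trans hmax
  rw [Real.norm_of_nonneg (Model.tauRate_pos hn hp hom).le,
    Real.norm_of_nonneg hτ.pos.le] at h₁ h₂
  exact (Model.measureReal_not_smallResid_le_of_psi_le hn hp hε hε1 hom hc₀ (hN ν) (hS ν) hτ
    (Model.one_le_tauRate_of_psi_le hn hp hom hε (hψ.trans hCρ0)) hc₁ h₁ h₂ hB (hρ0 ν) hψ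
    ((le_max_right _ _).trans hmax)).trans hEB

theorem Model.exists_eventually_measureReal_not_forall_smallResid_le {η : ℝ} (hη : 0 < η) :
    ∃ C, 0 < C ∧ ∀ᶠ ν in atTop,
      (P ν).real {w | ¬ ∀ k, (S ν).SmallResid (τ ν k) (C * ρ ν) k w} ≤ η := by
  choose C hC hCη using fun k =>
    Model.exists_eventually_measureReal_not_smallResid_le hn hp hε hε1 hom hc₀ hN hS hτ0 hτ hρ0
      hρ hψρ k (show 0 < η / (K + 1) by positivity)
  have hC0 : 0 ≤ ∑ k, C k := Finset.sum_nonneg fun k _ => (hC k).le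
  refine ⟨∑ k, C k + 1, by linarith, ?_⟩
  filter_upwards [eventually_all.mpr hCη] with ν hν
  have hsub : {w | ¬ ∀ k, (S ν).SmallResid (τ ν k) ((∑ j, C j + 1) * ρ ν) k w} ⊆
      ⋃ k, {w | ¬ (S ν).SmallResid (τ ν k) (C k * ρ ν) k w} := by
    intro w hw
    obtain ⟨k, hk⟩ := not_forall.mp hw
    refine Set.mem_iUnion.mpr ⟨k, fun hsmall => hk (hsmall.mono ?_)⟩
    have hle : C k ≤ ∑ j, C j + 1 :=
      (Finset.single_le_sum (fun j _ => (hC j).le) (Finset.mem_univ k)).trans (by linarith)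
    exact mul_le_mul_of_nonneg_right hle (hρ0 ν).le
  calc _ ≤ _ := measureReal_mono hsub
    _ ≤ ∑ k, (P ν).real {w | ¬ (S ν).SmallResid (τ ν k) (C k * ρ ν) k w} :=
        measureReal_iUnion_fintype_le _
    _ ≤ ∑ _k : Fin K, η / (K + 1) := Finset.sum_le_sum fun k _ => hν k
    _ ≤ η := by
        rw [Finset.sum_const, Finset.card_univ, Fintype.card_fin, nsmul_eq_mul, mul_div_left_comm]
        exact mul_le_of_le_one_right hη.le (div_le_one_of_le₀ (by linarith) (by positivity))

end Sequences

end TensorFactor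

namespace TensorFactor

open Matrix
open scoped MatrixOrder

/-! ### Consistency of the iterates -/

section Convergence

variable {Ω : ℕ → Type*} [∀ ν, MeasurableSpace (Ω ν)] {P : ∀ ν, Measure (Ω ν)}
  [∀ ν, IsProbabilityMeasure (P ν)] {E : ∀ ν, Set (Ω ν)}

theorem tendsto_measure_one_of_tendsto_compl (h : Tendsto (fun ν => P ν (E ν)ᶜ) atTop (𝓝 0)) :
    Tendsto (fun ν => P ν (E ν)) atTop (𝓝 1) := by
  have hsub : Tendsto (fun ν => 1 - P ν (E ν)ᶜ) atTop (𝓝 1) := by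
    simpa using ENNReal.Tendsto.sub tendsto_const_nhds h (Or.inl ENNReal.one_ne_top)
  refine tendsto_of_tendsto_of_tendsto_of_le_of_le hsub tendsto_const_nhds (fun ν => ?_)
    fun ν => prob_le_one
  rw [tsub_le_iff_right, ← measure_univ (μ := P ν)]
  exact measure_univ_le_add_compl _

theorem tendsto_measure_zero_of_subset_union {A : ∀ ν, Set (Ω ν)} {G : ℝ → ∀ ν, Set (Ω ν)}
    (hA : Tendsto (fun ν => P ν (A ν)) atTop (𝓝 0))
    (hG : ∀ η > 0, ∃ C > 0, ∀ᶠ ν in atTop, (P ν).real (G C ν) ≤ η)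
    (hE : ∀ C > 0, ∀ᶠ ν in atTop, E ν ⊆ A ν ∪ G C ν) :
    Tendsto (fun ν => P ν (E ν)) atTop (𝓝 0) := by
  have htoReal (B : ∀ ν, Set (Ω ν)) : Tendsto (fun ν => (P ν).real (B ν)) atTop (𝓝 0) ↔
      Tendsto (fun ν => P ν (B ν)) atTop (𝓝 0) :=
    ENNReal.tendsto_toReal_iff (fun ν => measure_ne_top _ _) ENNReal.zero_ne_top
  rw [← htoReal] at hA ⊢
  refine tendsto_order.mpr ⟨fun x hx => .of_forall fun ν => hx.trans_le measureReal_nonneg,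
    fun η hη => ?_⟩
  obtain ⟨C, hC, hGC⟩ := hG (η / 2) (half_pos hη)
  filter_upwards [hA.eventually_lt_const (half_pos hη), hGC, hE C hC] with ν hAν hGν hEν
  calc (P ν).real (E ν) ≤ (P ν).real (A ν) + (P ν).real (G C ν) :=
        (measureReal_mono hEν).trans (measureReal_union_le _ _)
    _ < η / 2 + η / 2 := add_lt_add_of_lt_of_le hAν hGν
    _ = η := add_halves η

end Convergence

namespace Model

variable {K : ℕ} {r : Fin K → ℕ}

theorem eventually_forall_eq_of_smallResid {Ω : ℕ → Type*} {S : ∀ ν, Model K r (Ω ν)}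
    {τ : ℕ → Fin K → ℝ} {ρ : ℕ → ℝ} {rbar : ℕ → Fin K → ℕ}
    {e : ∀ ν, Ω ν → ∀ k, Fin ((S ν).p k) → Fin ((S ν).p k) → ℝ}
    {rhat : ∀ ν, ℕ → Ω ν → Fin K → ℕ}
    (hrun : ∀ ν, (S ν).IsRun (τ ν) (ρ ν) (rbar ν) (e ν) (rhat ν))
    (he : ∀ ν w k, IsEigenbasis ((S ν).gammaHat (τ ν k) k w) (e ν w k))
    (hL : ∀ ν k, ((S ν).L k)ᵀ * (S ν).L k = ((S ν).p k : ℝ) • (1 : Matrix _ _ ℝ))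
    (hr : ∀ k, 1 ≤ r k) (hrbar : ∀ ν k, rbar ν k ≤ (S ν).p k) (hρ0 : ∀ ν, 0 < ρ ν)
    (hρ : Tendsto ρ atTop (𝓝 0)) {a b C : ℝ} (ha : 0 < a) (hb : 0 ≤ b)
    (haF : ∀ ν k, a • 1 ≤ (S ν).gammaF k) (hbF : ∀ ν k, (S ν).gammaF k ≤ b • 1) (hC : 0 < C)
    (m : ℕ) (k : Fin K) :
    ∀ᶠ ν in atTop, ∀ w, (∀ j, (S ν).SmallResid (τ ν j) (C * ρ ν) j w) →
      (∀ j, r j ≤ rhat ν m w j ∧ rhat ν m w j ≤ rbar ν j) → rhat ν (m + 1) w k = r k := by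
  set c := a * (1 / 2) ^ (K + 1) with hc
  have hc0 : 0 < c := by positivity
  have hlim {q : ℝ → ℝ} (hq : Continuous q) (hq0 : q 0 = 0) {δ : ℝ} (hδ : 0 < δ) :
      ∀ᶠ ν in atTop, q (ρ ν) < δ :=
    (hq0 ▸ (hq.tendsto 0).comp hρ).eventually_lt_const hδ
  filter_upwards [hlim (q := fun x => 12 * (C * x)) (by fun_prop) (by simp) ha,
    hlim (q := fun x => C * x) (by fun_prop) (by simp) hc0,
    hlim (q := fun x => 2 * (b + C * x) * (2 * (C * x) + x)) (by fun_prop) (by simp)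
      (mul_pos hc0 hc0),
    hlim (q := fun x => 2 * C * (2 * (C * x) + x)) (by fun_prop) (by simp) hc0]
    with ν hza hzc hbz hzρ w hsmall hprev
  refine (hrun ν).eq_of_smallResid (he ν w) (hL ν) hr (hrbar ν) hprev ha hb (haF ν) (hbF ν)
    (mul_pos hC (hρ0 ν)) hsmall (hρ0 ν) hza.le hc0 ?_ hbz ?_ k
  · rw [pow_succ] at hc
    linarith
  · calc 2 * (C * ρ ν) * (2 * (C * ρ ν) + ρ ν) = 2 * C * (2 * (C * ρ ν) + ρ ν) * ρ ν := by ring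
      _ < c * ρ ν := mul_lt_mul_of_pos_right hzρ (hρ0 ν)

section Assumptions

variable {Ω : Type*} {S : Model K r Ω}

theorem LoadingAssumption.transpose_mul_self {lbar : ℝ} (hL : S.LoadingAssumption lbar)
    (hp : ∀ k, 0 < S.p k) (k : Fin K) : (S.L k)ᵀ * S.L k = (S.p k : ℝ) • (1 : Matrix _ _ ℝ) := by
  rw [← (hL k).1, smul_inv_smul₀ (Nat.cast_ne_zero.mpr (hp k).ne')]

theorem FactorAssumption.smul_one_le_gammaF {α β : ∀ k, Fin (r k) → ℝ}
    (hF : S.FactorAssumption α β) {a : ℝ} (ha : ∀ k j, a ≤ α k j) (k : Fin K) :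
    a • 1 ≤ S.gammaF k := by
  rw [← (hF k).1.diagonal_diag, smul_one_eq_diagonal, Matrix.le_iff, diagonal_sub,
    posSemidef_diagonal_iff]
  exact fun j => sub_nonneg.mpr <| (ha k j).trans ((hF k).2 j).1

theorem FactorAssumption.gammaF_le_smul_one {α β : ∀ k, Fin (r k) → ℝ}
    (hF : S.FactorAssumption α β) {b : ℝ} (hb : ∀ k j, β k j ≤ b) (k : Fin K) :
    S.gammaF k ≤ b • 1 := by
  rw [← (hF k).1.diagonal_diag, smul_one_eq_diagonal, Matrix.le_iff, diagonal_sub,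
    posSemidef_diagonal_iff]
  exact fun j => sub_nonneg.mpr <| ((hF k).2 j).2.trans (hb k j)

variable [MeasurableSpace Ω] {P : Measure Ω} {ε om : ℝ}

theorem TailAssumption.noiseAssumption {M : ℝ} (hT : S.TailAssumption P ε om M)
    (hε : 0 < ε) (hom : 0 < om) : S.NoiseAssumption P ε (om ^ (2 + 2 * ε)) where
  measurable := hT.measurable
  centred := hT.centred
  memLp i t := ⟨(hT.measurable i t).aestronglyMeasurable,
    (hT.moment i t).trans_lt ENNReal.ofReal_lt_top⟩
  moment i t := by
    have hq : 0 < 2 + 2 * ε := by positivity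
    have hmem : MemLp (S.ξ i t) (ENNReal.ofReal (2 + 2 * ε)) P :=
      ⟨(hT.measurable i t).aestronglyMeasurable, (hT.moment i t).trans_lt ENNReal.ofReal_lt_top⟩
    have hnorm := hT.moment i t
    rw [hmem.eLpNorm_eq_integral_rpow_norm (ENNReal.ofReal_pos.mpr hq).ne' ENNReal.ofReal_ne_top,
      ENNReal.toReal_ofReal hq.le, ENNReal.ofReal_le_ofReal_iff hom.le,
      Real.rpow_inv_le_iff_of_pos (integral_nonneg fun _ => by positivity) hom.le hq] at hnorm
    exact hnorm

theorem DependenceAssumption.mixingAssumption {R : Regime} {c₀ cε : ℝ}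
    (hD : S.DependenceAssumption R P ε om c₀ cε) : S.MixingAssumption R P c₀ := by
  cases R with
  | indep => exact ⟨IndepAssumption.indep hD, IndepAssumption.mixing hD⟩
  | field => exact FieldAssumption.mixing hD

end Assumptions

theorem isLittleO_tauRate {Ω : ℕ → Type*} {S : ∀ ν, Model K r (Ω ν)} {R : Regime}
    {ε om s : ℝ} {M : ℕ → ℝ} {k : Fin K} (hn : Tendsto (fun ν => (S ν).n) atTop atTop)
    (hp : ∀ k, Tendsto (fun ν => (S ν).p k) atTop atTop) (hom : 0 < om) (hs : 0 ≤ s)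
    (hM : Tendsto (fun ν => M ν * ((S ν).tauRate R ε om k)⁻¹ *
      Real.log ((S ν).n * (S ν).pExcept k) ^ s) atTop (𝓝 0)) :
    M =o[atTop] fun ν => (S ν).tauRate R ε om k := by
  have hlarge : ∀ᶠ ν in atTop, 3 ≤ (S ν).n ∧ ∀ j, 0 < (S ν).p j :=
    (hn.eventually_ge_atTop 3).and (eventually_all.mpr fun j => (hp j).eventually_gt_atTop 0)
  refine (isLittleO_iff_tendsto' ?_).mpr (squeeze_zero_norm' ?_ (tendsto_norm_zero.comp hM))
  · filter_upwards [hlarge] with ν ⟨hn, hp⟩ hT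
    exact ((tauRate_pos hn hp hom).ne' hT).elim
  · filter_upwards [hlarge] with ν ⟨hn, hp⟩
    rw [Function.comp_apply, norm_mul, div_eq_mul_inv]
    refine le_mul_of_one_le_right (norm_nonneg _) ?_
    exact (Real.one_le_rpow (one_le_log_mul_pExcept hn hp) hs).trans (Real.le_norm_self _)

end Model

end TensorFactor

open scoped MatrixOrder in
theorem mainTheorem5_general {K : ℕ} {r : Fin K → ℕ} (hr : ∀ k, 1 ≤ r k) {Ω : ℕ → Type*}
    [∀ ν, MeasurableSpace (Ω ν)] (P : ∀ ν, Measure (Ω ν)) [∀ ν, IsProbabilityMeasure (P ν)]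
    (S : ∀ ν, TensorFactor.Model K r (Ω ν)) (hn : Tendsto (fun ν => (S ν).n) atTop atTop)
    (hp : ∀ k, Tendsto (fun ν => (S ν).p k) atTop atTop) (R : TensorFactor.Regime)
    (ε om c₀ a b : ℝ) (hε : 0 < ε) (hε1 : ε < 1) (hom : 0 < om) (hc₀ : 0 < c₀) (ha : 0 < a)
    (haF : ∀ ν k, a • 1 ≤ (S ν).gammaF k) (hbF : ∀ ν k, (S ν).gammaF k ≤ b • 1)
    (hL : ∀ ν k, ((S ν).L k).transpose * (S ν).L k = ((S ν).p k : ℝ) • (1 : Matrix _ _ ℝ))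
    (hN : ∀ ν, (S ν).NoiseAssumption (P ν) ε (om ^ (2 + 2 * ε)))
    (hS : ∀ ν, (S ν).MixingAssumption R (P ν) c₀) (τ : ℕ → Fin K → ℝ)
    (hτ0 : ∀ k, ∀ᶠ ν in atTop, (S ν).SmallSignal (τ ν k))
    (hτ : ∀ k, (fun ν => τ ν k) =Θ[atTop] fun ν => (S ν).tauRate R ε om k)
    (ρ : ℕ → ℝ) (hρ0 : ∀ ν, 0 < ρ ν) (hρ : Tendsto ρ atTop (𝓝 0))
    (hψρ : (fun ν => ∑ k, max ((S ν).psi R ε om k) (1 / ((S ν).p k : ℝ))) =O[atTop] ρ)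
    (rbar : ℕ → Fin K → ℕ) (hrbar : ∀ ν k, rbar ν k < (S ν).p k)
    (e : ∀ ν, Ω ν → ∀ k, Fin ((S ν).p k) → Fin ((S ν).p k) → ℝ)
    (he : ∀ ν w k, TensorFactor.IsEigenbasis ((S ν).gammaHat (τ ν k) k w) (e ν w k))
    (rhat : ∀ ν, ℕ → Ω ν → Fin K → ℕ)
    (hrun : ∀ ν, (S ν).IsRun (τ ν) (ρ ν) (rbar ν) (e ν) (rhat ν)) (m : ℕ)
    (hprev : Tendsto (fun ν => P ν {w | ¬ ∀ k, r k ≤ rhat ν m w k ∧ rhat ν m w k ≤ rbar ν k})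
      atTop (𝓝 0)) (k : Fin K) :
    Tendsto (fun ν => P ν {w | rhat ν (m + 1) w k = r k}) atTop (𝓝 1) ∧
      Tendsto (fun ν => P ν {w | rhat ν (m + 1) w k ≠ r k}) atTop (𝓝 0) := by
  have hbF' (ν k) : (S ν).gammaF k ≤ max b 0 • 1 :=
    (hbF ν k).trans (smul_le_smul_of_nonneg_right (le_max_left b 0) Matrix.PosSemidef.one.nonneg)
  have hne : Tendsto (fun ν => P ν {w | rhat ν (m + 1) w k ≠ r k}) atTop (𝓝 0) := by
    refine TensorFactor.tendsto_measure_zero_of_subset_union hprev (fun η hη =>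
      TensorFactor.Model.exists_eventually_measureReal_not_forall_smallResid_le
        hn hp hε hε1 hom hc₀ hN hS hτ0 hτ hρ0 hρ hψρ hη) fun C hC => ?_
    filter_upwards [TensorFactor.Model.eventually_forall_eq_of_smallResid hrun he hL hr
      (fun ν k => (hrbar ν k).le) hρ0 hρ ha (le_max_right b 0) haF hbF' hC m k] with ν hν w hw
    by_contra hgood
    obtain ⟨hrange, hsmall⟩ := not_or.mp hgood
    exact hw (hν w (not_not.mp hsmall) (not_not.mp hrange))
  exact ⟨TensorFactor.tendsto_measure_one_of_tendsto_compl hne, hne⟩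

theorem mainTheorem5 {K : ℕ} {r : Fin K → ℕ} (hr : ∀ k, 1 ≤ r k)
    -- a sequence of models with growing sample size and dimensions
    {Ω : ℕ → Type*} [∀ ν, MeasurableSpace (Ω ν)] (P : ∀ ν, Measure (Ω ν))
    [∀ ν, IsProbabilityMeasure (P ν)] (S : ∀ ν, TensorFactor.Model K r (Ω ν))
    (hn : Tendsto (fun ν => (S ν).n) atTop atTop)
    (hp : ∀ k, Tendsto (fun ν => (S ν).p k) atTop atTop)
    -- the fixed constants
    (R : TensorFactor.Regime) (lbar ε om c₀ cε : ℝ) (α β : ∀ k, Fin (r k) → ℝ)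
    (hε : 0 < ε) (hε1 : ε < 1) (hom : 0 < om) (hc₀ : 0 < c₀) (hcε : 0 < cε)
    (hα : ∀ k j, 0 < α k j) (hαβ : ∀ k (i j : Fin (r k)), i < j → β k j < α k i)
    -- the model assumptions
    (M : ℕ → ℝ)
    (hL : ∀ ν, (S ν).LoadingAssumption lbar)
    (hF : ∀ ν, (S ν).FactorAssumption α β)
    (hT : ∀ ν, (S ν).TailAssumption (P ν) ε om (M ν))
    (hD : ∀ ν, (S ν).DependenceAssumption R (P ν) ε om c₀ cε)
    -- the truncation levels
    (τ : ℕ → Fin K → ℝ) (hτ0 : ∀ ν k, 0 < τ ν k)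
    (hτ : ∀ k, (fun ν => τ ν k) =Θ[atTop] fun ν => (S ν).tauRate R ε om k)
    (hM : ∀ k, Tendsto (fun ν => M ν * ((S ν).tauRate R ε om k)⁻¹ *
      Real.log ((S ν).n * (S ν).pExcept k) ^ (1 / (2 * ε))) atTop (𝓝 0))
    -- the penalty and the maximal factor numbers
    (ρ : ℕ → ℝ) (hρ0 : ∀ ν, 0 < ρ ν) (hρ : Tendsto ρ atTop (𝓝 0))
    (hψρ : (fun ν => ∑ k, max ((S ν).psi R ε om k) (1 / ((S ν).p k : ℝ))) =O[atTop] ρ)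
    (rbar : ℕ → Fin K → ℕ) (hrbar : ∀ ν k, 1 ≤ rbar ν k ∧ rbar ν k + 1 ≤ (S ν).p k)
    -- the eigenvectors of the truncated second moment matrices, and a run of the procedure
    (e : ∀ ν, Ω ν → ∀ k, Fin ((S ν).p k) → Fin ((S ν).p k) → ℝ)
    (he : ∀ ν w k, TensorFactor.IsEigenbasis ((S ν).gammaHat (τ ν k) k w) (e ν w k))
    (rhat : ∀ ν, ℕ → Ω ν → Fin K → ℕ)
    (hrun : ∀ ν, (S ν).IsRun (τ ν) (ρ ν) (rbar ν) (e ν) (rhat ν))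
    -- the previous iterate lies in the required range with probability tending to one
    (m : ℕ) (hm : 1 ≤ m)
    (hprev : Tendsto (fun ν => P ν {w | ¬ ∀ k, r k ≤ rhat ν (m - 1) w k ∧
      rhat ν (m - 1) w k ≤ rbar ν k}) atTop (𝓝 0)) :
    ∀ k, Tendsto (fun ν => P ν {w | rhat ν m w k = r k}) atTop (𝓝 1) ∧
      Tendsto (fun ν => P ν {w | rhat ν m w k ≠ r k}) atTop (𝓝 0) := by
  obtain ⟨m, rfl⟩ := Nat.exists_eq_add_of_le' hm
  obtain ⟨⟨a, ha⟩, haα⟩ := Finite.exists_ge fun x : Σ k, Fin (r k) =>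
    (⟨α x.1 x.2, hα x.1 x.2⟩ : Set.Ioi (0 : ℝ))
  obtain ⟨b, hβb⟩ := Finite.exists_le fun x : Σ k, Fin (r k) => β x.1 x.2
  have hp0 (ν k) : 0 < (S ν).p k := Nat.zero_lt_of_lt (hrbar ν k).2
  have hMτ (k) : M =o[atTop] fun ν => τ ν k :=
    (TensorFactor.Model.isLittleO_tauRate hn hp hom (by positivity) (hM k)).trans_isBigO
      (hτ k).isBigO_symm
  exact mainTheorem5_general hr P S hn hp R ε om c₀ a b hε hε1 hom hc₀ ha
    (fun ν => (hF ν).smul_one_le_gammaF fun k j => haα ⟨k, j⟩)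
    (fun ν => (hF ν).gammaF_le_smul_one fun k j => hβb ⟨k, j⟩)
    (fun ν => (hL ν).transpose_mul_self (hp0 ν)) (fun ν => (hT ν).noiseAssumption hε hom)
    (fun ν => (hD ν).mixingAssumption) τ
    (fun k => TensorFactor.Model.eventually_smallSignal (fun ν k => (hL ν k).2)
      (fun ν => (hT ν).factor_bound) (fun ν => hτ0 ν k) (hMτ k))
    hτ ρ hρ0 hρ hψρ rbar (fun ν k => (hrbar ν k).2) e he rhat hrun m hprev
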